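/- Let $\Omega_{r,s}=\{Z\in M(r,s,\mathbb C): I-ZZ^*>0\}$ be the bounded symmetric domain of type I, and let $D_{r,s}\subset\mathbb P^{r+s-1}$ be the generalized ball of all $[z_1,\dots,z_{r+s}]$ with $|z_1|^2+\dots+|z_r|^2>|z_{r+1}|^2+\dots+|z_{r+s}|^2$. For $X=[A,B]\in D_{r,s}$ (with $A\in\mathbb C^{1\times r}$, $B\in\mathbb C^{1\times s}$) put $X^\#=\{Z\in\Omega_{r,s}: AZ=B\}$; these are the maximal invariantly geodesic subspaces of $\Omega_{r,s}$. Two maps $f,g:\Omega\to\Omega'$ are equivalent if $f=\alpha\circ g\circ\beta$ with $\beta\in\mathrm{Aut}(\Omega)$, $\alpha\in\mathrm{Aut}(\Omega')$. A rational map $g=[g_1,\dots,g_{r'+s'}]$ from $\mathbb P^{r+s-1}$ to $\mathbb P^{r'+s'-1}$ is written with homogeneous polynomials $g_k$ of one degree $\deg g$ without common factor; its indeterminacy $I(g)$ is the set of their common zeros. It is called monomial if every $g_k$ is a constant multiple (possibly zero) of a monomial. It is called a proper rational map $D_{r,s}\to D_{r',s'}$ if $g(D_{r,s}\setminus I(g))\subset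 D_{r',s'}$ and, whenever a point of $D_{r,s}\setminus I(g)$ tends to a point of $\partial D_{r,s}\setminus I(g)$, its image under $g$ leaves every compact subset of $D_{r',s'}$. **Theorem.** Let $r\ge2$ and let $f:\Omega_{r,r}\to\Omega_{r+1,r+1}$ be a proper holomorphic map which preserves the maximal invariantly geodesic subspaces, i.e. for every $X\in D_{r,r}$ there is $Y\in D_{r+1,r+1}$ with $f(X^\#)\subset Y^\#$. Suppose that there is a proper monomial rational map $g:D_{r,r}\to D_{r+1,r+1}$ inducing the map on these subspaces, i.e. $f(X^\#)\subset g(X)^\#$ for generic $X\in D_{r,r}$ (all $X$ in an open dense subset at which $g$ is defined). If $\deg g\ge3$, suppose moreover that the real polynomial $P$ with $P(|z_1|^2,\dots,|z_{2r}|^2)=\sum_{k\le r+1}|g_k(z)|^2-\sum_{k>r+1}|g_k(z)|^2$ can be written as $$P(x)=(x_1+\dots+x_r-x_{r+1}-\dots-x_{2r})^m\,Q(x)$$ with an integer $m\ge1$ and a homogeneous polynomial $Q$ which has degree one or nonnegative coefficients. Then $f$ is equivalent to one of the following maps: 1. $Z\mapsto\begin{pmatrix}Z&0\\0&h(Z)\end{pmatrix}$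 with a holomorphic $h:\Omega_{r,r}\to\Delta=\{z\in\mathbb C:|z|<1\}$; 2. ($r=2$) $\begin{pmatrix}z_1&z_2\\z_3&z_4\end{pmatrix}\mapsto \begin{pmatrix}z_1^2&z_1z_2&z_2\\z_1z_3&z_2z_3&z_4\\z_3&z_4&0\end{pmatrix}$; 3. ($r=2$) $\begin{pmatrix}z_1&z_2\\z_3&z_4\end{pmatrix}\mapsto \begin{pmatrix}z_1^2&\sqrt2z_1z_2&z_2^2\\\sqrt2z_1z_3&z_1z_4+z_2z_3&\sqrt2z_2z_4\\z_3^2&\sqrt2z_3z_4&z_4^2\end{pmatrix}$. -/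

import Mathlib

open scoped ComplexOrder LinearAlgebra.Projectivization

attribute [local instance] Matrix.normedAddCommGroup Matrix.normedSpace

noncomputable section

namespace TypeI

/-! Type I domains and generalized balls. -/

/-- The bounded symmetric domain of type I, `{Z ∈ M(r,s,ℂ) : I - Z Z* > 0}`. The space of matrices
carries the entrywise sup norm, which induces the usual topology. -/
def Omega (r s : ℕ) : Set (Matrix (Fin r) (Fin s) ℂ) :=
  {Z | (1 - Z * Z.conjTranspose).PosDef}

/-- The projective space with homogeneous coordinates `[z_1, …, z_r, w_1, …, w_s]`. -/
abbrev Proj (r s : ℕ) : Type := ℙ ℂ (Fin r ⊕ Fin s → ℂ)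

/-- The quotient topology on projective space. -/
instance projTopology (r s : ℕ) : TopologicalSpace (Proj r s) :=
  TopologicalSpace.coinduced
    (Projectivization.mk' ℂ : {v : Fin r ⊕ Fin s → ℂ // v ≠ 0} → Proj r s) inferInstance

/-- The indefinite form `|z_1|² + … + |z_r|² - |w_1|² - … - |w_s|²`. -/
def form {r s : ℕ} (v : Fin r ⊕ Fin s → ℂ) : ℝ :=
  ∑ i, ‖v (Sum.inl i)‖ ^ 2 - ∑ j, ‖v (Sum.inr j)‖ ^ 2

/-- The generalized ball: the points of projective space where the indefinite form is positive. -/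
def GenBall (r s : ℕ) : Set (Proj r s) := {X | 0 < form X.rep}

theorem form_smul {r s : ℕ} (a : ℂ) (v : Fin r ⊕ Fin s → ℂ) :
    form (a • v) = ‖a‖ ^ 2 * form v := by
  simp [form, mul_pow, mul_sub, Finset.mul_sum]

theorem mk_mem_genBall {r s : ℕ} (v : Fin r ⊕ Fin s → ℂ) (hv : v ≠ 0) :
    Projectivization.mk ℂ v hv ∈ GenBall r s ↔ 0 < form v := by
  obtain ⟨a, ha⟩ := Projectivization.exists_smul_eq_mk_rep ℂ v hv
  have h : (0 : ℝ) < ‖(a : ℂ)‖ ^ 2 := by have := a.ne_zero; positivity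
  show 0 < form _ ↔ _
  rw [← ha, Units.smul_def, form_smul, mul_pos_iff_of_pos_left h]

/-- The subspace `X^# = {Z ∈ Ω_{r,s} : A Z = B}` of the type I domain attached to `X = [A, B]`. For
`X` in the generalized ball these are the maximal invariantly geodesic subspaces. -/
def sharp {r s : ℕ} (X : Proj r s) : Set (Matrix (Fin r) (Fin s) ℂ) :=
  {Z | Z ∈ Omega r s ∧
    Matrix.vecMul (fun i => X.rep (Sum.inl i)) Z = fun j => X.rep (Sum.inr j)}

theorem mem_sharp_mk {r s : ℕ} (v : Fin r ⊕ Fin s → ℂ) (hv : v ≠ 0)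
    (Z : Matrix (Fin r) (Fin s) ℂ) :
    Z ∈ sharp (Projectivization.mk ℂ v hv) ↔
      Z ∈ Omega r s ∧ Matrix.vecMul (fun i => v (Sum.inl i)) Z = fun j => v (Sum.inr j) := by
  obtain ⟨a, ha⟩ := Projectivization.exists_smul_eq_mk_rep ℂ v hv
  have e1 : (fun i => (a • v) (Sum.inl i)) = a • fun i => v (Sum.inl i) := rfl
  have e2 : (fun i => (a • v) (Sum.inr i)) = a • fun i => v (Sum.inr i) := rfl
  show (_ ∧ _) ↔ _
  rw [← ha, e1, e2, Matrix.smul_vecMul, (MulAction.injective a).eq_iff]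

/-! Holomorphic maps between domains. -/

/-- `f` restricts to a proper holomorphic map `U → V`: the preimage in `U` of every compact subset
of `V` is compact. -/
def IsProperHolo {E F : Type*} [NormedAddCommGroup E] [NormedSpace ℂ E]
    [NormedAddCommGroup F] [NormedSpace ℂ F] (U : Set E) (V : Set F) (f : E → F) : Prop :=
  DifferentiableOn ℂ f U ∧ Set.MapsTo f U V ∧ ∀ K ⊆ V, IsCompact K → IsCompact (U ∩ f ⁻¹' K)

/-- `φ` restricts to a holomorphic automorphism of `U`. -/
def IsAut {E : Type*} [NormedAddCommGroup E] [NormedSpace ℂ E] (U : Set E) (φ : E → E) : Prop :=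
  DifferentiableOn ℂ φ U ∧ Set.MapsTo φ U U ∧
    ∃ ψ : E → E, DifferentiableOn ℂ ψ U ∧ Set.MapsTo ψ U U ∧
      Set.LeftInvOn ψ φ U ∧ Set.RightInvOn ψ φ U

/-- `f` and `g` are equivalent as maps `U → V`: `f = A ∘ g ∘ B` with `B ∈ Aut(U)`, `A ∈ Aut(V)`. -/
def MapEquivalent {E F : Type*} [NormedAddCommGroup E] [NormedSpace ℂ E]
    [NormedAddCommGroup F] [NormedSpace ℂ F] (U : Set E) (V : Set F) (f g : E → F) : Prop :=
  ∃ (B : E → E) (A : F → F), IsAut U B ∧ IsAut V A ∧ Set.EqOn f (A ∘ g ∘ B) U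

/-! Rational maps between projective spaces. -/

/-- A rational map of projective spaces, given in homogeneous coordinates by homogeneous polynomials
of one degree without common factor. -/
structure RatMap (r s r' s' : ℕ) where
  comp : Fin r' ⊕ Fin s' → MvPolynomial (Fin r ⊕ Fin s) ℂ
  degree : ℕ
  homogeneous : ∀ k, (comp k).IsHomogeneous degree
  no_common_factor : ∀ p : MvPolynomial (Fin r ⊕ Fin s) ℂ, (∀ k, p ∣ comp k) → IsUnit p

namespace RatMap

variable {r s r' s' : ℕ}

/-- The values of the homogeneous components. -/
def evalVec (g : RatMap r s r' s') (v : Fin r ⊕ Fin s → ℂ) : Fin r' ⊕ Fin s' → ℂ :=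
  fun k => MvPolynomial.eval v (g.comp k)

/-- The indeterminacy set: the common zeros of the components. -/
def indeterminacy (g : RatMap r s r' s') : Set (Proj r s) := {X | g.evalVec X.rep = 0}

/-- The value of the rational map outside its indeterminacy. -/
def toFun (g : RatMap r s r' s') (X : Proj r s) (hX : X ∉ g.indeterminacy) : Proj r' s' :=
  Projectivization.mk ℂ (g.evalVec X.rep) hX

/-- All components are monomials (possibly with a constant coefficient, possibly zero). -/
def IsMonomial (g : RatMap r s r' s') : Prop :=
  ∀ k, ∃ (e : (Fin r ⊕ Fin s) →₀ ℕ) (c : ℂ), g.comp k = MvPolynomial.monomial e c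

/-- `g` is a proper rational map between the generalized balls: outside the indeterminacy it maps
`D_{r,s}` into `D_{r',s'}`, and near each boundary point outside the indeterminacy it is proper, that
is, it leaves every compact subset of `D_{r',s'}` as the boundary point is approached in
`D_{r,s}`. -/
def IsProper (g : RatMap r s r' s') : Prop :=
  (∀ X ∈ GenBall r s, ∀ hX : X ∉ g.indeterminacy, g.toFun X hX ∈ GenBall r' s') ∧
  ∀ X ∈ frontier (GenBall r s), X ∉ g.indeterminacy →
    ∀ K ⊆ GenBall r' s', IsCompact K →
      ∃ U : Set (Proj r s), IsOpen U ∧ X ∈ U ∧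
        ∀ Y ∈ U ∩ GenBall r s, ∀ hY : Y ∉ g.indeterminacy, g.toFun Y hY ∉ K

/-- `P` is the real polynomial with
`P(|z_1|², …, |z_{r+s}|²) = ∑_{k ≤ r'} |g_k(z)|² - ∑_{k > r'} |g_k(z)|²`. -/
def IsNormPoly (g : RatMap r s r' s') (P : MvPolynomial (Fin r ⊕ Fin s) ℝ) : Prop :=
  ∀ z : Fin r ⊕ Fin s → ℂ, MvPolynomial.eval (fun i => ‖z i‖ ^ 2) P = form (g.evalVec z)

/-- The condition imposed in degree at least three: the polynomial `P` of `g` factors as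
`(x_1 + … + x_r - x_{r+1} - … - x_{r+s})^m Q` with `m ≥ 1` and `Q` homogeneous such that `Q` has
degree one or nonnegative coefficients. -/
def QuotientCondition (g : RatMap r s r' s') : Prop :=
  3 ≤ g.degree →
    ∃ (P Q : MvPolynomial (Fin r ⊕ Fin s) ℝ) (m d : ℕ), g.IsNormPoly P ∧ 1 ≤ m ∧
      Q.IsHomogeneous d ∧
      P = (∑ i, MvPolynomial.X (Sum.inl i) - ∑ j, MvPolynomial.X (Sum.inr j)) ^ m * Q ∧
      (d = 1 ∨ ∀ e, 0 ≤ Q.coeff e)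

end RatMap

/-- `f` preserves the maximal invariantly geodesic subspaces. -/
def PreservesSharp {r s r' s' : ℕ} (f : Matrix (Fin r) (Fin s) ℂ → Matrix (Fin r') (Fin s') ℂ) :
    Prop :=
  ∀ X ∈ GenBall r s, ∃ Y ∈ GenBall r' s', Set.MapsTo f (sharp X) (sharp Y)

/-- `g` is induced by `f`: `f(X^#) ⊆ g(X)^#` for generic `X ∈ D_{r,s}`, here for the points `X` of
an open dense subset of `D_{r,s}` at which `g` is defined. -/
def Induces {r s r' s' : ℕ} (f : Matrix (Fin r) (Fin s) ℂ → Matrix (Fin r') (Fin s') ℂ)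
    (g : RatMap r s r' s') : Prop :=
  ∃ U : Set (Proj r s), IsOpen U ∧ GenBall r s ⊆ closure (U ∩ GenBall r s) ∧
    ∀ X ∈ U ∩ GenBall r s, ∀ hX : X ∉ g.indeterminacy,
      Set.MapsTo f (sharp X) (sharp (g.toFun X hX))

/-! The model maps. -/

/-- `Z ↦ diag(Z, h(Z))`. -/
def diagMap {r : ℕ} (h : Matrix (Fin r) (Fin r) ℂ → ℂ) (Z : Matrix (Fin r) (Fin r) ℂ) :
    Matrix (Fin (r + 1)) (Fin (r + 1)) ℂ :=
  Matrix.reindex finSumFinEquiv finSumFinEquiv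
    (Matrix.fromBlocks Z 0 0 (Matrix.of fun (_ _ : Fin 1) => h Z))

/-- The first quadratic map, with `Z = (z_1, z_2; z_3, z_4)`. -/
def quadMapA (Z : Matrix (Fin 2) (Fin 2) ℂ) : Matrix (Fin 3) (Fin 3) ℂ :=
  !![Z 0 0 ^ 2, Z 0 0 * Z 0 1, Z 0 1;
     Z 0 0 * Z 1 0, Z 0 1 * Z 1 0, Z 1 1;
     Z 1 0, Z 1 1, 0]

/-- The second quadratic map, with `Z = (z_1, z_2; z_3, z_4)`. -/
def quadMapB (Z : Matrix (Fin 2) (Fin 2) ℂ) : Matrix (Fin 3) (Fin 3) ℂ :=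
  !![Z 0 0 ^ 2, (√2 : ℝ) * Z 0 0 * Z 0 1, Z 0 1 ^ 2;
     (√2 : ℝ) * Z 0 0 * Z 1 0, Z 0 0 * Z 1 1 + Z 0 1 * Z 1 0, (√2 : ℝ) * Z 0 1 * Z 1 1;
     Z 1 0 ^ 2, (√2 : ℝ) * Z 1 0 * Z 1 1, Z 1 1 ^ 2]

/-- A map from `2 × 2` to `3 × 3` matrices viewed as one from `r × r` to `(r+1) × (r+1)` matrices
when `r = 2`. -/
def castMap {r : ℕ} (hr : r = 2) (F : Matrix (Fin 2) (Fin 2) ℂ → Matrix (Fin 3) (Fin 3) ℂ)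
    (Z : Matrix (Fin r) (Fin r) ℂ) : Matrix (Fin (r + 1)) (Fin (r + 1)) ℂ :=
  have h3 : r + 1 = 3 := by omega
  (F (Z.submatrix (Fin.cast hr.symm) (Fin.cast hr.symm))).submatrix (Fin.cast h3) (Fin.cast h3)

end TypeI

end

/-! Write `L` for `x_1 + … + x_r - y_1 - … - y_r`. The norm polynomial `P` of a monomial map has at
most `r + 1` positive and at most `r + 1` negative coefficients, since each monomial of `P` uses up
a component of `g` of matching sign. Properness makes `P` vanish on the part of `L = 0` in the
positive orthant (`IsProper.form_eq_zero`), so `L` divides `P`; in degree at least three the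
factorization `P = L^m Q` is assumed. Moreover `Q` has nonnegative coefficients (`linear_nonneg`
when it is linear), and no variable divides `Q`, because the components of `g` have no common
factor.

It remains to find all such `Q` for which `L^m Q` has so few monomials. Grade monomials by their
degree in the `x_i`. The products of the top layer of `Q` with the `x_i` cannot be cancelled, and
neither can the products of the bottom layer with the `y_j`; each group has at least `r` elements.
So at most one positive monomial comes from below the top layer and at most one negative monomial
from above the bottom layer, and all other products cancel. This excludes `m ≥ 2`
(`pow_eq_one_of_nonneg`) and leaves, up to a positive factor, `Q = 1`, or `r = 2` with `Q = x_i +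
y_j` or `Q` the sum of all variables (`support_classification`, `quotient_classification`).

To return to `f`, a limit argument turns the inclusion for generic `X` into the identity `u f(Z) =
v` with `(u, v) = g(A, AZ)`, for all `Z` in the domain and all `A ≠ 0` (`Induces.intertwines`). In
the two quadratic cases `P` determines the components of `g` up to order, phases and a common
factor. Permutations and phases are automorphisms of the target, and varying `A` then determines `f`
(`equivalent_quadMapA`, `equivalent_quadMapB`).

If `Q` is constant, `g` is a multiple of a linear isometry of indefinite forms. A Witt extension and
a fractional linear automorphism bring `f` to the shape with first rows `(Z, 0)` and last row
`(c(Z), h(Z))` (`equivalent_diagMap`). At `Z = aU` with `U` unitary, membership in the domain forces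
`|c_j|² ≤ 1 - |a|²`, and the maximum principle on the disc of all `a` gives `c_j(aU) = 0`. The
matrices `aU` form a set of uniqueness for holomorphic functions, as a one-parameter family of
Cayley transforms shows (`eq_zero_of_unitary`), so `c = 0`. -/

/-! ### Combinatorics of the support of the quotient. -/

/-- The combinatorial shadow of a product `(∑ x_i - ∑ y_j) * Q` where `Q` has nonnegative
coefficients with support `S`: each product of an element of `S` with an `x_i` is cancelled or
contributes to `Pos`, and dually for the `y_j` and `Neg`. -/
structure SignConfig (r : ℕ) (M : Type*) [AddCommMonoid M] [IsCancelAdd M] where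
  x : Fin r → M
  y : Fin r → M
  xp : M →+ (Fin r → ℕ)
  yp : M →+ (Fin r → ℕ)
  xp_x : ∀ i, xp (x i) = Pi.single i 1
  xp_y : ∀ j, xp (y j) = 0
  yp_y : ∀ j, yp (y j) = Pi.single j 1
  yp_x : ∀ i, yp (x i) = 0
  ext : ∀ s t, xp s = xp t → yp s = yp t → s = t
  S : Finset M
  Pos : Finset M
  Neg : Finset M
  d : ℕ
  deg : ∀ s ∈ S, ∑ i, xp s i + ∑ j, yp s j = d
  pos : ∀ s ∈ S, ∀ i, s + x i ∈ Pos ∨ ∃ t ∈ S, ∃ j, t + y j = s + x i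
  neg : ∀ s ∈ S, ∀ j, s + y j ∈ Neg ∨ ∃ t ∈ S, ∃ i, t + x i = s + y j
  card_pos : Pos.card ≤ r + 1
  card_neg : Neg.card ≤ r + 1
  no_factor_x : ∀ i, ∃ s ∈ S, xp s i = 0
  no_factor_y : ∀ j, ∃ s ∈ S, yp s j = 0

namespace SignConfig

variable {r : ℕ} {M : Type*} [AddCommMonoid M] [IsCancelAdd M]

/-- Exchange the roles of the positive and the negative variables. -/
def swap (C : SignConfig r M) : SignConfig r M where
  x := C.y
  y := C.x
  xp := C.yp
  yp := C.xp
  xp_x := C.yp_y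
  xp_y := C.yp_x
  yp_y := C.xp_x
  yp_x := C.xp_y
  ext := fun s t h1 h2 => C.ext s t h2 h1
  S := C.S
  Pos := C.Neg
  Neg := C.Pos
  d := C.d
  deg := fun s hs => by rw [add_comm]; exact C.deg s hs
  pos := C.neg
  neg := C.pos
  card_pos := C.card_neg
  card_neg := C.card_pos
  no_factor_x := C.no_factor_y
  no_factor_y := C.no_factor_x

/-- The degree in the positive variables. -/
def xd (C : SignConfig r M) (s : M) : ℕ := ∑ i, C.xp s i

variable (C : SignConfig r M)

theorem xd_add_x (s : M) (i : Fin r) : C.xd (s + C.x i) = C.xd s + 1 := by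
  simp [xd, C.xp_x, Finset.sum_add_distrib]

theorem xd_add_y (s : M) (j : Fin r) : C.xd (s + C.y j) = C.xd s := by
  simp [xd, C.xp_y]

theorem xd_add_swap_xd {s : M} (hs : s ∈ C.S) : C.xd s + C.swap.xd s = C.d := C.deg s hs

theorem xd_of_eq {s t : M} {i j : Fin r} (h : t + C.x i = s + C.y j) : C.xd t + 1 = C.xd s := by
  rw [← C.xd_add_x t i, h, xd_add_y]

theorem xp_of_eq {s t : M} {i j : Fin r} (h : t + C.x i = s + C.y j) (c : Fin r) :
    C.xp t c + (if c = i then 1 else 0) = C.xp s c := by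
  have := congrFun (congrArg C.xp h) c
  simpa [C.xp_x, C.xp_y, Pi.single_apply] using this

theorem yp_of_eq {s t : M} {i j : Fin r} (h : t + C.x i = s + C.y j) (c : Fin r) :
    C.yp t c = C.yp s c + (if c = j then 1 else 0) := by
  have := congrFun (congrArg C.yp h) c
  simpa [C.yp_x, C.yp_y, Pi.single_apply] using this

theorem xp_of_eq_x {s t : M} {i j : Fin r} (h : t + C.x i = s + C.x j) (c : Fin r) :
    C.xp t c + (if c = i then 1 else 0) = C.xp s c + (if c = j then 1 else 0) := by
  have := congrFun (congrArg C.xp h) c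
  simpa [C.xp_x, Pi.single_apply] using this

theorem yp_of_eq_x {s t : M} {i j : Fin r} (h : t + C.x i = s + C.x j) (c : Fin r) :
    C.yp t c = C.yp s c := by
  have := congrFun (congrArg C.yp h) c
  simpa [C.yp_x] using this

theorem x_injective : Function.Injective C.x := fun i j h => by
  have := congrFun (congrArg C.xp h) i
  by_contra hne
  simp [C.xp_x, hne] at this

/-- A cancelling product `t + y j` would need `t` in a layer above the top one. -/
theorem add_x_mem_pos {k : ℕ} (hk : ∀ s ∈ C.S, C.xd s ≤ k) {s : M} (hs : s ∈ C.S)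
    (hsk : C.xd s = k) (i : Fin r) : s + C.x i ∈ C.Pos := by
  rcases C.pos s hs i with h | ⟨t, ht, j, h⟩
  · exact h
  · have := C.xd_of_eq h.symm
    have := hk t ht
    omega

theorem swap_xd_le {l : ℕ} (hl : ∀ s ∈ C.S, l ≤ C.xd s) {s : M} (hs : s ∈ C.S) (hsl : C.xd s = l) :
    ∀ t ∈ C.S, C.swap.xd t ≤ C.swap.xd s := fun t ht => by
  have := C.xd_add_swap_xd hs
  have := C.xd_add_swap_xd ht
  have := hl t ht
  omega

theorem add_y_mem_neg {l : ℕ} (hl : ∀ s ∈ C.S, l ≤ C.xd s) {s : M} (hs : s ∈ C.S)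
    (hsl : C.xd s = l) (j : Fin r) : s + C.y j ∈ C.Neg :=
  C.swap.add_x_mem_pos (C.swap_xd_le hl hs hsl) hs rfl j

/-- Outside the top layer there is at most one positive monomial. -/
theorem pos_unique {k : ℕ} (hk : ∀ s ∈ C.S, C.xd s ≤ k) {e : M} (he : e ∈ C.S) (hek : C.xd e = k)
    {s t : M} {i j : Fin r} (hs : C.xd s ≠ k) (ht : C.xd t ≠ k) (hsp : s + C.x i ∈ C.Pos)
    (htp : t + C.x j ∈ C.Pos) : s + C.x i = t + C.x j := by
  classical
  by_contra hne
  have hinj : Function.Injective fun i => e + C.x i := fun a b h =>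
    C.x_injective (add_left_cancel h)
  -- The `r` products of `e` already fill all but one of the places in `Pos`.
  have hsub : insert (s + C.x i) (insert (t + C.x j) (Finset.univ.image fun i => e + C.x i)) ⊆
      C.Pos := by
    intro p hp
    simp only [Finset.mem_insert, Finset.mem_image, Finset.mem_univ, true_and] at hp
    rcases hp with rfl | rfl | ⟨a, rfl⟩
    · exact hsp
    · exact htp
    · exact C.add_x_mem_pos hk he hek a
  have h1 : ∀ (u : M) (a : Fin r), C.xd u ≠ k →
      u + C.x a ∉ Finset.univ.image fun i => e + C.x i := by
    intro u a hu h
    simp only [Finset.mem_image, Finset.mem_univ, true_and] at h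
    obtain ⟨b, hb⟩ := h
    have := C.xd_add_x e b
    rw [hb, C.xd_add_x] at this
    omega
  have h2 := Finset.card_le_card hsub
  rw [Finset.card_insert_of_notMem, Finset.card_insert_of_notMem (h1 t j ht),
    Finset.card_image_of_injective _ hinj, Finset.card_univ, Fintype.card_fin] at h2
  · have := C.card_pos
    omega
  · rw [Finset.mem_insert, not_or]
    exact ⟨hne, h1 s i hs⟩

theorem neg_unique {l : ℕ} (hl : ∀ s ∈ C.S, l ≤ C.xd s) {e : M} (he : e ∈ C.S) (hel : C.xd e = l)
    {s t : M} {i j : Fin r} (hsS : s ∈ C.S) (htS : t ∈ C.S) (hs : C.xd s ≠ l) (ht : C.xd t ≠ l)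
    (hsp : s + C.y i ∈ C.Neg) (htp : t + C.y j ∈ C.Neg) : s + C.y i = t + C.y j := by
  have h1 := C.xd_add_swap_xd he
  have h2 := C.xd_add_swap_xd hsS
  have h3 := C.xd_add_swap_xd htS
  exact C.swap.pos_unique (C.swap_xd_le hl he hel) he rfl (by omega) (by omega) hsp htp

theorem exists_pair_ne (hr : 3 ≤ r) (i j : Fin r) : ∃ a, a ≠ i ∧ a ≠ j := by
  by_contra! h
  have : (Finset.univ : Finset (Fin r)) ⊆ {i, j} := fun a _ => by
    by_cases ha : a = i
    · simp [ha]
    · simp [h a ha]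
  have := Finset.card_le_card this
  rw [Finset.card_univ, Fintype.card_fin] at this
  have := Finset.card_le_two (a := i) (b := j)
  omega

theorem exists_index_ne (hr : 2 ≤ r) (i : Fin r) : ∃ a, a ≠ i :=
  haveI : Nontrivial (Fin r) := Fin.nontrivial_iff_two_le.2 hr
  exists_ne i

theorem eq_or_eq_of_two (hr : r = 2) {a b : Fin r} (hab : a ≠ b) (c : Fin r) : c = a ∨ c = b := by
  subst hr
  omega

/-- The support when top and bottom layer consist of one monomial each. -/
theorem support_of_singletons (hr : 2 ≤ r) {k l : ℕ} (hk : ∀ s ∈ C.S, C.xd s ≤ k)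
    (hl : ∀ s ∈ C.S, l ≤ C.xd s) (hlk : l < k) {e e' : M} (he : e ∈ C.S) (hek : C.xd e = k)
    (he' : e' ∈ C.S) (hel : C.xd e' = l) (hue : ∀ s ∈ C.S, C.xd s = k → s = e) :
    r = 2 ∧ ∃ i j, ∀ s, s ∈ C.S ↔ s = C.x i ∨ s = C.y j := by
  -- At most one negative monomial comes from above the bottom layer, and `e` has at least two
  -- products with the `y j`; so one of them is cancelled, by some `t` one layer down.
  obtain ⟨j, hj⟩ : ∃ j, e + C.y j ∉ C.Neg := by
    by_contra! h
    obtain ⟨j, hj⟩ := exists_index_ne hr ⟨0, by omega⟩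
    have := C.neg_unique hl he' hel he he (by omega) (by omega) (h j) (h ⟨0, by omega⟩)
    exact hj (C.swap.x_injective (add_left_cancel this))
  obtain ⟨t, ht, i, hti⟩ := (C.neg e he j).resolve_left hj
  have htk := C.xd_of_eq hti
  have key : ∀ u ∈ C.S, C.xd u + 1 = k → ∀ a, u + C.x a ∉ C.Pos → ∃ b, u + C.x a = e + C.y b := by
    intro u hu huk a hua
    obtain ⟨w, hw, b, hwb⟩ := (C.pos u hu a).resolve_left hua
    have := C.xd_of_eq hwb.symm
    have hwe := hue w hw (by omega)
    exact ⟨b, by rw [← hwe, hwb]⟩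
  -- These products survive: cancellation could only come from `e`, but `t` has one factor `x i`
  -- less than `e`. Only one such positive monomial is allowed, whence `r = 2`.
  have hpos : ∀ i', i' ≠ i → t + C.x i' ∈ C.Pos := by
    intro i' hi'
    by_contra h
    obtain ⟨b, hb⟩ := key t ht (by omega) i' h
    have h1 := C.xp_of_eq hb i
    have h2 := C.xp_of_eq hti i
    rw [if_neg hi'.symm] at h1
    rw [if_pos rfl] at h2
    omega
  have hr2 : r = 2 := by
    by_contra h
    obtain ⟨a, ha⟩ := exists_index_ne hr i
    obtain ⟨b, hb, hba⟩ := exists_pair_ne (by omega) i a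
    have := C.pos_unique hk he hek (by omega) (by omega) (hpos a ha) (hpos b hb)
    exact hba (C.x_injective (add_left_cancel this)).symm
  obtain ⟨i', hi'⟩ := exists_index_ne hr i
  obtain ⟨j', hj'⟩ := exists_index_ne hr j
  -- The layer below the top is `{t}`. An `s` whose product with `x i'` is cancelled has as many
  -- factors `x i` as `e`; then its product with `x i` can be neither cancelled nor equal to the one
  -- spare positive monomial.
  have huniq : ∀ s ∈ C.S, C.xd s + 1 = k → s = t := by
    intro s hs hsk
    by_cases h : s + C.x i' ∈ C.Pos
    · exact add_right_cancel
        (C.pos_unique hk he hek (by omega) (by omega) h (hpos i' hi'))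
    · obtain ⟨b, hb⟩ := key s hs hsk i' h
      have h1 := C.xp_of_eq hb i
      have h2 := C.xp_of_eq hti i
      rw [if_neg hi'.symm] at h1
      rw [if_pos rfl] at h2
      by_cases h' : s + C.x i ∈ C.Pos
      · have h3 := C.xp_of_eq_x
          (C.pos_unique hk he hek (by omega) (by omega) h' (hpos i' hi')) i
        rw [if_pos rfl, if_neg hi'.symm] at h3
        omega
      · obtain ⟨b', hb'⟩ := key s hs hsk i h'
        have h3 := C.xp_of_eq hb' i
        rw [if_pos rfl] at h3
        omega
  have hneg : e + C.y j' ∈ C.Neg := by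
    by_contra h
    obtain ⟨u, hu, a, hua⟩ := (C.neg e he j').resolve_left h
    have h1 := huniq u hu (by rw [C.xd_of_eq hua, hek])
    subst h1
    have h1 := C.yp_of_eq hua j
    have h2 := C.yp_of_eq hti j
    rw [if_neg hj'.symm] at h1
    rw [if_pos rfl] at h2
    omega
  refine ⟨hr2, i, j, ?_⟩
  by_cases htl : C.xd t = l
  · have hS : ∀ s ∈ C.S, s = e ∨ s = t := by
      intro s hs
      have h1 := hk s hs
      have h2 := hl s hs
      rcases Nat.lt_or_ge (C.xd s) k with h | h
      · exact Or.inr (huniq s hs (by omega))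
      · exact Or.inl (hue s hs (by omega))
    -- The support is now `{e, t}` with `e = t + x i - y j`; absence of a common variable removes
    -- everything else.
    have hxt : C.xp t = 0 := by
      funext c
      obtain ⟨s, hs, hsc⟩ := C.no_factor_x c
      have h2 := C.xp_of_eq hti c
      rcases hS s hs with rfl | rfl
      · show _ = 0
        omega
      · exact hsc
    have hye : C.yp e = 0 := by
      funext c
      obtain ⟨s, hs, hsc⟩ := C.no_factor_y c
      have h2 := C.yp_of_eq hti c
      rcases hS s hs with rfl | rfl
      · exact hsc
      · show _ = 0
        omega
    have htj : t = C.y j := by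
      refine C.ext _ _ (by rw [hxt, C.xp_y]) ?_
      funext c
      rw [C.yp_of_eq hti c, hye, C.yp_y, Pi.single_apply]
      simp
    have hei : e = C.x i := by
      refine C.ext _ _ ?_ (by rw [hye, C.yp_x])
      funext c
      rw [← C.xp_of_eq hti c, hxt, C.xp_x, Pi.single_apply]
      simp
    intro s
    rw [← htj, ← hei]
    exact ⟨hS s, by rintro (rfl | rfl) <;> assumption⟩
  -- With a third layer, `t + y j` must be cancelled from some `u` two layers down, the negative
  -- place being taken by `e + y j'`. The other product `u + x a'` then has to be cancelled by `t`,
  -- which the exponents of `x a` forbid.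
  · exfalso
    have h : t + C.y j ∉ C.Neg := by
      intro h
      have := congrArg C.xd (C.neg_unique hl he' hel ht he htl (by omega) h hneg)
      rw [C.xd_add_y, C.xd_add_y] at this
      omega
    obtain ⟨u, hu, a, hua⟩ := (C.neg t ht j).resolve_left h
    have huk := C.xd_of_eq hua
    obtain ⟨a', ha'⟩ := exists_index_ne hr a
    by_cases hup : u + C.x a' ∈ C.Pos
    · have := congrArg C.xd (C.pos_unique hk he hek (by omega) (by omega) hup (hpos i' hi'))
      rw [C.xd_add_x, C.xd_add_x] at this
      omega
    · obtain ⟨w, hw, b, hwb⟩ := (C.pos u hu a').resolve_left hup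
      have hwk := C.xd_of_eq hwb.symm
      have := huniq w hw (by omega)
      subst this
      have h1 := C.xp_of_eq hwb.symm a
      have h2 := C.xp_of_eq hua a
      rw [if_neg ha'.symm] at h1
      rw [if_pos rfl] at h2
      omega

/-- The support when the top layer has two monomials. -/
theorem support_of_two_top (hr : 2 ≤ r) {k l : ℕ} (hk : ∀ s ∈ C.S, C.xd s ≤ k)
    (hl : ∀ s ∈ C.S, l ≤ C.xd s) {s s' e' : M} (hs : s ∈ C.S) (hsk : C.xd s = k) (hs' : s' ∈ C.S)
    (hsk' : C.xd s' = k) (hne : s ≠ s') (he' : e' ∈ C.S) (hel : C.xd e' = l) :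
    r = 2 ∧ ∀ t, t ∈ C.S ↔ (∃ i, t = C.x i) ∨ ∃ j, t = C.y j := by
  classical
  have hinj : ∀ e, Function.Injective fun i => e + C.x i := fun e a b h =>
    C.x_injective (add_left_cancel h)
  have htop := fun i => C.add_x_mem_pos hk hs hsk i
  have htop' := fun i => C.add_x_mem_pos hk hs' hsk' i
  have himg : ∀ e, (Finset.univ.image fun i => e + C.x i).card = r := fun e => by
    rw [Finset.card_image_of_injective _ (hinj e), Finset.card_univ, Fintype.card_fin]
  -- Without a coincidence there would be `2r > r + 1` positive monomials.
  obtain ⟨a, b, hab⟩ : ∃ a b, s + C.x a = s' + C.x b := by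
    by_contra! h
    have hd : Disjoint (Finset.univ.image fun i => s + C.x i)
        (Finset.univ.image fun i => s' + C.x i) := by
      rw [Finset.disjoint_left]
      intro p hp hp'
      simp only [Finset.mem_image, Finset.mem_univ, true_and] at hp hp'
      obtain ⟨a, rfl⟩ := hp
      obtain ⟨b, hb⟩ := hp'
      exact h a b hb.symm
    have h1 : (Finset.univ.image fun i => s + C.x i) ∪ (Finset.univ.image fun i => s' + C.x i) ⊆
        C.Pos := by
      intro p hp
      simp only [Finset.mem_union, Finset.mem_image, Finset.mem_univ, true_and] at hp
      rcases hp with ⟨a, rfl⟩ | ⟨a, rfl⟩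
      · exact htop a
      · exact htop' a
    have h2 := Finset.card_le_card h1
    rw [Finset.card_union_of_disjoint hd, himg, himg] at h2
    have := C.card_pos
    omega
  have hab' : a ≠ b := by
    rintro rfl
    exact hne (add_right_cancel hab)
  have hxa := C.xp_of_eq_x hab a
  have hxb := C.xp_of_eq_x hab b
  rw [if_pos rfl, if_neg hab'] at hxa
  rw [if_pos rfl, if_neg hab'.symm] at hxb
  have hnotin : ∀ c, c ≠ b → s' + C.x c ∉ Finset.univ.image fun i => s + C.x i := by
    intro c hc h
    simp only [Finset.mem_image, Finset.mem_univ, true_and] at h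
    obtain ⟨i, hi⟩ := h
    have h1 := C.xp_of_eq_x hi b
    have h2 := C.xp_of_eq_x hi a
    rw [if_neg hc.symm] at h1
    split_ifs at h1 h2 <;> omega
  -- The two families share exactly one monomial, so `2r - 1 ≤ r + 1`. With `r = 2` this is an
  -- equality, so the top layer accounts for all of `Pos`.
  have hr2 : r = 2 := by
    by_contra h
    obtain ⟨c, hca, hcb⟩ := exists_pair_ne (by omega) a b
    have h1 : insert (s' + C.x a) (insert (s' + C.x c) (Finset.univ.image fun i => s + C.x i)) ⊆
        C.Pos := by
      intro p hp
      simp only [Finset.mem_insert, Finset.mem_image, Finset.mem_univ, true_and] at hp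
      rcases hp with rfl | rfl | ⟨a, rfl⟩
      · exact htop' _
      · exact htop' _
      · exact htop a
    have h2 := Finset.card_le_card h1
    rw [Finset.card_insert_of_notMem, Finset.card_insert_of_notMem (hnotin c hcb), himg] at h2
    · have := C.card_pos
      omega
    · rw [Finset.mem_insert, not_or]
      exact ⟨fun h => hca (hinj s' h).symm, hnotin a hab'⟩
  have hPos : ∀ p ∈ C.Pos, p = s + C.x a ∨ p = s + C.x b ∨ p = s' + C.x a := by
    intro p hp
    have h1 : insert (s' + C.x a) (Finset.univ.image fun i => s + C.x i) ⊆ C.Pos := by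
      intro p hp
      simp only [Finset.mem_insert, Finset.mem_image, Finset.mem_univ, true_and] at hp
      rcases hp with rfl | ⟨a, rfl⟩
      · exact htop' _
      · exact htop a
    have h2 := Finset.eq_of_subset_of_card_le h1 (by
      rw [Finset.card_insert_of_notMem (hnotin a hab'), himg]
      exact C.card_pos)
    rw [← h2] at hp
    simp only [Finset.mem_insert, Finset.mem_image, Finset.mem_univ, true_and] at hp
    rcases hp with rfl | ⟨c, rfl⟩
    · exact Or.inr (Or.inr rfl)
    · rcases eq_or_eq_of_two hr2 hab' c with rfl | rfl
      · exact Or.inl rfl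
      · exact Or.inr (Or.inl rfl)
  have htwo : ∀ u ∈ C.S, C.xd u = k → u = s ∨ u = s' := by
    intro u hu huk
    by_contra! h
    have h1 := hPos _ (C.add_x_mem_pos hk hu huk a)
    have h2 := hPos _ (C.add_x_mem_pos hk hu huk b)
    have h3 : u + C.x a = s + C.x b := by
      rcases h1 with h1 | h1 | h1
      · exact absurd (add_right_cancel h1) h.1
      · exact h1
      · exact absurd (add_right_cancel h1) h.2
    have h4 := C.xp_of_eq_x h3 a
    rw [if_pos rfl, if_neg hab'] at h4
    rcases h2 with h2 | h2 | h2
    · have h5 := C.xp_of_eq_x h2 a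
      rw [if_pos rfl, if_neg hab'] at h5
      omega
    · exact h.1 (add_right_cancel h2)
    · have h5 := C.xp_of_eq_x h2 a
      rw [if_pos rfl, if_neg hab'] at h5
      omega
  -- No positive place is left, so every product of a lower element with an `x c` is cancelled.
  have hcancel : ∀ u ∈ C.S, C.xd u ≠ k → ∀ c, ∃ w ∈ C.S, ∃ j, u + C.x c = w + C.y j := by
    intro u hu huk c
    have : u + C.x c ∉ C.Pos := by
      intro h
      apply huk
      have h1 : C.xd (u + C.x c) = k + 1 := by
        rcases hPos _ h with h | h | h <;> rw [h, C.xd_add_x] <;> omega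
      rw [C.xd_add_x] at h1
      omega
    obtain ⟨w, hw, j, h⟩ := (C.pos u hu c).resolve_left this
    exact ⟨w, hw, j, h.symm⟩
  have hyp : ∀ c, C.yp s c = C.yp s' c := C.yp_of_eq_x hab
  -- If the top layer were also the bottom one, `s` and `s'` would give `2r` distinct negative
  -- monomials.
  have hlk : l < k := by
    by_contra hlk
    have hsl : C.xd s = l := by have := hl s hs; omega
    have hsl' : C.xd s' = l := by have := hl s' hs'; omega
    have h1 : (Finset.univ.image fun j => s + C.y j) ∪ (Finset.univ.image fun j => s' + C.y j) ⊆
        C.Neg := by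
      intro p hp
      simp only [Finset.mem_union, Finset.mem_image, Finset.mem_univ, true_and] at hp
      rcases hp with ⟨c, rfl⟩ | ⟨c, rfl⟩
      · exact C.add_y_mem_neg hl hs hsl c
      · exact C.add_y_mem_neg hl hs' hsl' c
    have hd : Disjoint (Finset.univ.image fun j => s + C.y j)
        (Finset.univ.image fun j => s' + C.y j) := by
      rw [Finset.disjoint_left]
      intro p hp hp'
      simp only [Finset.mem_image, Finset.mem_univ, true_and] at hp hp'
      obtain ⟨c, rfl⟩ := hp
      obtain ⟨c', hc'⟩ := hp'
      have := congrFun (congrArg C.xp hc') a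
      simp only [map_add, C.xp_y, Pi.add_apply, Pi.zero_apply] at this
      omega
    have himg' : ∀ e, (Finset.univ.image fun j => e + C.y j).card = r := fun e => by
      have hinj' : Function.Injective fun j => e + C.y j := fun a b h =>
        C.swap.x_injective (add_left_cancel h)
      rw [Finset.card_image_of_injective _ hinj', Finset.card_univ, Fintype.card_fin]
    have h2 := Finset.card_le_card h1
    rw [Finset.card_union_of_disjoint hd, himg', himg'] at h2
    have := C.card_neg
    omega
  -- An element just below the top is tied to both `s` and `s'`, through the same `y j` since `s`
  -- and `s'` have equal exponents in the negative variables.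
  have hsub : ∀ u ∈ C.S, C.xd u + 1 = k → ∃ j, u + C.x b = s + C.y j ∧ u + C.x a = s' + C.y j := by
    intro u hu huk
    obtain ⟨w, hw, j, h⟩ := hcancel u hu (by omega) a
    obtain ⟨w', hw', j', h'⟩ := hcancel u hu (by omega) b
    have e1 := C.xd_of_eq h
    have e2 := C.xd_of_eq h'
    have ha := C.xp_of_eq h a
    have hb := C.xp_of_eq h' a
    rw [if_pos rfl] at ha
    rw [if_neg hab'] at hb
    have hw1 : w = s' := by
      rcases htwo w hw (by omega) with rfl | h1
      · exfalso
        rcases htwo w' hw' (by omega) with rfl | h2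
        · omega
        · subst h2
          omega
      · exact h1
    have hw2 : w' = s := by
      rcases htwo w' hw' (by omega) with h1 | rfl
      · exact h1
      · subst hw1
        omega
    subst hw1 hw2
    have : j = j' := by
      by_contra hjj
      have h1 := C.yp_of_eq h j
      have h2 := C.yp_of_eq h' j
      have h3 := hyp j
      rw [if_pos rfl] at h1
      rw [if_neg hjj] at h2
      omega
    subst this
    exact ⟨j, h', h⟩
  -- Of `s + y j` and `s' + y j` at most one fits into `Neg`; the element cancelling the other is
  -- the required `u`.
  have hex : ∀ j, ∃ u ∈ C.S, C.xd u + 1 = k ∧ u + C.x b = s + C.y j ∧ u + C.x a = s' + C.y j := by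
    intro j
    obtain ⟨c, hcS, hck, hcN, hcy⟩ : ∃ c ∈ C.S, C.xd c = k ∧ c + C.y j ∉ C.Neg ∧
        C.yp c j = C.yp s j := by
      by_contra! h
      have h1 : s + C.y j ∈ C.Neg := by
        by_contra h'
        exact h s hs hsk h' rfl
      have h2 : s' + C.y j ∈ C.Neg := by
        by_contra h'
        exact h s' hs' hsk' h' (hyp j).symm
      exact hne (add_right_cancel
        (C.neg_unique hl he' hel hs hs' (by omega) (by omega) h1 h2))
    obtain ⟨u, hu, i, hui⟩ := (C.neg c hcS j).resolve_left hcN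
    have huk := C.xd_of_eq hui
    obtain ⟨j', h1, h2⟩ := hsub u hu (by omega)
    have : j' = j := by
      by_contra hjj
      have h3 := C.yp_of_eq h1 j
      have h4 := C.yp_of_eq hui j
      rw [if_neg (Ne.symm hjj)] at h3
      rw [if_pos rfl] at h4
      omega
    subst this
    exact ⟨u, hu, by omega, h1, h2⟩
  refine ⟨hr2, ?_⟩
  choose u huS huk hub hua using hex
  by_cases hlk1 : l + 1 = k
  · have hS : ∀ t ∈ C.S, t = s ∨ t = s' ∨ ∃ j, t = u j := by
      intro t ht
      have h1 := hk t ht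
      have h2 := hl t ht
      rcases Nat.lt_or_ge (C.xd t) k with h | h
      · obtain ⟨j, h3, -⟩ := hsub t ht (by omega)
        exact Or.inr (Or.inr ⟨j, add_right_cancel (h3.trans (hub j).symm)⟩)
      · rcases htwo t ht (by omega) with h | h
        · exact Or.inl h
        · exact Or.inr (Or.inl h)
    have hxu : ∀ j c, C.xp (u j) c = 0 := by
      intro j c
      obtain ⟨t, ht, htc⟩ := C.no_factor_x c
      have h2 := C.xp_of_eq (hub j) c
      rcases hS t ht with rfl | rfl | ⟨j', rfl⟩
      · omega
      · have h2 := C.xp_of_eq (hua j) c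
        omega
      · have h3 := C.xp_of_eq (hub j') c
        omega
    have hys : ∀ c, C.yp s c = 0 := by
      intro c
      obtain ⟨t, ht, htc⟩ := C.no_factor_y c
      rcases hS t ht with rfl | rfl | ⟨j', rfl⟩
      · exact htc
      · rw [hyp, htc]
      · have h3 := C.yp_of_eq (hub j') c
        omega
    have e1 : s = C.x b := by
      refine C.ext _ _ ?_ ?_ <;> funext c
      · rw [← C.xp_of_eq (hub a) c, hxu, C.xp_x, Pi.single_apply]
        simp
      · rw [hys, C.yp_x]
        rfl
    have e2 : s' = C.x a := by
      refine C.ext _ _ ?_ ?_ <;> funext c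
      · rw [← C.xp_of_eq (hua a) c, hxu, C.xp_x, Pi.single_apply]
        simp
      · rw [← hyp, hys, C.yp_x]
        rfl
    have e3 : ∀ j, u j = C.y j := by
      intro j
      refine C.ext _ _ ?_ ?_ <;> funext c
      · rw [hxu, C.xp_y]
        rfl
      · rw [C.yp_of_eq (hub j) c, hys, C.yp_y, Pi.single_apply]
        simp
    intro t
    constructor
    · intro ht
      rcases hS t ht with rfl | rfl | ⟨j, rfl⟩
      · exact Or.inl ⟨_, e1⟩
      · exact Or.inl ⟨_, e2⟩
      · exact Or.inr ⟨j, e3 j⟩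
    · rintro (⟨i, rfl⟩ | ⟨j, rfl⟩)
      · rcases eq_or_eq_of_two hr2 hab' i with rfl | rfl
        · rwa [← e2]
        · rwa [← e1]
      · rw [← e3]
        exact huS j
  -- A third layer is impossible: some `u j + y j` would be cancelled from an element `t` two layers
  -- below the top. Its other product `t + x i'` would be cancelled by some `w` with the same
  -- exponents in the positive variables as `u j`, although `t` has one factor `x i` less than `u j`
  -- and as many as `w`.
  · exfalso
    have hul : ∀ j, C.xd (u j) ≠ l := fun j => by have := huk j; omega
    obtain ⟨j, hj⟩ : ∃ j, u j + C.y j ∉ C.Neg := by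
      by_contra! h
      have h1 := C.neg_unique hl he' hel (huS a) (huS b) (hul a) (hul b) (h a) (h b)
      have h2 := congrFun (congrArg C.yp h1) a
      simp only [map_add, C.yp_y, Pi.add_apply, Pi.single_apply, if_true, if_neg hab'] at h2
      have h3 := C.yp_of_eq (hub a) a
      have h4 := C.yp_of_eq (hub b) a
      rw [if_pos rfl] at h3
      rw [if_neg hab'] at h4
      omega
    obtain ⟨t, ht, i, hti⟩ := (C.neg _ (huS j) j).resolve_left hj
    have htk := C.xd_of_eq hti
    obtain ⟨i', hi'⟩ := exists_index_ne hr i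
    obtain ⟨w, hw, j', h⟩ := hcancel t ht (by have := huk j; omega) i'
    have hwk := C.xd_of_eq h
    obtain ⟨j'', h1, -⟩ := hsub w hw (by have := huk j; omega)
    have h2 := C.xp_of_eq h1 i
    have h3 := C.xp_of_eq (hub j) i
    have h4 := C.xp_of_eq h i
    have h5 := C.xp_of_eq hti i
    rw [if_neg hi'.symm] at h4
    rw [if_pos rfl] at h5
    omega

/-- The cases are two monomials in the top layer, two in the bottom layer (reduced to the former by
`swap`), and one in each. If top and bottom coincide in a single monomial, that monomial is `1`, as
no variable divides the support. -/
theorem support_classification (hr : 2 ≤ r) :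
    (∀ s, s ∈ C.S ↔ s = 0) ∨ (r = 2 ∧ ∃ i j, ∀ s, s ∈ C.S ↔ s = C.x i ∨ s = C.y j) ∨
      (r = 2 ∧ ∀ t, t ∈ C.S ↔ (∃ i, t = C.x i) ∨ ∃ j, t = C.y j) := by
  obtain ⟨s0, hs0, -⟩ := C.no_factor_x ⟨0, by omega⟩
  obtain ⟨e, he, hk⟩ := C.S.exists_max_image C.xd ⟨s0, hs0⟩
  obtain ⟨e', he', hl⟩ := C.S.exists_min_image C.xd ⟨s0, hs0⟩
  by_cases h1 : ∃ s ∈ C.S, C.xd s = C.xd e ∧ s ≠ e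
  · obtain ⟨s, hs, hse, hne⟩ := h1
    exact Or.inr (Or.inr (C.support_of_two_top hr hk hl hs hse he rfl hne he' rfl))
  by_cases h2 : ∃ s ∈ C.S, C.xd s = C.xd e' ∧ s ≠ e'
  · obtain ⟨s, hs, hse, hne⟩ := h2
    have d1 := C.xd_add_swap_xd hs
    have d2 := C.xd_add_swap_xd he'
    have hl' : ∀ t ∈ C.swap.S, C.swap.xd e ≤ C.swap.xd t := fun t ht => by
      have d3 := C.xd_add_swap_xd ht
      have d4 := C.xd_add_swap_xd he
      have := hk t ht
      omega
    obtain ⟨h3, h4⟩ := C.swap.support_of_two_top hr (C.swap_xd_le hl he' rfl) hl' hs (by omega)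
      he' rfl hne he rfl
    exact Or.inr (Or.inr ⟨h3, fun t => (h4 t).trans or_comm⟩)
  push Not at h1 h2
  rcases (hl e he).lt_or_eq with hlt | heq
  · exact Or.inr (Or.inl (C.support_of_singletons hr hk hl hlt he rfl he' rfl h1))
  · left
    have hS : ∀ s ∈ C.S, s = e := fun s hs => h1 s hs (by
      have := hk s hs
      have := hl s hs
      omega)
    have he0 : e = 0 := by
      refine C.ext _ _ ?_ ?_ <;> funext c
      · obtain ⟨s, hs, h⟩ := C.no_factor_x c
        rw [← hS s hs, h, map_zero]
        rfl
      · obtain ⟨s, hs, h⟩ := C.no_factor_y c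
        rw [← hS s hs, h, map_zero]
        rfl
    intro s
    rw [← he0]
    exact ⟨hS s, fun h => h ▸ he⟩

end SignConfig

/-! ### Leading terms of products with a linear form. -/

open MvPolynomial in
theorem coeff_linear_mul {σ : Type*} [Fintype σ] (ε : σ → ℝ) (Q : MvPolynomial σ ℝ) (e : σ →₀ ℕ) :
    coeff e ((∑ v, C (ε v) * X v) * Q) =
      ∑ v, ε v * (if e v ≠ 0 then coeff (e - Finsupp.single v 1) Q else 0) := by
  classical
  rw [Finset.sum_mul, coeff_sum]
  refine Finset.sum_congr rfl fun v _ => ?_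
  rw [mul_assoc, coeff_C_mul, coeff_X_mul']
  simp only [Finsupp.mem_support_iff]

theorem Finsupp.sub_single_add_single {σ : Type*} {e : σ →₀ ℕ} {v : σ} (hv : e v ≠ 0) :
    e - Finsupp.single v 1 + Finsupp.single v 1 = e := by
  refine tsub_add_cancel_of_le ?_
  rw [Finsupp.single_le_iff]
  exact Nat.one_le_iff_ne_zero.2 hv

/-- The weight of a monomial. -/
def monomialWeight {σ : Type*} [Fintype σ] (wt : σ → ℤ) (e : σ →₀ ℕ) : ℤ := ∑ v, e v * wt v

theorem monomialWeight_add {σ : Type*} [Fintype σ] (wt : σ → ℤ) (e f : σ →₀ ℕ) :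
    monomialWeight wt (e + f) = monomialWeight wt e + monomialWeight wt f := by
  simp [monomialWeight, add_mul, Finset.sum_add_distrib]

theorem monomialWeight_single {σ : Type*} [Fintype σ] (wt : σ → ℤ) (v : σ) :
    monomialWeight wt (Finsupp.single v 1) = wt v := by
  classical
  rw [monomialWeight, Finset.sum_eq_single v]
  · simp
  · intro w _ hw
    simp [hw.symm]
  · simp

/-- All coefficients of weight above `k` vanish and those of weight `k` are nonnegative. -/
def NonnegTop {σ : Type*} [Fintype σ] (wt : σ → ℤ) (k : ℤ) (Q : MvPolynomial σ ℝ) : Prop :=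
  (∀ e, k < monomialWeight wt e → Q.coeff e = 0) ∧ ∀ e, monomialWeight wt e = k → 0 ≤ Q.coeff e

section NonnegTop

variable {σ : Type*} [Fintype σ] {wt : σ → ℤ} {k W : ℤ} {Q : MvPolynomial σ ℝ} {ε : σ → ℝ}

open MvPolynomial

/-- In the leading weight only leading terms of both factors meet, and these have nonnegative
coefficients. The weight is left free so that both the top and the bottom layer can serve as leading
part. -/
theorem NonnegTop.mul (hQ : NonnegTop wt k Q) (hW : ∀ v, wt v ≤ W) (hε : ∀ v, wt v = W → 0 < ε v) :
    NonnegTop wt (k + W) ((∑ v, C (ε v) * X v) * Q) := by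
  have key : ∀ e (v : σ), e v ≠ 0 → monomialWeight wt (e - Finsupp.single v 1) + wt v =
      monomialWeight wt e := fun e v hv => by
    rw [← monomialWeight_single wt v, ← monomialWeight_add, Finsupp.sub_single_add_single hv]
  refine ⟨fun e he => ?_, fun e he => ?_⟩
  · rw [coeff_linear_mul]
    refine Finset.sum_eq_zero fun v _ => ?_
    split_ifs with hv
    · rw [hQ.1 _ (by linarith [key e v hv, hW v]), mul_zero]
    · rw [mul_zero]
  · rw [coeff_linear_mul]
    refine Finset.sum_nonneg fun v _ => ?_
    split_ifs with hv
    · rcases (hW v).lt_or_eq with h | h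
      · rw [hQ.1 _ (by linarith [key e v hv]), mul_zero]
      · exact mul_nonneg (hε v h).le (hQ.2 _ (by linarith [key e v hv]))
    · rw [mul_zero]

theorem NonnegTop.coeff_mul_pos (hQ : NonnegTop wt k Q) (hW : ∀ v, wt v ≤ W)
    (hε : ∀ v, wt v = W → 0 < ε v) {s : σ →₀ ℕ} (hs : monomialWeight wt s = k)
    (hsQ : 0 < Q.coeff s) {v : σ} (hv : wt v = W) :
    0 < coeff (s + Finsupp.single v 1) ((∑ v, C (ε v) * X v) * Q) := by
  classical
  rw [coeff_linear_mul]
  refine Finset.sum_pos' (fun w _ => ?_) ⟨v, Finset.mem_univ _, ?_⟩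
  · split_ifs with hw
    · have key : monomialWeight wt (s + Finsupp.single v 1 - Finsupp.single w 1) + wt w = k + W := by
        rw [← monomialWeight_single wt w, ← monomialWeight_add, Finsupp.sub_single_add_single hw,
          monomialWeight_add, monomialWeight_single, hs, hv]
      rcases (hW w).lt_or_eq with h | h
      · rw [hQ.1 _ (by linarith), mul_zero]
      · exact mul_nonneg (hε w h).le (hQ.2 _ (by linarith))
    · rw [mul_zero]
  · rw [if_pos (by simp), add_tsub_cancel_right]
    exact mul_pos (hε v hv) hsQ

/-- Leading terms never cancel, so `s` can be multiplied by one leading variable per factor; the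
list records the choices. -/
theorem NonnegTop.coeff_pow_mul_pos (hQ : NonnegTop wt k Q) (hW : ∀ v, wt v ≤ W)
    (hε : ∀ v, wt v = W → 0 < ε v) {s : σ →₀ ℕ} (hs : monomialWeight wt s = k)
    (hsQ : 0 < Q.coeff s) (l : List σ) (hl : ∀ v ∈ l, wt v = W) :
    NonnegTop wt (k + l.length * W) ((∑ v, C (ε v) * X v) ^ l.length * Q) ∧
      monomialWeight wt (s + (l.map fun v => Finsupp.single v 1).sum) = k + l.length * W ∧
      0 < coeff (s + (l.map fun v => Finsupp.single v 1).sum)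
        ((∑ v, C (ε v) * X v) ^ l.length * Q) := by
  induction l with
  | nil => simpa using ⟨hQ, hs, hsQ⟩
  | cons v l ih =>
    obtain ⟨h1, h2, h3⟩ := ih fun v hv => hl v (List.mem_cons_of_mem _ hv)
    have hv := hl v List.mem_cons_self
    have e1 : (∑ v, C (ε v) * X v : MvPolynomial σ ℝ) ^ (v :: l).length * Q =
        (∑ v, C (ε v) * X v) * ((∑ v, C (ε v) * X v) ^ l.length * Q) := by
      rw [List.length_cons, pow_succ']
      ring
    have e2 : k + ((v :: l).length : ℤ) * W = k + l.length * W + W := by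
      rw [List.length_cons]
      push_cast
      ring
    have e3 : s + ((v :: l).map fun v => Finsupp.single v 1).sum =
        s + (l.map fun v => Finsupp.single v 1).sum + Finsupp.single v 1 := by
      rw [List.map_cons, List.sum_cons]
      abel
    rw [e1, e2, e3]
    refine ⟨h1.mul hW hε, ?_, h1.coeff_mul_pos hW hε h2 h3 hv⟩
    rw [monomialWeight_add, h2, monomialWeight_single, hv]

end NonnegTop

/-! ### Powers of the indefinite linear form. -/

/-- The polynomial `x_1 + … + x_r - x_{r+1} - … - x_{2r}`. -/
noncomputable def indefPoly (r : ℕ) : MvPolynomial (Fin r ⊕ Fin r) ℝ :=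
  ∑ i, MvPolynomial.X (Sum.inl i) - ∑ j, MvPolynomial.X (Sum.inr j)

/-- The signs of the variables in `indefPoly`. -/
def varSign {a b : Type*} : a ⊕ b → ℝ := Sum.elim (fun _ => 1) fun _ => -1

section indefPoly

open MvPolynomial

variable {r : ℕ}

theorem indefPoly_eq : indefPoly r = ∑ v, C (varSign v) * X v := by
  simp [indefPoly, varSign, sub_eq_add_neg]

theorem neg_indefPoly_eq : -indefPoly r = ∑ v, C (-varSign v) * X v := by
  simp [indefPoly, varSign, sub_eq_add_neg, add_comm]

theorem eval_indefPoly (x : Fin r ⊕ Fin r → ℝ) :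
    eval x (indefPoly r) = ∑ i, x (Sum.inl i) - ∑ j, x (Sum.inr j) := by
  simp [indefPoly]

/-- The degree in the positive variables as a weight. -/
def xWeight {a b : Type*} : a ⊕ b → ℤ := Sum.elim (fun _ => 1) fun _ => 0

/-- In the top degree of the positive variables the product is `(∑ x_i)^m` times the top layer of
`Q`. The monomials `x_i x_j^(m-1)` of the power are enough for the counts below. -/
theorem coeff_indefPoly_pow_mul_pos {k : ℤ} {Q : MvPolynomial (Fin r ⊕ Fin r) ℝ}
    (hQ : NonnegTop xWeight k Q) {s : Fin r ⊕ Fin r →₀ ℕ} (hs : monomialWeight xWeight s = k)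
    (hsQ : 0 < Q.coeff s) {m : ℕ} (hm : 1 ≤ m) (i j : Fin r) :
    0 < coeff (s + (Finsupp.single (Sum.inl i) 1 + (m - 1) • Finsupp.single (Sum.inl j) 1))
      (indefPoly r ^ m * Q) := by
  have h := (hQ.coeff_pow_mul_pos (W := 1) (ε := varSign)
    (by rintro (v | v) <;> simp [xWeight]) (by rintro (v | v) <;> simp [xWeight, varSign])
    hs hsQ (Sum.inl i :: List.replicate (m - 1) (Sum.inl j)) (by
      intro v hv
      rcases List.mem_cons.1 hv with rfl | hv
      · rfl
      · rw [List.eq_of_mem_replicate hv]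
        rfl)).2.2
  rw [← indefPoly_eq, List.length_cons, List.length_replicate, Nat.sub_add_cancel hm, List.map_cons,
    List.map_replicate, List.sum_cons, List.sum_replicate] at h
  exact h

/-- A positive monomial besides the `r + 1` standard ones is too many. -/
theorem false_of_extra_monomial {P : MvPolynomial (Fin r ⊕ Fin r) ℝ}
    (hpos : ∀ T : Finset (Fin r ⊕ Fin r →₀ ℕ), (∀ e ∈ T, 0 < P.coeff e) → T.card ≤ r + 1)
    {i j : Fin r} (hij : i ≠ j) {N : ℕ} (hN : 2 ≤ N) (c e : Fin r ⊕ Fin r →₀ ℕ)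
    (h1 : ∀ a, 0 < P.coeff
      (c + (Finsupp.single (Sum.inl a) 1 + (N - 1) • Finsupp.single (Sum.inl i) 1)))
    (h2 : 0 < P.coeff
      (c + (Finsupp.single (Sum.inl j) 1 + (N - 1) • Finsupp.single (Sum.inl j) 1)))
    (he : 0 < P.coeff e)
    (he1 : ∀ a, e ≠ c + (Finsupp.single (Sum.inl a) 1 + (N - 1) • Finsupp.single (Sum.inl i) 1))
    (he2 : e ≠ c + (Finsupp.single (Sum.inl j) 1 + (N - 1) • Finsupp.single (Sum.inl j) 1)) :
    False := by
  classical
  have hinj : Function.Injective fun a : Fin r => c + (Finsupp.single (Sum.inl a) 1 +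
      (N - 1) • Finsupp.single (Sum.inl i : Fin r ⊕ Fin r) 1) := fun a b h => by
    have := add_right_cancel (add_left_cancel h)
    exact Sum.inl_injective (Finsupp.single_left_injective one_ne_zero this)
  have h3 := hpos (insert e (insert
    (c + (Finsupp.single (Sum.inl j) 1 + (N - 1) • Finsupp.single (Sum.inl j) 1))
    (Finset.univ.image fun a => c + (Finsupp.single (Sum.inl a) 1 +
      (N - 1) • Finsupp.single (Sum.inl i : Fin r ⊕ Fin r) 1)))) (by
    intro p hp
    simp only [Finset.mem_insert, Finset.mem_image, Finset.mem_univ, true_and] at hp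
    rcases hp with rfl | rfl | ⟨a, rfl⟩
    · exact he
    · exact h2
    · exact h1 a)
  rw [Finset.card_insert_of_notMem, Finset.card_insert_of_notMem,
    Finset.card_image_of_injective _ hinj, Finset.card_univ, Fintype.card_fin] at h3
  · omega
  · simp only [Finset.mem_image, Finset.mem_univ, true_and, not_exists]
    intro a h
    have := DFunLike.congr_fun (add_left_cancel h) (Sum.inl j)
    simp only [Finsupp.add_apply, Finsupp.smul_apply, Finsupp.single_apply, Sum.inl.injEq, if_true,
      if_neg hij, smul_eq_mul, mul_one, mul_zero] at this
    split_ifs at this <;> omega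
  · simp only [Finset.mem_insert, Finset.mem_image, Finset.mem_univ, true_and, not_or, not_exists]
    exact ⟨he2, fun a h => he1 a h.symm⟩

theorem nonnegTop_of_nonneg {σ : Type*} [Fintype σ] (wt : σ → ℤ) {Q : MvPolynomial σ ℝ}
    (hQ : ∀ e, 0 ≤ Q.coeff e) (h0 : Q ≠ 0) :
    ∃ s, 0 < Q.coeff s ∧ NonnegTop wt (monomialWeight wt s) Q := by
  obtain ⟨s, hs, hmax⟩ := Q.support.exists_max_image (monomialWeight wt)
    (by rwa [Finset.nonempty_iff_ne_empty, Ne, MvPolynomial.support_eq_empty])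
  refine ⟨s, (hQ s).lt_of_ne (mem_support_iff.1 hs).symm, fun e he => ?_, fun e _ => hQ e⟩
  by_contra h
  exact absurd (hmax e (mem_support_iff.2 h)) (not_le.2 he)

/-- For `m ≥ 3` the monomials `s x_a x_i^(m-1)`, `s x_j^m` and `s x_i x_j^(m-1)` are `r + 2`
distinct positive ones. -/
theorem pow_eq_one_of_nonneg (hr : 2 ≤ r) {Q : MvPolynomial (Fin r ⊕ Fin r) ℝ}
    (hQ : ∀ e, 0 ≤ Q.coeff e) (h0 : Q ≠ 0) {m : ℕ} (hm : 1 ≤ m)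
    (hpos : ∀ T : Finset (Fin r ⊕ Fin r →₀ ℕ),
      (∀ e ∈ T, 0 < (indefPoly r ^ m * Q).coeff e) → T.card ≤ r + 1) : m = 1 := by
  by_contra hm1
  obtain ⟨s, hs, htop⟩ := nonnegTop_of_nonneg xWeight hQ h0
  have hij : (⟨0, by omega⟩ : Fin r) ≠ ⟨1, by omega⟩ := by simp
  generalize (⟨0, by omega⟩ : Fin r) = i at hij
  generalize (⟨1, by omega⟩ : Fin r) = j at hij
  have key := fun a b => coeff_indefPoly_pow_mul_pos htop rfl hs hm a b
  rcases Nat.lt_or_ge 2 m with hm3 | hm2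
  · refine false_of_extra_monomial hpos hij (by omega) s _ (fun a => key a i) (key j j) (key i j)
      (fun a h => ?_) fun h => ?_
    · have := DFunLike.congr_fun (add_left_cancel h) (Sum.inl j)
      simp only [Finsupp.add_apply, Finsupp.smul_apply, Finsupp.single_apply, Sum.inl.injEq,
        if_true, if_neg hij, smul_eq_mul, mul_one, mul_zero] at this
      split_ifs at this <;> omega
    · have := DFunLike.congr_fun (add_left_cancel h) (Sum.inl j)
      simp only [Finsupp.add_apply, Finsupp.smul_apply, Finsupp.single_apply, Sum.inl.injEq,
        if_true, if_neg hij, smul_eq_mul, mul_one] at this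
      omega
  -- For `m = 2` the last of these coincides with one of the others. Since `L² = (-L)²`, the bottom
  -- layer also contributes a positive monomial, `t y_i²`, of smaller degree in the positive
  -- variables.
  · obtain rfl : m = 2 := by omega
    obtain ⟨t, ht, hbot⟩ := nonnegTop_of_nonneg (fun v => -xWeight v) hQ h0
    have h1 := (hbot.coeff_pow_mul_pos (W := 0) (ε := fun v => -varSign v)
      (by rintro (v | v) <;> simp [xWeight]) (by rintro (v | v) <;> simp [xWeight, varSign])
      rfl ht [Sum.inr i, Sum.inr i] (by
        intro v hv
        simp only [List.mem_cons, List.not_mem_nil, or_false, or_self] at hv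
        subst hv
        rfl)).2.2
    rw [← neg_indefPoly_eq, List.length_cons, List.length_cons, List.length_nil, zero_add,
      neg_sq] at h1
    have hwt : ∀ e : Fin r ⊕ Fin r →₀ ℕ, monomialWeight (fun v => -xWeight v) e =
        -monomialWeight xWeight e := fun e => by simp [monomialWeight]
    have hle : monomialWeight xWeight t ≤ monomialWeight xWeight s := by
      by_contra h
      exact hs.ne' (hbot.1 s (by rw [hwt, hwt]; linarith))
    have hdiff : ∀ a b, t + ([Sum.inr i, Sum.inr i].map fun v => Finsupp.single v 1).sum ≠
        s + (Finsupp.single (Sum.inl a) 1 + (2 - 1) • Finsupp.single (Sum.inl b) 1) := by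
      intro a b h
      have := congrArg (monomialWeight (xWeight : Fin r ⊕ Fin r → ℤ)) h
      simp only [List.map_cons, List.map_nil, List.sum_cons, List.sum_nil, add_zero,
        monomialWeight_add, monomialWeight_single, Nat.add_one_sub_one, one_smul] at this
      have e1 : ∀ c : Fin r, xWeight (Sum.inl c : Fin r ⊕ Fin r) = 1 := fun _ => rfl
      have e2 : ∀ c : Fin r, xWeight (Sum.inr c : Fin r ⊕ Fin r) = 0 := fun _ => rfl
      rw [e1, e1, e2] at this
      linarith
    exact false_of_extra_monomial hpos hij le_rfl s _ (fun a => key a i) (key j j) h1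
      (fun a => hdiff a i) (hdiff j j)

end indefPoly

/-! ### Linear quotients and the classification of the quotient. -/

section LinearQuotient

open MvPolynomial

theorem exists_eq_single_of_degree_eq_one {σ : Type*} {e : σ →₀ ℕ} (he : e.degree = 1) :
    ∃ v, e = Finsupp.single v 1 := by
  classical
  obtain ⟨v, hv⟩ : ∃ v, e v ≠ 0 := by
    by_contra! h
    have : e = 0 := Finsupp.ext h
    simp [this] at he
  refine ⟨v, ?_⟩
  have h1 := Finsupp.sub_single_add_single hv
  have h2 := congrArg Finsupp.degree h1
  rw [map_add, he, Finsupp.degree_single, Nat.add_eq_right, Finsupp.degree_eq_zero_iff] at h2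
  rw [← h1, h2, zero_add]

theorem linear_of_isHomogeneous_one {σ R : Type*} [Fintype σ] [CommSemiring R] {Q : MvPolynomial σ R}
    (h : Q.IsHomogeneous 1) : Q = ∑ v, C (Q.coeff (Finsupp.single v 1)) * X v := by
  classical
  ext e
  simp only [coeff_sum, coeff_C_mul, coeff_X]
  by_cases he : e.degree = 1
  · obtain ⟨v, rfl⟩ := exists_eq_single_of_degree_eq_one he
    rw [Finset.sum_eq_single v]
    · simp
    · intro w _ hw
      rw [if_neg, mul_zero]
      exact fun h => hw (Finsupp.single_left_injective one_ne_zero h)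
    · simp
  · rw [h.coeff_eq_zero he, Finset.sum_eq_zero]
    intro v _
    rw [if_neg, mul_zero]
    rintro rfl
    simp at he

theorem coeff_linear {σ : Type*} [Fintype σ] [DecidableEq σ] (q : σ → ℝ) (e : σ →₀ ℕ) :
    coeff e (∑ v, C (q v) * X v) = ∑ v, if Finsupp.single v 1 = e then q v else 0 := by
  simp [coeff_sum, coeff_C_mul, coeff_X]

theorem coeff_linear_single {σ : Type*} [Fintype σ] (q : σ → ℝ) (v : σ) :
    coeff (Finsupp.single v 1) (∑ v, C (q v) * X v) = q v := by
  classical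
  rw [coeff_linear, Finset.sum_eq_single v]
  · simp
  · intro w _ hw
    rw [if_neg fun h => hw (Finsupp.single_left_injective one_ne_zero h)]
  · simp

theorem coeff_linear_mul_linear {σ : Type*} [Fintype σ] (ε q : σ → ℝ) {v w : σ} (hvw : v ≠ w) :
    coeff (Finsupp.single v 1 + Finsupp.single w 1)
      ((∑ v, C (ε v) * X v) * ∑ v, C (q v) * X v) = ε v * q w + ε w * q v := by
  classical
  rw [coeff_linear_mul, Finset.sum_eq_add v w hvw]
  · rw [if_pos (by simp), if_pos (by simp), add_tsub_cancel_right, add_tsub_cancel_left,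
      coeff_linear_single, coeff_linear_single]
  · intro u _ hu
    simp [hu.1.symm, hu.2.symm]
  · simp
  · simp

theorem coeff_linear_mul_linear_self {σ : Type*} [Fintype σ] (ε q : σ → ℝ) (v : σ) :
    coeff (Finsupp.single v 1 + Finsupp.single v 1)
      ((∑ v, C (ε v) * X v) * ∑ v, C (q v) * X v) = ε v * q v := by
  classical
  rw [coeff_linear_mul, Finset.sum_eq_single v]
  · rw [if_pos (by simp), add_tsub_cancel_right, coeff_linear_single]
  · intro u _ hu
    simp [hu.symm]
  · simp

variable {r : ℕ}

/-- Evaluation at suitable points makes the coefficients of the `x_i` nonnegative, and strictly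
positive once some `y_b` has a negative coefficient. Then all monomials in the `x_i` of the top
degree that are needed occur: for `m ≥ 2` already two indices give too many, for `m = 1` and `r ≥ 3`
the monomial `x_j x_c` is one too many, and for `r = 2` the monomial `y_b²` has the positive
coefficient `-q_b`. -/
theorem linear_nonneg (hr : 2 ≤ r) (q : Fin r ⊕ Fin r → ℝ) {m : ℕ} (hm : 1 ≤ m)
    (hnn : ∀ x : Fin r ⊕ Fin r → ℝ, (∀ v, 0 ≤ x v) → 0 < eval x (indefPoly r) →
      0 ≤ eval x (∑ v, C (q v) * X v))
    (hpos : ∀ T : Finset (Fin r ⊕ Fin r →₀ ℕ),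
      (∀ e ∈ T, 0 < (indefPoly r ^ m * ∑ v, C (q v) * X v).coeff e) → T.card ≤ r + 1)
    (v : Fin r ⊕ Fin r) : 0 ≤ q v := by
  classical
  have hx : ∀ i, 0 ≤ q (Sum.inl i) := by
    intro i
    have := hnn (fun v => if v = Sum.inl i then 1 else 0) (fun v => by positivity)
      (by simp [eval_indefPoly])
    simpa using this
  by_contra hv
  -- At `x_i = 1`, `y_b = 1/2` the form `L` is positive, so `q_i = 0` would give `q_b ≥ 0`.
  have hx' : ∀ i, 0 < q (Sum.inl i) := by
    intro i
    refine (hx i).lt_of_ne fun hi => hv ?_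
    rcases v with a | b
    · exact hx a
    · have := hnn (fun v => if v = Sum.inl i then 1 else if v = Sum.inr b then 1 / 2 else 0)
        (fun v => by positivity) (by simp [eval_indefPoly]; norm_num)
      simp [← hi] at this
      linarith
  obtain ⟨b, rfl⟩ : ∃ b, v = Sum.inr b := by
    rcases v with a | b
    · exact absurd (hx a) hv
    · exact ⟨b, rfl⟩
  have htop : NonnegTop xWeight 1 (∑ v, C (q v) * X v) := by
    refine ⟨fun e he => ?_, fun e he => ?_⟩
    · rw [coeff_linear]
      refine Finset.sum_eq_zero fun v _ => if_neg ?_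
      rintro rfl
      rw [monomialWeight_single] at he
      rcases v with v | v <;> simp [xWeight] at he
    · rw [coeff_linear]
      refine Finset.sum_nonneg fun v _ => ?_
      split_ifs with h
      · subst h
        rw [monomialWeight_single] at he
        rcases v with v | v
        · exact hx v
        · simp [xWeight] at he
      · exact le_rfl
  have key : ∀ c a d, 0 < coeff (Finsupp.single (Sum.inl c) 1 +
      (Finsupp.single (Sum.inl a) 1 + (m - 1) • Finsupp.single (Sum.inl d) 1))
      (indefPoly r ^ m * ∑ v, C (q v) * X v) := fun c a d =>
    coeff_indefPoly_pow_mul_pos htop (by rw [monomialWeight_single]; rfl)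
      (by rw [coeff_linear_single]; exact hx' c) hm a d
  have hij : (⟨0, by omega⟩ : Fin r) ≠ ⟨1, by omega⟩ := by simp
  generalize (⟨0, by omega⟩ : Fin r) = i at hij
  generalize (⟨1, by omega⟩ : Fin r) = j at hij
  have h1 : ∀ a d : Fin r, 0 < coeff (0 + (Finsupp.single (Sum.inl a) 1 +
      (m + 1 - 1) • Finsupp.single (Sum.inl d) 1)) (indefPoly r ^ m * ∑ v, C (q v) * X v) := by
    intro a d
    have := key d a d
    obtain ⟨n, rfl⟩ := Nat.exists_eq_add_of_le' hm
    rwa [show (0 : Fin r ⊕ Fin r →₀ ℕ) + (Finsupp.single (Sum.inl a) 1 +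
      (n + 1 + 1 - 1) • Finsupp.single (Sum.inl d) 1) = Finsupp.single (Sum.inl d) 1 +
      (Finsupp.single (Sum.inl a) 1 + (n + 1 - 1) • Finsupp.single (Sum.inl d) 1) by
        simp only [Nat.add_sub_cancel, succ_nsmul]
        abel]
  have extra := false_of_extra_monomial hpos hij (N := m + 1) (by omega) 0
  rcases hm.lt_or_eq with hm2 | rfl
  · refine extra _ (fun a => h1 a i) (h1 j j) (key j i j) (fun a h => ?_) fun h => ?_
    · have := DFunLike.congr_fun h (Sum.inl j)
      simp only [Finsupp.add_apply, Finsupp.smul_apply, Finsupp.single_apply, Sum.inl.injEq,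
        if_true, if_neg hij, smul_eq_mul, mul_one, mul_zero, Finsupp.coe_zero, Pi.zero_apply]
        at this
      split_ifs at this <;> omega
    · have := DFunLike.congr_fun h (Sum.inl i)
      simp [hij.symm] at this
  rcases Nat.lt_or_ge 2 r with hr3 | hr2
  · obtain ⟨c, hci, hcj⟩ := SignConfig.exists_pair_ne (by omega) i j
    refine extra _ (fun a => h1 a i) (h1 j j) (key j c j) (fun a h => ?_) fun h => ?_
    · have := DFunLike.congr_fun h (Sum.inl i)
      simp [Finsupp.single_apply, hij.symm, hci] at this
    · have := DFunLike.congr_fun h (Sum.inl c)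
      simp [hcj.symm] at this
  · refine extra (Finsupp.single (Sum.inr b) 1 + Finsupp.single (Sum.inr b) 1)
      (fun a => h1 a i) (h1 j j) ?_ (fun a h => ?_) fun h => ?_
    · rw [pow_one, indefPoly_eq, coeff_linear_mul_linear_self]
      simp only [varSign, Sum.elim_inr]
      linarith
    · have := DFunLike.congr_fun h (Sum.inr b)
      simp at this
    · have := DFunLike.congr_fun h (Sum.inr b)
      simp at this

/-- The sign configuration of a product of `indefPoly` with a polynomial with nonnegative
coefficients. -/
noncomputable def signConfig {Q : MvPolynomial (Fin r ⊕ Fin r) ℝ} {d : ℕ} (hd : Q.IsHomogeneous d)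
    (hQ : ∀ e, 0 ≤ Q.coeff e)
    (hnf : ∀ v, ∃ e, Q.coeff e ≠ 0 ∧ e v = 0)
    (hpos : ∀ T : Finset (Fin r ⊕ Fin r →₀ ℕ),
      (∀ e ∈ T, 0 < (indefPoly r * Q).coeff e) → T.card ≤ r + 1)
    (hneg : ∀ T : Finset (Fin r ⊕ Fin r →₀ ℕ),
      (∀ e ∈ T, (indefPoly r * Q).coeff e < 0) → T.card ≤ r + 1) :
    SignConfig r (Fin r ⊕ Fin r →₀ ℕ) where
  x i := Finsupp.single (Sum.inl i) 1
  y j := Finsupp.single (Sum.inr j) 1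
  xp := ⟨⟨fun e i => e (Sum.inl i), rfl⟩, fun _ _ => rfl⟩
  yp := ⟨⟨fun e i => e (Sum.inr i), rfl⟩, fun _ _ => rfl⟩
  xp_x i := by
    funext c
    show (Finsupp.single (Sum.inl i : Fin r ⊕ Fin r) 1) (Sum.inl c) = _
    simp [Finsupp.single_apply, Pi.single_apply, eq_comm]
  xp_y j := by
    funext c
    show (Finsupp.single (Sum.inr j : Fin r ⊕ Fin r) 1) (Sum.inl c) = _
    simp
  yp_y i := by
    funext c
    show (Finsupp.single (Sum.inr i : Fin r ⊕ Fin r) 1) (Sum.inr c) = _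
    simp [Finsupp.single_apply, Pi.single_apply, eq_comm]
  yp_x j := by
    funext c
    show (Finsupp.single (Sum.inl j : Fin r ⊕ Fin r) 1) (Sum.inr c) = _
    simp
  ext s t h1 h2 := by
    ext (v | v)
    · exact congrFun h1 v
    · exact congrFun h2 v
  S := Q.support
  Pos := (indefPoly r * Q).support.filter fun e => 0 < (indefPoly r * Q).coeff e
  Neg := (indefPoly r * Q).support.filter fun e => (indefPoly r * Q).coeff e < 0
  d := d
  deg s hs := by
    rw [hd.degree_eq_sum_deg_support hs]
    exact (Fintype.sum_sum_type s).symm.trans (Finset.sum_subset (Finset.subset_univ _)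
      fun v _ hv => Finsupp.notMem_support_iff.1 hv).symm
  pos s hs i := by
    by_contra! h
    refine h.1 ?_
    have : 0 < (indefPoly r * Q).coeff (s + Finsupp.single (Sum.inl i) 1) := by
      rw [indefPoly_eq, coeff_linear_mul]
      refine Finset.sum_pos' (fun w _ => ?_) ⟨Sum.inl i, Finset.mem_univ _, ?_⟩
      · split_ifs with hw
        · rcases w with w | w
          · exact mul_nonneg zero_le_one (hQ _)
          · have : Q.coeff (s + Finsupp.single (Sum.inl i) 1 - Finsupp.single (Sum.inr w) 1) = 0 := by
              by_contra hne
              exact h.2 _ (mem_support_iff.2 hne) w (Finsupp.sub_single_add_single hw)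
            rw [this, mul_zero]
        · rw [mul_zero]
      · rw [if_pos (by simp), add_tsub_cancel_right]
        exact mul_pos zero_lt_one ((hQ _).lt_of_ne (mem_support_iff.1 hs).symm)
    exact Finset.mem_filter.2 ⟨mem_support_iff.2 this.ne', this⟩
  neg s hs i := by
    by_contra! h
    refine h.1 ?_
    have : 0 < (-indefPoly r * Q).coeff (s + Finsupp.single (Sum.inr i) 1) := by
      rw [neg_indefPoly_eq, coeff_linear_mul]
      refine Finset.sum_pos' (fun w _ => ?_) ⟨Sum.inr i, Finset.mem_univ _, ?_⟩
      · split_ifs with hw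
        · rcases w with w | w
          · have : Q.coeff (s + Finsupp.single (Sum.inr i) 1 - Finsupp.single (Sum.inl w) 1) = 0 := by
              by_contra hne
              exact h.2 _ (mem_support_iff.2 hne) w (Finsupp.sub_single_add_single hw)
            rw [this, mul_zero]
          · exact mul_nonneg (by simp [varSign]) (hQ _)
        · rw [mul_zero]
      · rw [if_pos (by simp), add_tsub_cancel_right]
        exact mul_pos (by simp [varSign]) ((hQ _).lt_of_ne (mem_support_iff.1 hs).symm)
    rw [neg_mul, coeff_neg, neg_pos] at this
    exact Finset.mem_filter.2 ⟨mem_support_iff.2 this.ne, this⟩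
  card_pos := hpos _ fun e he => (Finset.mem_filter.1 he).2
  card_neg := hneg _ fun e he => (Finset.mem_filter.1 he).2
  no_factor_x i := by
    obtain ⟨e, he, h⟩ := hnf (Sum.inl i)
    exact ⟨e, mem_support_iff.2 he, h⟩
  no_factor_y i := by
    obtain ⟨e, he, h⟩ := hnf (Sum.inr i)
    exact ⟨e, mem_support_iff.2 he, h⟩

theorem eq_linear_of_support {σ : Type*} [Fintype σ] {Q : MvPolynomial σ ℝ}
    (h : ∀ e ∈ Q.support, ∃ v, e = Finsupp.single v 1) :
    Q = ∑ v, C (Q.coeff (Finsupp.single v 1)) * X v := by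
  refine linear_of_isHomogeneous_one fun {e} he => ?_
  obtain ⟨v, rfl⟩ := h e (mem_support_iff.2 he)
  simp [Finsupp.weight_single]

theorem card_four {α : Type*} [DecidableEq α] {a b c d : α} (hab : a ≠ b) (hac : a ≠ c)
    (had : a ≠ d) (hbc : b ≠ c) (hbd : b ≠ d) (hcd : c ≠ d) :
    ({a, b, c, d} : Finset α).card = 4 := by
  rw [Finset.card_insert_of_notMem, Finset.card_insert_of_notMem, Finset.card_pair hcd] <;>
    simp [*]

theorem false_of_four_monomials (hr2 : r = 2) {p : (Fin r ⊕ Fin r →₀ ℕ) → Prop}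
    (hp : ∀ T : Finset (Fin r ⊕ Fin r →₀ ℕ), (∀ e ∈ T, p e) → T.card ≤ r + 1)
    {e₁ e₂ e₃ e₄ : Fin r ⊕ Fin r →₀ ℕ} (h₁ : p e₁) (h₂ : p e₂) (h₃ : p e₃) (h₄ : p e₄)
    (h₁₂ : e₁ ≠ e₂) (h₁₃ : e₁ ≠ e₃) (h₁₄ : e₁ ≠ e₄) (h₂₃ : e₂ ≠ e₃) (h₂₄ : e₂ ≠ e₄)
    (h₃₄ : e₃ ≠ e₄) : False := by
  classical
  have h := hp {e₁, e₂, e₃, e₄} (by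
    intro e he
    simp only [Finset.mem_insert, Finset.mem_singleton] at he
    rcases he with rfl | rfl | rfl | rfl <;> assumption)
  rw [card_four h₁₂ h₁₃ h₁₄ h₂₃ h₂₄ h₃₄] at h
  omega

theorem single_add_single_ne {σ : Type*} {a b c d : σ} (h1 : a ≠ c ∨ b ≠ d) (h2 : a ≠ d ∨ b ≠ c) :
    Finsupp.single a 1 + Finsupp.single b 1 ≠ (Finsupp.single c 1 + Finsupp.single d 1 : σ →₀ ℕ) := by
  classical
  intro h
  by_cases hac : a = c
  · subst hac
    have := add_left_cancel h
    exact h1.elim (· rfl) (· (Finsupp.single_left_injective one_ne_zero this))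
  · have h3 := DFunLike.congr_fun h a
    simp only [Finsupp.add_apply, Finsupp.single_apply, if_true, if_neg (Ne.symm hac)] at h3
    have had : d = a := by
      by_contra hne
      rw [if_neg hne] at h3
      omega
    subst had
    rw [add_comm (Finsupp.single c 1)] at h
    exact h2.elim (· rfl) (· (Finsupp.single_left_injective one_ne_zero (add_left_cancel h)))

/-- The classification of the products `(∑ x_i - ∑ y_j)^m * Q` with few monomials. -/
theorem quotient_classification (hr : 2 ≤ r) {Q : MvPolynomial (Fin r ⊕ Fin r) ℝ} {d m : ℕ}
    (hd : Q.IsHomogeneous d) (hQ : ∀ e, 0 ≤ Q.coeff e) (hm : 1 ≤ m)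
    (hnf : ∀ v, ∃ e, Q.coeff e ≠ 0 ∧ e v = 0)
    (hpos : ∀ T : Finset (Fin r ⊕ Fin r →₀ ℕ),
      (∀ e ∈ T, 0 < (indefPoly r ^ m * Q).coeff e) → T.card ≤ r + 1)
    (hneg : ∀ T : Finset (Fin r ⊕ Fin r →₀ ℕ),
      (∀ e ∈ T, (indefPoly r ^ m * Q).coeff e < 0) → T.card ≤ r + 1) :
    m = 1 ∧ ∃ c : ℝ, 0 < c ∧ (Q = C c ∨
      (r = 2 ∧ ∃ i j, Q = C c * (X (Sum.inl i) + X (Sum.inr j))) ∨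
      (r = 2 ∧ Q = C c * ∑ v, X v)) := by
  classical
  have h0 : Q ≠ 0 := by
    rintro rfl
    obtain ⟨e, he, -⟩ := hnf (Sum.inl ⟨0, by omega⟩)
    simp at he
  obtain rfl := pow_eq_one_of_nonneg hr hQ h0 hm hpos
  simp only [pow_one] at hpos hneg
  refine ⟨rfl, ?_⟩
  have hposc : ∀ e ∈ Q.support, 0 < Q.coeff e := fun e he =>
    (hQ e).lt_of_ne (mem_support_iff.1 he).symm
  set q : Fin r ⊕ Fin r → ℝ := fun v => Q.coeff (Finsupp.single v 1) with hq
  have hcoef : ∀ v w, v ≠ w → (Q = ∑ v, C (q v) * X v) →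
      coeff (Finsupp.single v 1 + Finsupp.single w 1) (indefPoly r * Q) =
        varSign v * q w + varSign w * q v := by
    intro v w hvw hQ'
    conv_lhs => rw [hQ', indefPoly_eq]
    exact coeff_linear_mul_linear _ _ hvw
  have hcoef' : ∀ v, (Q = ∑ v, C (q v) * X v) →
      coeff (Finsupp.single v 1 + Finsupp.single v 1) (indefPoly r * Q) = varSign v * q v := by
    intro v hQ'
    conv_lhs => rw [hQ', indefPoly_eq]
    exact coeff_linear_mul_linear_self _ _ v
  rcases (signConfig hd hQ hnf hpos hneg).support_classification hr with
    h | ⟨hr2, i, j, h⟩ | ⟨hr2, h⟩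
  · refine ⟨Q.coeff 0, hposc 0 ((h 0).2 rfl), Or.inl ?_⟩
    ext e
    rw [coeff_C]
    split_ifs with he
    · rw [← he]
    · by_contra hne
      exact he ((h e).1 (mem_support_iff.2 hne)).symm
  · have h' : ∀ s, s ∈ Q.support ↔ s = Finsupp.single (Sum.inl i) 1 ∨
        s = Finsupp.single (Sum.inr j) 1 := h
    have hQlin : Q = ∑ v, C (q v) * X v := eq_linear_of_support fun e he => by
      rcases (h' e).1 he with rfl | rfl
      exacts [⟨_, rfl⟩, ⟨_, rfl⟩]
    have hqi : 0 < q (Sum.inl i) := hposc _ ((h' _).2 (Or.inl rfl))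
    have hqj : 0 < q (Sum.inr j) := hposc _ ((h' _).2 (Or.inr rfl))
    have hq0 : ∀ v, v ≠ Sum.inl i → v ≠ Sum.inr j → q v = 0 := by
      intro v hv1 hv2
      by_contra hne
      rcases (h' _).1 (mem_support_iff.2 hne) with h | h
      · exact hv1 (Finsupp.single_left_injective one_ne_zero h)
      · exact hv2 (Finsupp.single_left_injective one_ne_zero h)
    obtain ⟨i', hi'⟩ := SignConfig.exists_index_ne hr i
    obtain ⟨j', hj'⟩ := SignConfig.exists_index_ne hr j
    have hqi' : q (Sum.inl i') = 0 := hq0 _ (by simpa using hi') (by simp)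
    have hqj' : q (Sum.inr j') = 0 := hq0 _ (by simp) (by simpa using hj')
    -- The coefficient of `x_i y_j` is `q_j - q_i`. Three monomials of each sign are present anyway,
    -- which for `r = 2` is the maximum, so this one must vanish.
    have heq : q (Sum.inl i) = q (Sum.inr j) := by
      rcases lt_trichotomy (q (Sum.inl i)) (q (Sum.inr j)) with hlt | heq | hlt
      · exfalso
        refine false_of_four_monomials hr2 (p := fun e => 0 < (indefPoly r * Q).coeff e) hpos
          (e₁ := Finsupp.single (Sum.inl i) 1 + Finsupp.single (Sum.inl i) 1)
          (e₂ := Finsupp.single (Sum.inl i) 1 + Finsupp.single (Sum.inl i') 1)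
          (e₃ := Finsupp.single (Sum.inl i') 1 + Finsupp.single (Sum.inr j) 1)
          (e₄ := Finsupp.single (Sum.inl i) 1 + Finsupp.single (Sum.inr j) 1)
          ?_ ?_ ?_ ?_ (single_add_single_ne ?_ ?_) (single_add_single_ne ?_ ?_)
          (single_add_single_ne ?_ ?_) (single_add_single_ne ?_ ?_) (single_add_single_ne ?_ ?_)
          (single_add_single_ne ?_ ?_) <;>
          try solve | simp [hi', hi'.symm]
        · rw [hcoef' _ hQlin]
          simpa [varSign] using hqi
        · rw [hcoef _ _ (by simpa using hi'.symm) hQlin]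
          simpa [varSign, hqi'] using hqi
        · rw [hcoef _ _ (by simp) hQlin]
          simpa [varSign, hqi'] using hqj
        · rw [hcoef _ _ (by simp) hQlin]
          simpa [varSign] using hlt
      · exact heq
      · exfalso
        refine false_of_four_monomials hr2 (p := fun e => (indefPoly r * Q).coeff e < 0) hneg
          (e₁ := Finsupp.single (Sum.inr j) 1 + Finsupp.single (Sum.inr j) 1)
          (e₂ := Finsupp.single (Sum.inr j) 1 + Finsupp.single (Sum.inr j') 1)
          (e₃ := Finsupp.single (Sum.inl i) 1 + Finsupp.single (Sum.inr j') 1)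
          (e₄ := Finsupp.single (Sum.inl i) 1 + Finsupp.single (Sum.inr j) 1)
          ?_ ?_ ?_ ?_ (single_add_single_ne ?_ ?_) (single_add_single_ne ?_ ?_)
          (single_add_single_ne ?_ ?_) (single_add_single_ne ?_ ?_) (single_add_single_ne ?_ ?_)
          (single_add_single_ne ?_ ?_) <;>
          try solve | simp [hj', hj'.symm]
        · rw [hcoef' _ hQlin]
          simpa [varSign] using hqj
        · rw [hcoef _ _ (by simpa using hj'.symm) hQlin]
          simpa [varSign, hqj'] using hqj
        · rw [hcoef _ _ (by simp) hQlin]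
          simpa [varSign, hqj'] using hqi
        · rw [hcoef _ _ (by simp) hQlin]
          simpa [varSign] using hlt
    refine ⟨q (Sum.inl i), hqi, Or.inr (Or.inl ⟨hr2, i, j, ?_⟩)⟩
    conv_lhs => rw [hQlin]
    rw [Finset.sum_eq_add (Sum.inl i) (Sum.inr j) (by simp)]
    · rw [← heq]
      ring
    · intro v _ hv
      rw [hq0 v hv.1 hv.2]
      simp
    · simp
    · simp
  · have h' : ∀ s, s ∈ Q.support ↔ (∃ i, s = Finsupp.single (Sum.inl i) 1) ∨
        ∃ j, s = Finsupp.single (Sum.inr j) 1 := h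
    have hQlin : Q = ∑ v, C (q v) * X v := eq_linear_of_support fun e he => by
      rcases (h' e).1 he with ⟨i, rfl⟩ | ⟨i, rfl⟩
      exacts [⟨_, rfl⟩, ⟨_, rfl⟩]
    have hqpos : ∀ v, 0 < q v := by
      rintro (v | v)
      · exact hposc _ ((h' _).2 (Or.inl ⟨v, rfl⟩))
      · exact hposc _ ((h' _).2 (Or.inr ⟨v, rfl⟩))
    obtain ⟨i, i', hi'⟩ : ∃ i i' : Fin r, i ≠ i' := ⟨⟨0, by omega⟩, ⟨1, by omega⟩, by simp⟩
    -- Again there are three monomials of each sign, the quadratic ones in the `x` alone and in the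
    -- `y` alone; hence no mixed term survives.
    have heq : ∀ a b, q (Sum.inl a) = q (Sum.inr b) := by
      intro a b
      rcases lt_trichotomy (q (Sum.inl a)) (q (Sum.inr b)) with hlt | heq | hlt
      · exfalso
        refine false_of_four_monomials hr2 (p := fun e => 0 < (indefPoly r * Q).coeff e) hpos
          (e₁ := Finsupp.single (Sum.inl i) 1 + Finsupp.single (Sum.inl i) 1)
          (e₂ := Finsupp.single (Sum.inl i) 1 + Finsupp.single (Sum.inl i') 1)
          (e₃ := Finsupp.single (Sum.inl i') 1 + Finsupp.single (Sum.inl i') 1)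
          (e₄ := Finsupp.single (Sum.inl a) 1 + Finsupp.single (Sum.inr b) 1)
          ?_ ?_ ?_ ?_ (single_add_single_ne ?_ ?_) (single_add_single_ne ?_ ?_)
          (single_add_single_ne ?_ ?_) (single_add_single_ne ?_ ?_) (single_add_single_ne ?_ ?_)
          (single_add_single_ne ?_ ?_) <;>
          try solve | simp [hi']
        · rw [hcoef' _ hQlin]
          simpa [varSign] using hqpos _
        · rw [hcoef _ _ (by simpa using hi') hQlin]
          simpa [varSign] using add_pos (hqpos _) (hqpos _)
        · rw [hcoef' _ hQlin]
          simpa [varSign] using hqpos _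
        · rw [hcoef _ _ (by simp) hQlin]
          simpa [varSign] using hlt
      · exact heq
      · exfalso
        refine false_of_four_monomials hr2 (p := fun e => (indefPoly r * Q).coeff e < 0) hneg
          (e₁ := Finsupp.single (Sum.inr i) 1 + Finsupp.single (Sum.inr i) 1)
          (e₂ := Finsupp.single (Sum.inr i) 1 + Finsupp.single (Sum.inr i') 1)
          (e₃ := Finsupp.single (Sum.inr i') 1 + Finsupp.single (Sum.inr i') 1)
          (e₄ := Finsupp.single (Sum.inl a) 1 + Finsupp.single (Sum.inr b) 1)
          ?_ ?_ ?_ ?_ (single_add_single_ne ?_ ?_) (single_add_single_ne ?_ ?_)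
          (single_add_single_ne ?_ ?_) (single_add_single_ne ?_ ?_) (single_add_single_ne ?_ ?_)
          (single_add_single_ne ?_ ?_) <;>
          try solve | simp [hi']
        · rw [hcoef' _ hQlin]
          simpa [varSign] using hqpos _
        · rw [hcoef _ _ (by simpa using hi') hQlin]
          have := add_pos (hqpos (Sum.inr i)) (hqpos (Sum.inr i'))
          simp only [varSign, Sum.elim_inr]
          linarith
        · rw [hcoef' _ hQlin]
          simpa [varSign] using hqpos _
        · rw [hcoef _ _ (by simp) hQlin]
          simpa [varSign] using hlt
    refine ⟨q (Sum.inl i), hqpos _, Or.inr (Or.inr ⟨hr2, ?_⟩)⟩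
    conv_lhs => rw [hQlin]
    rw [Finset.mul_sum]
    refine Finset.sum_congr rfl ?_
    rintro (v | v) -
    · rw [heq v v, heq i v]
    · rw [heq i v]

end LinearQuotient

/-! ### Divisibility by the indefinite linear form. -/

section Divisibility

open MvPolynomial

/-- Modulo `L` the substitution is the identity. -/
theorem dvd_sub_bind₁ {σ R : Type*} [CommRing R] {L : MvPolynomial σ R}
    {φ : σ → MvPolynomial σ R} (h : ∀ v, L ∣ X v - φ v) (P : MvPolynomial σ R) :
    L ∣ P - bind₁ φ P := by
  induction P using MvPolynomial.induction_on with
  | C a => simp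
  | add p q hp hq =>
    rw [map_add, add_sub_add_comm]
    exact dvd_add hp hq
  | mul_X p v hp =>
    rw [map_mul, bind₁_X_right]
    have : p * X v - bind₁ φ p * φ v = (p - bind₁ φ p) * X v + bind₁ φ p * (X v - φ v) := by ring
    rw [this]
    exact dvd_add (hp.mul_right _) ((h v).mul_left _)

variable {r : ℕ}

/-- Substituting `x_1 - L` for `x_1` solves `L = 0` for `x_1` and changes `P` by a multiple of `L`;
the substituted polynomial is zero. -/
theorem indefPoly_dvd (hr : 1 ≤ r) {P : MvPolynomial (Fin r ⊕ Fin r) ℝ}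
    (h : ∀ x : Fin r ⊕ Fin r → ℝ, (∀ v, 0 < x v) → eval x (indefPoly r) = 0 → eval x P = 0) :
    indefPoly r ∣ P := by
  classical
  set i : Fin r := ⟨0, hr⟩
  set φ : Fin r ⊕ Fin r → MvPolynomial (Fin r ⊕ Fin r) ℝ :=
    Function.update X (Sum.inl i) (X (Sum.inl i) - indefPoly r) with hφ
  have h1 : indefPoly r ∣ P - bind₁ φ P := dvd_sub_bind₁ (fun v => by
    by_cases hv : v = Sum.inl i
    · subst hv
      simp [hφ]
    · simp [hφ, hv]) P
  have h2 : bind₁ φ P = 0 := by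
    -- On this box `L < 0`, so the new value `x_1 - L` stays positive and the substituted point lies
    -- in the positive orthant on `L = 0`. A product of infinite sets suffices for the vanishing of
    -- a polynomial.
    refine funext_set (s := Sum.elim (fun _ => Set.Ioo (0 : ℝ) 1) fun _ => Set.Ioo (1 : ℝ) 2) ?_ ?_
    · rintro (v | v)
      · exact Set.Ioo_infinite zero_lt_one
      · exact Set.Ioo_infinite one_lt_two
    · intro x hx
      have hxl : ∀ a, 0 < x (Sum.inl a) ∧ x (Sum.inl a) < 1 := fun a => hx (Sum.inl a) trivial
      have hxr : ∀ a, 1 < x (Sum.inr a) ∧ x (Sum.inr a) < 2 := fun a => hx (Sum.inr a) trivial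
      have hL : eval x (indefPoly r) < 0 := by
        rw [eval_indefPoly, sub_neg]
        exact Finset.sum_lt_sum_of_nonempty ⟨i, Finset.mem_univ _⟩
          fun a _ => (hxl a).2.trans (hxr a).1
      have he : (fun v => eval x (φ v)) =
          Function.update x (Sum.inl i) (x (Sum.inl i) - eval x (indefPoly r)) := by
        funext v
        by_cases hv : v = Sum.inl i
        · subst hv
          simp [hφ]
        · simp [hφ, hv]
      rw [map_zero]
      have hb : eval x (bind₁ φ P) = eval (fun v => eval x (φ v)) P := by
        rw [← coe_aeval_eq_eval, ← coe_aeval_eq_eval]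
        exact aeval_bind₁ _ _ _
      rw [hb, he]
      apply h
      · intro v
        by_cases hv : v = Sum.inl i
        · subst hv
          simp only [Function.update_self]
          linarith [(hxl i).1]
        · rw [Function.update_of_ne hv]
          rcases v with v | v
          · exact (hxl v).1
          · linarith [(hxr v).1]
      · have : Function.update x (Sum.inl i) (x (Sum.inl i) - eval x (indefPoly r)) =
            fun v => x v - if v = Sum.inl i then eval x (indefPoly r) else 0 := by
          funext v
          by_cases hv : v = Sum.inl i
          · subst hv
            simp
          · simp [hv]
        rw [this, eval_indefPoly]
        simp only [Finset.sum_sub_distrib, Sum.inl.injEq, Finset.sum_ite_eq', Finset.mem_univ,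
          if_true, reduceCtorEq, if_false, sub_zero]
        rw [eval_indefPoly]
        ring
  rwa [h2, sub_zero] at h1

/-- Multiplication by `L` raises degrees by one, so only one homogeneous component of the quotient
matters. The product has no constant term, which excludes `D = 0`. -/
theorem exists_homogeneous_quotient {P : MvPolynomial (Fin r ⊕ Fin r) ℝ} {D : ℕ}
    (hP : P.IsHomogeneous D) (h0 : P ≠ 0) (hdvd : indefPoly r ∣ P) :
    ∃ d Q, D = d + 1 ∧ Q.IsHomogeneous d ∧ P = indefPoly r * Q := by
  obtain ⟨Q, rfl⟩ := hdvd
  have key : ∀ e : Fin r ⊕ Fin r →₀ ℕ, ∀ v, e v ≠ 0 →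
      (e - Finsupp.single v 1).degree + 1 = e.degree := fun e v hv => by
    conv_rhs => rw [← Finsupp.sub_single_add_single hv]
    rw [map_add, Finsupp.degree_single]
  obtain ⟨d, rfl⟩ : ∃ d, D = d + 1 := by
    refine Nat.exists_eq_succ_of_ne_zero ?_
    rintro rfl
    obtain ⟨e, he⟩ := ne_zero_iff.1 h0
    have hdeg : e.degree = 0 := by
      by_contra hne
      exact he (hP.coeff_eq_zero hne)
    rw [Finsupp.degree_eq_zero_iff] at hdeg
    subst hdeg
    rw [indefPoly_eq, coeff_linear_mul] at he
    simp at he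
  refine ⟨d, homogeneousComponent d Q, rfl, homogeneousComponent_isHomogeneous d Q, ?_⟩
  ext e
  by_cases he : e.degree = d + 1
  · rw [indefPoly_eq, coeff_linear_mul, coeff_linear_mul]
    refine Finset.sum_congr rfl fun v _ => ?_
    split_ifs with hv
    · rw [coeff_homogeneousComponent, if_pos]
      have := key e v hv
      omega
    · rfl
  · rw [hP.coeff_eq_zero he, indefPoly_eq, coeff_linear_mul, Finset.sum_eq_zero]
    intro v _
    split_ifs with hv
    · rw [coeff_homogeneousComponent, if_neg, mul_zero]
      have := key e v hv
      omega
    · rw [mul_zero]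

end Divisibility

/-! ### The norm polynomial of a monomial map. -/

/-- Exponents and coefficients of the components of a monomial map. -/
theorem TypeI.RatMap.IsMonomial.exists_data {r s r' s' : ℕ} {g : TypeI.RatMap r s r' s'}
    (h : g.IsMonomial) : ∃ (E : Fin r' ⊕ Fin s' → (Fin r ⊕ Fin s) →₀ ℕ) (c : Fin r' ⊕ Fin s' → ℂ),
      ∀ k, g.comp k = MvPolynomial.monomial (E k) (c k) := by
  choose E c h using h
  exact ⟨E, c, h⟩

/-- The real polynomial `∑ ± ‖c_k‖² x^{E_k}`. -/
noncomputable def monomialNormPoly {σ : Type*} {a b : ℕ} (E : Fin a ⊕ Fin b → σ →₀ ℕ)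
    (c : Fin a ⊕ Fin b → ℂ) : MvPolynomial σ ℝ :=
  ∑ k, MvPolynomial.monomial (E k) (varSign k * ‖c k‖ ^ 2)

section monomialNormPoly

open MvPolynomial

variable {σ : Type*} {a b : ℕ} {E : Fin a ⊕ Fin b → σ →₀ ℕ} {c : Fin a ⊕ Fin b → ℂ}

theorem form_eq_sum (v : Fin a ⊕ Fin b → ℂ) : TypeI.form v = ∑ k, varSign k * ‖v k‖ ^ 2 := by
  simp [TypeI.form, varSign, sub_eq_add_neg]

theorem eval_monomialNormPoly (z : σ → ℂ) : eval (fun i => ‖z i‖ ^ 2) (monomialNormPoly E c) =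
    TypeI.form fun k => eval z (monomial (E k) (c k)) := by
  rw [form_eq_sum, monomialNormPoly, map_sum]
  refine Finset.sum_congr rfl fun k _ => ?_
  simp only [eval_monomial, norm_mul, mul_pow, Finsupp.prod, norm_prod, norm_pow, mul_assoc,
    ← Finset.prod_pow]
  simp only [← pow_mul, mul_comm]

open Classical in
theorem coeff_monomialNormPoly (e : σ →₀ ℕ) :
    coeff e (monomialNormPoly E c) =
      ∑ k, if E k = e then varSign k * ‖c k‖ ^ 2 else 0 := by
  simp [monomialNormPoly, coeff_sum, coeff_monomial]

/-- Components with equal exponents may merge or cancel, but a positive sum needs at least one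
nonzero positive term. -/
theorem exists_of_coeff_pos {e : σ →₀ ℕ} (he : 0 < coeff e (monomialNormPoly E c)) :
    ∃ k, E (Sum.inl k) = e ∧ c (Sum.inl k) ≠ 0 := by
  classical
  rw [coeff_monomialNormPoly] at he
  by_contra! h
  refine absurd he (not_lt.2 (Finset.sum_nonpos ?_))
  rintro (k | k) -
  · split_ifs with hk
    · simp [h k hk]
    · rfl
  · split_ifs with hk
    · simp [varSign]
    · rfl

theorem exists_of_coeff_neg {e : σ →₀ ℕ} (he : coeff e (monomialNormPoly E c) < 0) :
    ∃ k, E (Sum.inr k) = e ∧ c (Sum.inr k) ≠ 0 := by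
  classical
  rw [coeff_monomialNormPoly] at he
  by_contra! h
  refine absurd he (not_lt.2 (Finset.sum_nonneg ?_))
  rintro (k | k) -
  · split_ifs with hk
    · simp [varSign]
    · rfl
  · split_ifs with hk
    · simp [h k hk]
    · rfl

/-- Distinct monomials with positive coefficient come from distinct positive components. This bound
drives the whole classification. -/
theorem card_pos_le (T : Finset (σ →₀ ℕ)) (hT : ∀ e ∈ T, 0 < coeff e (monomialNormPoly E c)) :
    T.card ≤ a := by
  classical
  have : T ⊆ Finset.univ.image fun k => E (Sum.inl k) := fun e he => by
    obtain ⟨k, hk, -⟩ := exists_of_coeff_pos (hT e he)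
    exact Finset.mem_image.2 ⟨k, Finset.mem_univ _, hk⟩
  simpa using (Finset.card_le_card this).trans Finset.card_image_le

theorem card_neg_le (T : Finset (σ →₀ ℕ)) (hT : ∀ e ∈ T, coeff e (monomialNormPoly E c) < 0) :
    T.card ≤ b := by
  classical
  have : T ⊆ Finset.univ.image fun k => E (Sum.inr k) := fun e he => by
    obtain ⟨k, hk, -⟩ := exists_of_coeff_neg (hT e he)
    exact Finset.mem_image.2 ⟨k, Finset.mem_univ _, hk⟩
  simpa using (Finset.card_le_card this).trans Finset.card_image_le

theorem monomialNormPoly_isHomogeneous {D : ℕ}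
    (h : ∀ k, (monomial (E k) (c k) : MvPolynomial σ ℂ).IsHomogeneous D) :
    (monomialNormPoly E c).IsHomogeneous D := by
  classical
  refine IsHomogeneous.sum _ _ _ fun k _ => ?_
  by_cases hc : c k = 0
  · simp only [hc, norm_zero, ne_eq, OfNat.ofNat_ne_zero, not_false_eq_true, zero_pow, mul_zero,
      monomial_zero]
    exact isHomogeneous_zero _ _ _
  · refine isHomogeneous_monomial _ ?_
    by_contra hne
    have := (h k).coeff_eq_zero hne
    rw [coeff_monomial, if_pos rfl] at this
    exact hc this

/-- Polynomials which agree at all squared absolute values are equal. -/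
theorem eq_of_eval_norm_sq {P P' : MvPolynomial σ ℝ}
    (h : ∀ z : σ → ℂ, eval (fun i => ‖z i‖ ^ 2) P = eval (fun i => ‖z i‖ ^ 2) P') : P = P' := by
  refine funext_set (s := fun _ => Set.Ioi (0 : ℝ)) (fun _ => Set.Ioi_infinite 0) fun x hx => ?_
  have : x = fun i => ‖((√(x i) : ℝ) : ℂ)‖ ^ 2 := by
    funext i
    have : 0 < x i := hx i trivial
    rw [Complex.norm_real, Real.norm_of_nonneg (Real.sqrt_nonneg _), Real.sq_sqrt this.le]
  rw [this]
  exact h _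

end monomialNormPoly

namespace TypeI

/-! ### The domain, projective space, and the relation between `f` and `g`. -/

section Domain

variable {r s : ℕ}

theorem form_sum_elim (x : Fin r → ℂ) (y : Fin s → ℂ) :
    form (Sum.elim x y) = ∑ i, ‖x i‖ ^ 2 - ∑ j, ‖y j‖ ^ 2 := rfl

theorem continuous_form : Continuous (form : (Fin r ⊕ Fin s → ℂ) → ℝ) := by
  unfold form
  fun_prop

theorem star_dotProduct_self (x : Fin r → ℂ) : star x ⬝ᵥ x = ((∑ i, ‖x i‖ ^ 2 : ℝ) : ℂ) := by
  simp [dotProduct, Complex.conj_mul']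

/-- `Z` lies in the domain if the form is positive on the nonzero vectors `(x, xZ)`. -/
theorem mem_Omega_iff {Z : Matrix (Fin r) (Fin s) ℂ} :
    Z ∈ Omega r s ↔ ∀ x : Fin r → ℂ, x ≠ 0 → 0 < form (Sum.elim x (Matrix.vecMul x Z)) := by
  have key : ∀ x : Fin r → ℂ, star (star x) ⬝ᵥ ((1 - Z * Z.conjTranspose).mulVec (star x)) =
      ((form (Sum.elim x (Matrix.vecMul x Z)) : ℝ) : ℂ) := by
    intro x
    have h1 : (Z * Z.conjTranspose).mulVec (star x) = Z.mulVec (star (Matrix.vecMul x Z)) := by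
      rw [← Matrix.mulVec_mulVec, ← Matrix.star_vecMul]
    rw [Matrix.sub_mulVec, Matrix.one_mulVec, dotProduct_sub, h1, star_star,
      Matrix.dotProduct_mulVec, dotProduct_comm, star_dotProduct_self,
      dotProduct_comm (Matrix.vecMul x Z), star_dotProduct_self, form_sum_elim]
    push_cast
    rfl
  show (1 - Z * Z.conjTranspose).PosDef ↔ _
  rw [Matrix.posDef_iff_dotProduct_mulVec]
  constructor
  · rintro ⟨-, h⟩ x hx
    have := h (x := star x) (by simpa using hx)
    rw [key] at this
    exact_mod_cast this
  · intro h
    refine ⟨?_, fun x hx => ?_⟩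
    · exact Matrix.isHermitian_one.sub (Matrix.isHermitian_mul_conjTranspose_self Z)
    · have := key (star x)
      simp only [star_star] at this
      rw [this]
      exact_mod_cast h (star x) (by simpa using hx)

theorem sum_elim_smul (a : ℂ) (x : Fin r → ℂ) (y : Fin s → ℂ) :
    Sum.elim (a • x) (a • y) = a • Sum.elim x y := by
  funext v
  rcases v with v | v <;> rfl

/-- By homogeneity, positivity need only be tested on the compact unit sphere, where it is an open
condition on `Z`. -/
theorem isOpen_Omega : IsOpen (Omega r s) := by
  have hS : Omega r s = {Z | ∀ x ∈ Metric.sphere (0 : Fin r → ℂ) 1,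
      0 < form (Sum.elim x (Matrix.vecMul x Z))} := by
    ext Z
    rw [mem_Omega_iff]
    refine ⟨fun h x hx => h x ?_, fun h x hx => ?_⟩
    · rintro rfl
      simp at hx
    · have h1 := h (((‖x‖⁻¹ : ℝ) : ℂ) • x) (by
        rw [mem_sphere_zero_iff_norm, norm_smul, Complex.norm_real, norm_inv, norm_norm,
          inv_mul_cancel₀ (norm_ne_zero_iff.2 hx)])
      rw [Matrix.smul_vecMul, sum_elim_smul, form_smul] at h1
      exact pos_of_mul_pos_right h1 (by positivity)
  rw [hS, isOpen_iff_mem_nhds]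
  intro Z hZ
  refine (isCompact_sphere _ _).eventually_forall_of_forall_eventually fun x hx => ?_
  have hc : Continuous fun p : Matrix (Fin r) (Fin s) ℂ × (Fin r → ℂ) =>
      form (Sum.elim p.2 (Matrix.vecMul p.2 p.1)) := by
    refine continuous_form.comp (continuous_pi fun v => ?_)
    rcases v with v | v
    · exact (continuous_apply v).comp continuous_snd
    · exact (continuous_apply v).comp (continuous_snd.matrix_vecMul continuous_fst)
  exact hc.continuousAt.eventually (lt_mem_nhds (hZ x hx))

theorem continuous_mk :
    Continuous (Projectivization.mk' ℂ : {v : Fin r ⊕ Fin s → ℂ // v ≠ 0} → Proj r s) :=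
  continuous_coinduced_rng

/-- The saturation of an open set is the union of its multiples by units. -/
theorem isOpenMap_mk :
    IsOpenMap (Projectivization.mk' ℂ : {v : Fin r ⊕ Fin s → ℂ // v ≠ 0} → Proj r s) := by
  intro W hW
  rw [isOpen_coinduced]
  have : Projectivization.mk' ℂ ⁻¹' (Projectivization.mk' ℂ '' W) =
      ⋃ a : ℂˣ, (fun v : {v : Fin r ⊕ Fin s → ℂ // v ≠ 0} =>
        (⟨a • v.1, (smul_ne_zero_iff_ne a).2 v.2⟩ : {v : Fin r ⊕ Fin s → ℂ // v ≠ 0})) ⁻¹' W := by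
    ext v
    simp only [Set.mem_preimage, Set.mem_image, Set.mem_iUnion]
    constructor
    · rintro ⟨w, hw, h⟩
      obtain ⟨a, ha⟩ := (Projectivization.mk_eq_mk_iff ℂ w.1 v.1 w.2 v.2).1 h
      refine ⟨a, ?_⟩
      convert hw
    · rintro ⟨a, ha⟩
      exact ⟨_, ha, (Projectivization.mk_eq_mk_iff ℂ _ _ _ _).2 ⟨a, rfl⟩⟩
  rw [this]
  refine isOpen_iUnion fun a => hW.preimage ?_
  exact (continuous_subtype_val.const_smul a).subtype_mk _

variable {r' s' : ℕ} (g : RatMap r s r' s')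

theorem RatMap.evalVec_smul (a : ℂ) (v : Fin r ⊕ Fin s → ℂ) :
    g.evalVec (a • v) = a ^ g.degree • g.evalVec v := by
  funext k
  simp only [RatMap.evalVec, Pi.smul_apply, smul_eq_mul]
  rw [MvPolynomial.eval_eq, MvPolynomial.eval_eq, Finset.mul_sum]
  refine Finset.sum_congr rfl fun e he => ?_
  have hd := (g.homogeneous k).degree_eq_sum_deg_support he
  simp only [Pi.smul_apply, smul_eq_mul, mul_pow]
  rw [Finset.prod_mul_distrib, Finset.prod_pow_eq_pow_sum, ← hd]
  ring

theorem RatMap.evalVec_rep {v : Fin r ⊕ Fin s → ℂ} (hv : v ≠ 0) :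
    ∃ a : ℂ, a ≠ 0 ∧ g.evalVec (Projectivization.mk ℂ v hv).rep = a • g.evalVec v := by
  obtain ⟨a, ha⟩ := Projectivization.exists_smul_eq_mk_rep ℂ v hv
  refine ⟨a.1 ^ g.degree, pow_ne_zero _ a.ne_zero, ?_⟩
  rw [← ha, Units.smul_def, evalVec_smul]

theorem RatMap.mk_mem_indeterminacy {v : Fin r ⊕ Fin s → ℂ} (hv : v ≠ 0) :
    Projectivization.mk ℂ v hv ∈ g.indeterminacy ↔ g.evalVec v = 0 := by
  obtain ⟨a, ha, h⟩ := g.evalVec_rep hv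
  show g.evalVec _ = 0 ↔ _
  rw [h, smul_eq_zero_iff_right ha]

theorem RatMap.toFun_mk {v : Fin r ⊕ Fin s → ℂ} (hv : v ≠ 0)
    (h : Projectivization.mk ℂ v hv ∉ g.indeterminacy) :
    g.toFun (Projectivization.mk ℂ v hv) h =
      Projectivization.mk ℂ (g.evalVec v) fun h' => h ((g.mk_mem_indeterminacy hv).2 h') := by
  obtain ⟨a, ha, h'⟩ := g.evalVec_rep hv
  exact (Projectivization.mk_eq_mk_iff ℂ _ _ _ _).2 ⟨Units.mk0 a ha, h'.symm⟩

theorem RatMap.continuous_evalVec : Continuous g.evalVec :=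
  continuous_pi fun k => MvPolynomial.continuous_eval (g.comp k)

theorem ne_zero_of_form_pos {v : Fin r ⊕ Fin s → ℂ} (h : 0 < form v) : v ≠ 0 := by
  rintro rfl
  simp [form] at h

variable {g}

theorem RatMap.IsProper.form_pos (hg : g.IsProper) {v : Fin r ⊕ Fin s → ℂ} (hv : 0 < form v)
    (h : g.evalVec v ≠ 0) : 0 < form (g.evalVec v) := by
  have hv0 := ne_zero_of_form_pos hv
  have h1 := hg.1 (Projectivization.mk ℂ v hv0) ((mk_mem_genBall v hv0).2 hv)
    fun h' => h ((g.mk_mem_indeterminacy hv0).1 h')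
  rwa [g.toFun_mk, mk_mem_genBall] at h1

/-- Pushing a null vector into the positive cone. -/
theorem form_add_smul_inl {v : Fin r ⊕ Fin s → ℂ} (hv : form v = 0) (t : ℝ) :
    form (v + (t : ℂ) • Sum.elim (fun i => v (Sum.inl i)) 0) =
      (2 * t + t ^ 2) * ∑ i, ‖v (Sum.inl i)‖ ^ 2 := by
  have h1 : ∀ i, ‖v (Sum.inl i) + (t : ℂ) * v (Sum.inl i)‖ ^ 2 =
      (1 + t) ^ 2 * ‖v (Sum.inl i)‖ ^ 2 := fun i => by
    rw [show v (Sum.inl i) + (t : ℂ) * v (Sum.inl i) = ((1 + t : ℝ) : ℂ) * v (Sum.inl i) by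
      push_cast; ring, norm_mul, mul_pow, Complex.norm_real, Real.norm_eq_abs, sq_abs]
  have h2 : ∑ i, ‖v (Sum.inl i)‖ ^ 2 = ∑ j, ‖v (Sum.inr j)‖ ^ 2 := sub_eq_zero.1 hv
  simp only [form, Pi.add_apply, Pi.smul_apply, Sum.elim_inl, Sum.elim_inr, Pi.zero_apply,
    smul_eq_mul, mul_zero, add_zero, h1, ← Finset.mul_sum]
  rw [← h2]
  ring

theorem isCompact_image_mk {K : Set (Fin r ⊕ Fin s → ℂ)} (hK : IsCompact K) (h0 : ∀ v ∈ K, v ≠ 0) :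
    IsCompact {X : Proj r s | ∃ v, ∃ hv : v ∈ K, X = Projectivization.mk ℂ v (h0 v hv)} := by
  have := isCompact_iff_compactSpace.1 hK
  have hc : Continuous fun v : K => (Projectivization.mk' ℂ ⟨v.1, h0 v.1 v.2⟩ : Proj r s) :=
    continuous_mk.comp (continuous_subtype_val.subtype_mk _)
  convert isCompact_range hc
  ext X
  constructor
  · rintro ⟨v, hv, rfl⟩
    exact ⟨⟨v, hv⟩, rfl⟩
  · rintro ⟨v, rfl⟩
    exact ⟨v.1, v.2, rfl⟩

-- Approach the null vector `v` from the positive cone. By continuity the form of `g(v)` is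
-- nonnegative. Were it positive, the images would stay near `g(v)`, in a compact subset of the
-- target ball, against properness.
open Filter Topology in
theorem RatMap.IsProper.form_eq_zero (hg : g.IsProper) {v : Fin r ⊕ Fin s → ℂ} (hv0 : v ≠ 0)
    (hv : form v = 0) : form (g.evalVec v) = 0 := by
  by_cases hw : g.evalVec v = 0
  · rw [hw]
    simp [form]
  have hx : 0 < ∑ i, ‖v (Sum.inl i)‖ ^ 2 := by
    refine (Finset.sum_nonneg fun i _ => by positivity).lt_of_ne fun h => hv0 ?_
    have h2 : ∑ i, ‖v (Sum.inl i)‖ ^ 2 = ∑ j, ‖v (Sum.inr j)‖ ^ 2 := sub_eq_zero.1 hv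
    rw [← h] at h2
    have h3 := (Finset.sum_eq_zero_iff_of_nonneg fun i _ => by positivity).1 h.symm
    have h4 := (Finset.sum_eq_zero_iff_of_nonneg fun i _ => by positivity).1 h2.symm
    funext i
    rcases i with i | i
    · simpa using h3 i (Finset.mem_univ _)
    · simpa using h4 i (Finset.mem_univ _)
  set γ : ℝ → Fin r ⊕ Fin s → ℂ := fun t => v + (t : ℂ) • Sum.elim (fun i => v (Sum.inl i)) 0
  have hγ : Continuous γ := by
    refine continuous_const.add ?_
    exact Complex.continuous_ofReal.smul continuous_const
  have hγ0 : γ 0 = v := by simp [γ]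
  have hγlim : Tendsto γ (𝓝[>] 0) (𝓝 v) := by
    have := hγ.tendsto 0
    rw [hγ0] at this
    exact this.mono_left nhdsWithin_le_nhds
  have hγpos : ∀ t, 0 < t → 0 < form (γ t) := fun t ht => by
    rw [form_add_smul_inl hv]
    positivity
  have hglim : Tendsto (fun t => g.evalVec (γ t)) (𝓝[>] 0) (𝓝 (g.evalVec v)) :=
    (g.continuous_evalVec.tendsto v).comp hγlim
  have hne : ∀ᶠ t in 𝓝[>] (0 : ℝ), g.evalVec (γ t) ≠ 0 :=
    hglim.eventually (isOpen_ne.mem_nhds hw)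
  have hnn : 0 ≤ form (g.evalVec v) := by
    refine ge_of_tendsto ((continuous_form.tendsto _).comp hglim) ?_
    filter_upwards [hne, self_mem_nhdsWithin] with t ht1 ht2
    exact (hg.form_pos (hγpos t ht2) ht1).le
  by_contra hform
  have hfpos : 0 < form (g.evalVec v) := hnn.lt_of_ne (Ne.symm hform)
  -- A closed ball inside the positive cone projects to a compact subset of the generalized ball.
  obtain ⟨ε, hε, hball⟩ := Metric.nhds_basis_closedBall.mem_iff.1
    (continuous_form.continuousAt.eventually (lt_mem_nhds hfpos))
  have hK0 : ∀ w ∈ Metric.closedBall (g.evalVec v) ε, w ≠ 0 := fun w hw =>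
    ne_zero_of_form_pos (hball hw)
  -- The default value is never used for `t > 0`, where `γ t ≠ 0`; it only makes the path total.
  have hmk : Tendsto (fun t => if h : γ t ≠ 0 then Projectivization.mk ℂ (γ t) h else
      Projectivization.mk ℂ v hv0) (𝓝[>] 0) (𝓝 (Projectivization.mk ℂ v hv0)) := by
    rw [tendsto_def]
    intro O hO
    obtain ⟨O', hO'O, hO', hvO'⟩ := mem_nhds_iff.1 hO
    have h1 := (isOpen_coinduced.1 hO')
    obtain ⟨W, hW, hWO⟩ := isOpen_induced_iff.1 h1
    have hvW : v ∈ W := by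
      have : (⟨v, hv0⟩ : {v : Fin r ⊕ Fin s → ℂ // v ≠ 0}) ∈ Subtype.val ⁻¹' W := by
        rw [hWO]
        exact hvO'
      exact this
    filter_upwards [hγlim.eventually (hW.mem_nhds hvW)] with t ht
    by_cases h : γ t ≠ 0
    · rw [Set.mem_preimage, dif_pos h]
      have : (⟨γ t, h⟩ : {v : Fin r ⊕ Fin s → ℂ // v ≠ 0}) ∈ Subtype.val ⁻¹' W := ht
      rw [hWO] at this
      exact hO'O this
    · rw [Set.mem_preimage, dif_neg h]
      exact hO'O hvO'
  have hfront : Projectivization.mk ℂ v hv0 ∈ frontier (GenBall r s) := by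
    refine ⟨mem_closure_of_tendsto hmk ?_, fun h => ?_⟩
    · filter_upwards [self_mem_nhdsWithin] with t ht
      have := hγpos t ht
      rw [dif_pos (ne_zero_of_form_pos this)]
      exact (mk_mem_genBall _ _).2 this
    · have := (mk_mem_genBall v hv0).1 (interior_subset h)
      exact this.ne' hv
  obtain ⟨U, hU, hvU, hUK⟩ := hg.2 _ hfront (fun h => hw ((g.mk_mem_indeterminacy hv0).1 h))
    {X | ∃ w, ∃ hw : w ∈ Metric.closedBall (g.evalVec v) ε, X = Projectivization.mk ℂ w (hK0 w hw)}
    (by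
      rintro X ⟨w, hw, rfl⟩
      exact (mk_mem_genBall _ _).2 (hball hw))
    (isCompact_image_mk (isCompact_closedBall _ _) hK0)
  obtain ⟨t, ht1, ht2, ht3, ht4⟩ := ((hne.and ((hmk.eventually (hU.mem_nhds hvU)).and
    ((hglim.eventually (Metric.closedBall_mem_nhds _ hε)).and self_mem_nhdsWithin))).exists)
  have hγt := ne_zero_of_form_pos (hγpos t ht4)
  rw [dif_pos hγt] at ht2
  have hind : Projectivization.mk ℂ (γ t) hγt ∉ g.indeterminacy := fun h =>
    ht1 ((g.mk_mem_indeterminacy hγt).1 h)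
  refine hUK _ ⟨ht2, (mk_mem_genBall _ _).2 (hγpos t ht4)⟩ hind ?_
  rw [g.toFun_mk]
  exact ⟨_, ht3, rfl⟩

/-- The equation `u f(Z) = v` with `(u, v) = g(A, AZ)`, relating `f` and `g`. -/
def Intertwines {r s r' s' : ℕ} (f : Matrix (Fin r) (Fin s) ℂ → Matrix (Fin r') (Fin s') ℂ)
    (G : (Fin r ⊕ Fin s → ℂ) → Fin r' ⊕ Fin s' → ℂ) : Prop :=
  ∀ Z ∈ Omega r s, ∀ A : Fin r → ℂ, A ≠ 0 →
    Matrix.vecMul (fun i => G (Sum.elim A (Matrix.vecMul A Z)) (Sum.inl i)) (f Z) =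
      fun j => G (Sum.elim A (Matrix.vecMul A Z)) (Sum.inr j)

/-- The matrix closest to `Z` which maps `A` to `B`, where `v = (A, B)`. -/
noncomputable def correctedMatrix (Z : Matrix (Fin r) (Fin s) ℂ) (v : Fin r ⊕ Fin s → ℂ) :
    Matrix (Fin r) (Fin s) ℂ :=
  Z + ((fun i => v (Sum.inl i)) ⬝ᵥ star fun i => v (Sum.inl i))⁻¹ •
    Matrix.vecMulVec (star fun i => v (Sum.inl i))
      ((fun j => v (Sum.inr j)) - Matrix.vecMul (fun i => v (Sum.inl i)) Z)

theorem vecMul_correctedMatrix (Z : Matrix (Fin r) (Fin s) ℂ) (v : Fin r ⊕ Fin s → ℂ)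
    (hv : (fun i => v (Sum.inl i)) ≠ 0) :
    Matrix.vecMul (fun i => v (Sum.inl i)) (correctedMatrix Z v) = fun j => v (Sum.inr j) := by
  have h : ((fun i => v (Sum.inl i)) ⬝ᵥ star fun i => v (Sum.inl i)) ≠ 0 :=
    fun h => hv (dotProduct_self_star_eq_zero.1 h)
  rw [correctedMatrix, Matrix.vecMul_add, Matrix.vecMul_smul, Matrix.vecMul_vecMulVec, smul_smul,
    inv_mul_cancel₀ h, one_smul, add_sub_cancel]

-- The point `(A, AZ)` is a limit of generic vectors `v`. For each of them `Z` is replaced by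
-- `correctedMatrix Z v`, which depends continuously on `v`, lies in the subspace attached to `v`,
-- and tends to `Z`. The relation between `f` and `g` holds along this approximation and passes to
-- the limit.
open Filter Topology in
theorem Induces.intertwines {f : Matrix (Fin r) (Fin s) ℂ → Matrix (Fin r') (Fin s') ℂ}
    (hfg : Induces f g) (hf : ContinuousOn f (Omega r s)) : Intertwines f g.evalVec := by
  intro Z hZ A hA
  obtain ⟨U, hU, hUcl, hUf⟩ := hfg
  set v₀ := Sum.elim A (Matrix.vecMul A Z) with hv₀
  have hform := mem_Omega_iff.1 hZ A hA
  have hv0 : v₀ ≠ 0 := ne_zero_of_form_pos hform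
  set G : Set (Fin r ⊕ Fin s → ℂ) :=
    {v | ∃ h : v ≠ 0, Projectivization.mk ℂ v h ∈ U ∩ GenBall r s}
  have hcl : v₀ ∈ closure G := by
    rw [mem_closure_iff_nhds]
    intro W hW
    obtain ⟨W', hW'W, hW', hvW'⟩ := mem_nhds_iff.1 hW
    have h1 := isOpenMap_mk _ (hW'.preimage (continuous_subtype_val (p := fun v => v ≠ 0)))
    have h2 := hUcl ((mk_mem_genBall v₀ hv0).2 hform)
    obtain ⟨X, hX1, hX2⟩ := mem_closure_iff.1 h2 _ h1 ⟨⟨v₀, hv0⟩, hvW', rfl⟩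
    obtain ⟨⟨w, hw0⟩, hw, rfl⟩ := hX1
    exact ⟨w, hW'W hw, hw0, hX2⟩
  have hcorr : correctedMatrix Z v₀ = Z := by
    simp only [correctedMatrix, hv₀, Sum.elim_inl, Sum.elim_inr]
    have h0 : Matrix.vecMulVec (star fun i => A i)
        ((fun j => Matrix.vecMul A Z j) - Matrix.vecMul (fun i => A i) Z) = 0 := by
      ext i j
      simp [Matrix.vecMulVec_apply]
    rw [h0, smul_zero, add_zero]
  have hcont : ContinuousAt (correctedMatrix Z) v₀ := by
    have h1 : Continuous fun v : Fin r ⊕ Fin s → ℂ => fun i => v (Sum.inl i) := by fun_prop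
    have h2 : Continuous fun v : Fin r ⊕ Fin s → ℂ => fun i => v (Sum.inr i) := by fun_prop
    refine continuousAt_const.add (ContinuousAt.fun_smul (ContinuousAt.fun_inv₀ ?_ ?_) ?_)
    · exact (h1.dotProduct h1.star).continuousAt
    · exact fun h => hA (dotProduct_self_star_eq_zero.1 h)
    · exact (h1.star.matrix_vecMulVec (h2.sub (h1.matrix_vecMul continuous_const))).continuousAt
  have hfc : ContinuousAt (fun v => f (correctedMatrix Z v)) v₀ := by
    refine ContinuousAt.comp (f := correctedMatrix Z) ?_ hcont
    rw [hcorr]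
    exact hf.continuousAt (isOpen_Omega.mem_nhds hZ)
  have hgl : Continuous fun v => fun i => g.evalVec v (Sum.inl i) := by
    have := g.continuous_evalVec
    fun_prop
  have hgr : Continuous fun v => fun i => g.evalVec v (Sum.inr i) := by
    have := g.continuous_evalVec
    fun_prop
  have hlhs : Tendsto (fun v => Matrix.vecMul (fun i => g.evalVec v (Sum.inl i))
      (f (correctedMatrix Z v))) (𝓝[G] v₀)
      (𝓝 (Matrix.vecMul (fun i => g.evalVec v₀ (Sum.inl i)) (f Z))) := by
    have hc : Continuous fun p : (Fin r' → ℂ) × Matrix (Fin r') (Fin s') ℂ =>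
        Matrix.vecMul p.1 p.2 := continuous_fst.matrix_vecMul continuous_snd
    have := hc.continuousAt.tendsto.comp (hgl.continuousAt.prodMk hfc).tendsto
    rw [hcorr] at this
    exact this.mono_left nhdsWithin_le_nhds
  have hrhs : Tendsto (fun v => fun i => g.evalVec v (Sum.inr i)) (𝓝[G] v₀)
      (𝓝 (fun i => g.evalVec v₀ (Sum.inr i))) :=
    (hgr.tendsto v₀).mono_left nhdsWithin_le_nhds
  have := mem_closure_iff_nhdsWithin_neBot.1 hcl
  refine tendsto_nhds_unique (hlhs.congr' ?_) hrhs
  have e1 : ∀ᶠ v in 𝓝[G] v₀, correctedMatrix Z v ∈ Omega r s := by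
    refine nhdsWithin_le_nhds (hcont.eventually ?_)
    rw [hcorr]
    exact isOpen_Omega.mem_nhds hZ
  have e2 : ∀ᶠ v in 𝓝[G] v₀, (fun i => v (Sum.inl i)) ≠ (0 : Fin r → ℂ) := by
    have h1 : Continuous fun v : Fin r ⊕ Fin s → ℂ => fun i => v (Sum.inl i) := by fun_prop
    exact nhdsWithin_le_nhds (h1.continuousAt.eventually_ne hA)
  filter_upwards [e1, e2, self_mem_nhdsWithin] with v hv1 hv2 hv3
  obtain ⟨hvne, hvU⟩ := hv3
  -- At an indeterminate vector both sides are zero.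
  by_cases hind : g.evalVec v = 0
  · simp only [hind, Pi.zero_apply]
    exact Matrix.zero_vecMul _
  · have hind' : Projectivization.mk ℂ v hvne ∉ g.indeterminacy := fun h =>
      hind ((g.mk_mem_indeterminacy hvne).1 h)
    have := hUf _ hvU hind' ((mem_sharp_mk v hvne _).2 ⟨hv1, vecMul_correctedMatrix Z v hv2⟩)
    rw [g.toFun_mk, mem_sharp_mk] at this
    exact this.2

end Domain

/-! ### Classification of the norm polynomials. -/

section MonomialMaps

open MvPolynomial

variable {r : ℕ}

theorem form_eq_eval_indefPoly (z : Fin r ⊕ Fin r → ℂ) :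
    form z = eval (fun i => ‖z i‖ ^ 2) (indefPoly r) := by
  rw [eval_indefPoly]
  rfl

theorem eval_monomial_ne_zero {σ : Type*} {z : σ → ℂ} {e : σ →₀ ℕ} {c : ℂ} (hc : c ≠ 0)
    (h : ∀ v, e v ≠ 0 → z v ≠ 0) : eval z (monomial e c) ≠ 0 := by
  rw [eval_monomial]
  refine mul_ne_zero hc (Finset.prod_ne_zero_iff.2 fun v hv => pow_ne_zero _ (h v ?_))
  exact Finsupp.mem_support_iff.1 hv

theorem not_isUnit_X {σ : Type*} (v : σ) : ¬IsUnit (X v : MvPolynomial σ ℂ) := fun h => by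
  have := h.map (eval (0 : σ → ℂ))
  simp at this

/-- A vector in the positive cone with prescribed zero coordinate. -/
theorem exists_form_pos_of_coord_zero (hr : 2 ≤ r) (v : Fin r ⊕ Fin r) :
    ∃ z : Fin r ⊕ Fin r → ℂ, 0 < form z ∧ z v = 0 ∧ ∀ w, w ≠ v → z w ≠ 0 := by
  classical
  have hr1 : ((r : ℂ) + 1) ≠ 0 := by exact_mod_cast r.succ_ne_zero
  -- One positive coordinate equal to `r + 1` outweighs all negative ones, since `(r + 1)² > r`; as
  -- `r ≥ 2`, one remains after a coordinate is set to zero.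
  set z : Fin r ⊕ Fin r → ℂ :=
    fun w => if w = v then 0 else Sum.elim (fun _ => (r : ℂ) + 1) (fun _ => 1) w with hz
  refine ⟨z, ?_, by simp [hz], fun w hw => ?_⟩
  · obtain ⟨i, hi⟩ : ∃ i : Fin r, Sum.inl i ≠ v := by
      rcases v with v | v
      · obtain ⟨i, hi⟩ := SignConfig.exists_index_ne hr v
        exact ⟨i, by simpa using hi⟩
      · exact ⟨⟨0, by omega⟩, by simp⟩
    have h1 : ((r : ℝ) + 1) ^ 2 ≤ ∑ i, ‖z (Sum.inl i)‖ ^ 2 := by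
      have h2 : ‖z (Sum.inl i)‖ ^ 2 = ((r : ℝ) + 1) ^ 2 := by
        rw [hz]
        simp only [if_neg hi, Sum.elim_inl]
        rw [show (r : ℂ) + 1 = ((r + 1 : ℝ) : ℂ) by push_cast; rfl, Complex.norm_real,
          Real.norm_eq_abs, sq_abs]
      rw [← h2]
      exact Finset.single_le_sum (f := fun i => ‖z (Sum.inl i)‖ ^ 2) (fun i _ => by positivity)
        (Finset.mem_univ i)
    have h2 : ∑ j, ‖z (Sum.inr j)‖ ^ 2 ≤ r := by
      have : ∀ j : Fin r, ‖z (Sum.inr j)‖ ^ 2 ≤ 1 := fun j => by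
        rw [hz]
        dsimp only
        split_ifs <;> simp
      refine (Finset.sum_le_sum fun j _ => this j).trans ?_
      simp
    have : (0 : ℝ) ≤ r := by positivity
    unfold form
    nlinarith
  · rw [hz]
    simp only [if_neg hw]
    rcases w with w | w
    · exact hr1
    · exact one_ne_zero

/-- The norm polynomials of proper monomial rational maps `D_{r,r} → D_{r+1,r+1}`. -/
theorem RatMap.IsProper.monomial_classification (hr : 2 ≤ r) {g : RatMap r r (r + 1) (r + 1)}
    (hproper : g.IsProper) (hQ : g.QuotientCondition)
    {E : Fin (r + 1) ⊕ Fin (r + 1) → (Fin r ⊕ Fin r) →₀ ℕ} {c : Fin (r + 1) ⊕ Fin (r + 1) → ℂ}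
    (hg : ∀ k, g.comp k = monomial (E k) (c k)) :
    ∃ a : ℝ, 0 < a ∧ (monomialNormPoly E c = indefPoly r * C a ∨
      (r = 2 ∧ ∃ i j, monomialNormPoly E c =
        indefPoly r * (C a * (X (Sum.inl i) + X (Sum.inr j)))) ∨
      (r = 2 ∧ monomialNormPoly E c = indefPoly r * (C a * ∑ v, X v))) := by
  have heval : ∀ z, eval (fun i => ‖z i‖ ^ 2) (monomialNormPoly E c) = form (g.evalVec z) := by
    intro z
    rw [eval_monomialNormPoly]
    congr 1
    funext k
    rw [RatMap.evalVec, hg]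
  have hsqrt : ∀ x : Fin r ⊕ Fin r → ℝ, (∀ v, 0 ≤ x v) →
      (fun v => ‖((√(x v) : ℝ) : ℂ)‖ ^ 2) = x := fun x hx => by
    funext v
    rw [Complex.norm_real, Real.norm_of_nonneg (Real.sqrt_nonneg _), Real.sq_sqrt (hx v)]
  have hPnn : ∀ x : Fin r ⊕ Fin r → ℝ, (∀ v, 0 ≤ x v) → 0 < eval x (indefPoly r) →
      0 ≤ eval x (monomialNormPoly E c) := by
    intro x hx hL
    rw [← hsqrt x hx, ← form_eq_eval_indefPoly] at hL
    rw [← hsqrt x hx, heval]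
    by_cases h : g.evalVec (fun v => ((√(x v) : ℝ) : ℂ)) = 0
    · rw [h]
      simp [form]
    · exact (hproper.form_pos hL h).le
  have hP0 : monomialNormPoly E c ≠ 0 := by
    intro h0
    obtain ⟨k, hk⟩ : ∃ k, c k ≠ 0 := by
      by_contra! h
      have := g.no_common_factor 0 fun k => by rw [hg, h, monomial_zero]
      simp at this
    have hform : 0 < form (Sum.elim (fun _ => 2) fun _ => 1 : Fin r ⊕ Fin r → ℂ) := by
      rw [form_sum_elim]
      have : (0 : ℝ) < r := by exact_mod_cast (by omega : 0 < r)
      simp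
      linarith
    have h1 := hproper.form_pos hform fun h => by
      have h2 := congrFun h k
      rw [RatMap.evalVec, hg] at h2
      refine eval_monomial_ne_zero hk (fun v _ => ?_) h2
      rcases v with v | v <;> simp
    rw [← heval, h0, map_zero] at h1
    exact lt_irrefl _ h1
  have hhom : (monomialNormPoly E c).IsHomogeneous g.degree :=
    monomialNormPoly_isHomogeneous fun k => hg k ▸ g.homogeneous k
  obtain ⟨Q, m, d, hm, hd, hPQ, hQ'⟩ : ∃ (Q : MvPolynomial (Fin r ⊕ Fin r) ℝ) (m d : ℕ), 1 ≤ m ∧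
      Q.IsHomogeneous d ∧ monomialNormPoly E c = indefPoly r ^ m * Q ∧
      (d = 1 ∨ ∀ e, 0 ≤ Q.coeff e) := by
    by_cases hdeg : 3 ≤ g.degree
    · obtain ⟨P, Q, m, d, hP, hm, hd, hPQ, hQ'⟩ := hQ hdeg
      refine ⟨Q, m, d, hm, hd, ?_, hQ'⟩
      rw [indefPoly, ← hPQ]
      exact eq_of_eval_norm_sq fun z => by rw [heval, hP]
    -- In degree at most two the factorization comes from properness, with `m = 1` and a quotient of
    -- degree at most one.
    · have hdvd : indefPoly r ∣ monomialNormPoly E c := by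
        refine indefPoly_dvd (by omega) fun x hx hL => ?_
        rw [← hsqrt x fun v => (hx v).le, ← form_eq_eval_indefPoly] at hL
        rw [← hsqrt x fun v => (hx v).le, heval]
        refine hproper.form_eq_zero (fun h => ?_) hL
        have := congrFun h (Sum.inl ⟨0, by omega⟩)
        simp only [Pi.zero_apply, Complex.ofReal_eq_zero] at this
        exact (Real.sqrt_pos.2 (hx _)).ne' this
      obtain ⟨d, Q, hd1, hd, hPQ⟩ := exists_homogeneous_quotient hhom hP0 hdvd
      refine ⟨Q, 1, d, le_rfl, hd, by rw [pow_one, hPQ], ?_⟩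
      by_cases hd0 : d = 1
      · exact Or.inl hd0
      · obtain rfl : d = 0 := by omega
        right
        obtain ⟨z, hz, -⟩ := exists_form_pos_of_coord_zero hr (Sum.inl ⟨0, by omega⟩)
        rw [form_eq_eval_indefPoly] at hz
        have h1 := hPnn _ (fun v => by positivity) hz
        rw [hPQ, map_mul, totalDegree_eq_zero_iff_eq_C.1 ((totalDegree_zero_iff_isHomogeneous _).2 hd),
          eval_C] at h1
        have h2 := nonneg_of_mul_nonneg_right h1 hz
        intro e
        by_cases he : e = 0
        · rwa [he]
        · rw [hd.coeff_eq_zero (by rwa [Ne, Finsupp.degree_eq_zero_iff])]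
  have hQnn : ∀ x : Fin r ⊕ Fin r → ℝ, (∀ v, 0 ≤ x v) → 0 < eval x (indefPoly r) →
      0 ≤ eval x Q := by
    intro x hx hL
    have := hPnn x hx hL
    rw [hPQ, map_mul, map_pow] at this
    exact nonneg_of_mul_nonneg_right this (pow_pos hL m)
  have hpos : ∀ T : Finset (Fin r ⊕ Fin r →₀ ℕ),
      (∀ e ∈ T, 0 < (indefPoly r ^ m * Q).coeff e) → T.card ≤ r + 1 := fun T hT =>
    card_pos_le T (by rwa [hPQ])
  have hneg : ∀ T : Finset (Fin r ⊕ Fin r →₀ ℕ),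
      (∀ e ∈ T, (indefPoly r ^ m * Q).coeff e < 0) → T.card ≤ r + 1 := fun T hT =>
    card_neg_le T (by rwa [hPQ])
  have hQcoef : ∀ e, 0 ≤ Q.coeff e := by
    rcases hQ' with rfl | hQ'
    · have hlin := linear_of_isHomogeneous_one hd
      have h1 := linear_nonneg hr (fun v => Q.coeff (Finsupp.single v 1)) hm
        (by rwa [← hlin]) (by rwa [← hlin])
      intro e
      by_cases he : e.degree = 1
      · obtain ⟨v, rfl⟩ := exists_eq_single_of_degree_eq_one he
        exact h1 v
      · rw [hd.coeff_eq_zero he]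
    · exact hQ'
  -- If a variable divided `Q`, then `P` would vanish at a positive vector whose only zero
  -- coordinate is that variable. So `g` is indeterminate there, and each of its monomials contains
  -- the variable, a common factor.
  have hnf : ∀ v, ∃ e, Q.coeff e ≠ 0 ∧ e v = 0 := by
    intro v
    by_contra! h
    obtain ⟨z, hz, hzv, hz'⟩ := exists_form_pos_of_coord_zero hr v
    have hQz : eval (fun i => ‖z i‖ ^ 2) Q = 0 := by
      rw [eval_eq]
      refine Finset.sum_eq_zero fun e he => ?_
      have hev := h e (mem_support_iff.1 he)
      rw [Finset.prod_eq_zero (Finsupp.mem_support_iff.2 hev), mul_zero]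
      simp [hzv, hev]
    have hgz : g.evalVec z = 0 := by
      by_contra hne
      have := hproper.form_pos hz hne
      rw [← heval, hPQ, map_mul, hQz, mul_zero] at this
      exact lt_irrefl _ this
    refine not_isUnit_X v (g.no_common_factor _ fun k => ?_)
    rw [hg, X_dvd_monomial]
    by_contra! hk
    have := congrFun hgz k
    rw [RatMap.evalVec, hg] at this
    refine eval_monomial_ne_zero hk.1 (fun w hw => hz' w ?_) this
    rintro rfl
    exact hw hk.2
  obtain ⟨rfl, a, ha, hcases⟩ := quotient_classification hr hd hQcoef hm hnf hpos hneg
  refine ⟨a, ha, ?_⟩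
  rw [pow_one] at hPQ
  rcases hcases with h | ⟨hr2, i, j, h⟩ | ⟨hr2, h⟩
  · exact Or.inl (h ▸ hPQ)
  · exact Or.inr (Or.inl ⟨hr2, i, j, h ▸ hPQ⟩)
  · exact Or.inr (Or.inr ⟨hr2, h ▸ hPQ⟩)

end MonomialMaps

/-! ### Holomorphy of matrix operations. -/

section Differentiability

variable {E : Type*} [NormedAddCommGroup E] [NormedSpace ℂ E] {m n : ℕ} {U : Set E}

theorem differentiableOn_matrix {F : E → Matrix (Fin m) (Fin n) ℂ} :
    DifferentiableOn ℂ F U ↔ ∀ i j, DifferentiableOn ℂ (fun z => F z i j) U :=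
  differentiableOn_pi.trans (forall_congr' fun _ => differentiableOn_pi)

theorem differentiableOn_mul {p : ℕ} {F : E → Matrix (Fin m) (Fin n) ℂ}
    {G : E → Matrix (Fin n) (Fin p) ℂ} (hF : DifferentiableOn ℂ F U) (hG : DifferentiableOn ℂ G U) :
    DifferentiableOn ℂ (fun z => F z * G z) U := by
  rw [differentiableOn_matrix] at *
  intro i j
  simp only [Matrix.mul_apply]
  exact DifferentiableOn.fun_sum fun k _ => (hF i k).mul (hG k j)

theorem differentiableOn_det {F : E → Matrix (Fin n) (Fin n) ℂ} (hF : DifferentiableOn ℂ F U) :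
    DifferentiableOn ℂ (fun z => (F z).det) U := by
  rw [differentiableOn_matrix] at hF
  simp only [Matrix.det_apply]
  refine DifferentiableOn.fun_sum fun σ _ => DifferentiableOn.const_smul ?_ _
  intro z hz
  exact (HasFDerivWithinAt.finsetProd fun i _ =>
    (hF (σ i) i z hz).hasFDerivWithinAt).differentiableWithinAt

theorem differentiableOn_inv {F : E → Matrix (Fin n) (Fin n) ℂ} (hF : DifferentiableOn ℂ F U)
    (h : ∀ z ∈ U, IsUnit (F z)) : DifferentiableOn ℂ (fun z => (F z)⁻¹) U := by
  have hdet := differentiableOn_det hF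
  have hadj : DifferentiableOn ℂ (fun z => (F z).adjugate) U := by
    rw [differentiableOn_matrix]
    intro i j
    simp only [Matrix.adjugate_apply]
    refine differentiableOn_det (differentiableOn_matrix.2 fun a b => ?_)
    by_cases ha : a = j
    · subst ha
      simp only [Matrix.updateRow_self]
      exact differentiableOn_const _
    · simp only [Matrix.updateRow_ne ha]
      exact differentiableOn_matrix.1 hF a b
  rw [differentiableOn_matrix] at hadj ⊢
  intro i j
  simp only [Matrix.inv_def, Matrix.smul_apply, smul_eq_mul, Ring.inverse_eq_inv']
  exact (hdet.inv fun z hz => ((Matrix.isUnit_iff_isUnit_det _).1 (h z hz)).ne_zero).mul (hadj i j)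

end Differentiability

/-! ### Fractional linear automorphisms. -/

section Mobius

variable {n : ℕ}

/-- The action of a block matrix by fractional linear transformations, on the right of the row
`(1, W)`. -/
noncomputable def mobius (T : Matrix (Fin n ⊕ Fin n) (Fin n ⊕ Fin n) ℂ)
    (W : Matrix (Fin n) (Fin n) ℂ) : Matrix (Fin n) (Fin n) ℂ :=
  (T.toBlocks₁₁ + W * T.toBlocks₂₁)⁻¹ * (T.toBlocks₁₂ + W * T.toBlocks₂₂)

/-- `T` preserves the indefinite form. -/
def PreservesForm (T : Matrix (Fin n ⊕ Fin n) (Fin n ⊕ Fin n) ℂ) : Prop :=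
  ∀ v, form (Matrix.vecMul v T) = form v

variable {T S : Matrix (Fin n ⊕ Fin n) (Fin n ⊕ Fin n) ℂ} {W : Matrix (Fin n) (Fin n) ℂ}

theorem PreservesForm.of_mul_eq_one (hT : PreservesForm T) (h : S * T = 1) : PreservesForm S :=
  fun v => by rw [← hT, Matrix.vecMul_vecMul, h, Matrix.vecMul_one]

theorem vecMul_sum_elim_blocks (x : Fin n → ℂ) :
    Matrix.vecMul (Sum.elim x (Matrix.vecMul x W)) T =
      Sum.elim (Matrix.vecMul x (T.toBlocks₁₁ + W * T.toBlocks₂₁))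
        (Matrix.vecMul x (T.toBlocks₁₂ + W * T.toBlocks₂₂)) := by
  conv_lhs => rw [← Matrix.fromBlocks_toBlocks T, Matrix.vecMul_fromBlocks]
  simp only [Sum.elim_comp_inl, Sum.elim_comp_inr, Matrix.vecMul_add, Matrix.vecMul_vecMul]

/-- A row vector in the kernel would give a positive vector `(x, xW)` whose image under `T` has zero
positive part. -/
theorem PreservesForm.isUnit (hT : PreservesForm T) (hW : W ∈ Omega n n) :
    IsUnit (T.toBlocks₁₁ + W * T.toBlocks₂₁) := by
  rw [← Matrix.vecMul_injective_iff_isUnit]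
  refine (injective_iff_map_eq_zero
    (Matrix.vecMulLinear (T.toBlocks₁₁ + W * T.toBlocks₂₁))).2 fun x hx => ?_
  by_contra hne
  have h1 := mem_Omega_iff.1 hW x hne
  have hx' : Matrix.vecMul x (T.toBlocks₁₁ + W * T.toBlocks₂₁) = 0 := hx
  rw [← hT, vecMul_sum_elim_blocks, hx', form_sum_elim] at h1
  simp only [Pi.zero_apply, norm_zero, ne_eq, OfNat.ofNat_ne_zero, not_false_eq_true, zero_pow,
    Finset.sum_const_zero, zero_sub, Left.neg_pos_iff] at h1
  exact absurd h1 (not_lt.2 (Finset.sum_nonneg fun i _ => by positivity))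

/-- Right multiplication by `T` carries the space of rows `(x, xW)` onto the analogous space for
`mobius T W`, and positivity of the form on it is preserved. -/
theorem PreservesForm.mobius_mem (hT : PreservesForm T) (hW : W ∈ Omega n n) :
    mobius T W ∈ Omega n n := by
  have hu := (Matrix.isUnit_iff_isUnit_det _).1 (hT.isUnit hW)
  rw [mem_Omega_iff]
  intro x hx
  set X := T.toBlocks₁₁ + W * T.toBlocks₂₁ with hX
  have h1 : Matrix.vecMul (Matrix.vecMul x X⁻¹) X = x := by
    rw [Matrix.vecMul_vecMul, Matrix.nonsing_inv_mul _ hu, Matrix.vecMul_one]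
  have h2 : Matrix.vecMul x X⁻¹ ≠ 0 := by
    intro h
    rw [h, Matrix.zero_vecMul] at h1
    exact hx h1.symm
  have h3 := mem_Omega_iff.1 hW _ h2
  rw [← hT, vecMul_sum_elim_blocks, ← hX, h1, Matrix.vecMul_vecMul] at h3
  exact h3

/-- Put `(X, Y) = (1, W) T`. Then `(X, Y) S = (1, W)`, while `mobius T W = X⁻¹ Y`; the factor `X⁻¹`
drops out of the second quotient. -/
theorem PreservesForm.mobius_mobius (hT : PreservesForm T) (h : T * S = 1) (hW : W ∈ Omega n n) :
    mobius S (mobius T W) = W := by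
  have hu := (Matrix.isUnit_iff_isUnit_det _).1 (hT.isUnit hW)
  rw [← Matrix.fromBlocks_toBlocks T, ← Matrix.fromBlocks_toBlocks S, Matrix.fromBlocks_multiply,
    ← Matrix.fromBlocks_one, Matrix.fromBlocks_inj] at h
  obtain ⟨h11, h12, h21, h22⟩ := h
  unfold mobius
  set X := T.toBlocks₁₁ + W * T.toBlocks₂₁ with hX
  set Y := T.toBlocks₁₂ + W * T.toBlocks₂₂ with hY
  have e1 : X * S.toBlocks₁₁ + Y * S.toBlocks₂₁ = 1 := by
    have : X * S.toBlocks₁₁ + Y * S.toBlocks₂₁ =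
        (T.toBlocks₁₁ * S.toBlocks₁₁ + T.toBlocks₁₂ * S.toBlocks₂₁) +
          W * (T.toBlocks₂₁ * S.toBlocks₁₁ + T.toBlocks₂₂ * S.toBlocks₂₁) := by
      rw [hX, hY]
      noncomm_ring
    rw [this, h11, h21, mul_zero, add_zero]
  have e2 : X * S.toBlocks₁₂ + Y * S.toBlocks₂₂ = W := by
    have : X * S.toBlocks₁₂ + Y * S.toBlocks₂₂ =
        (T.toBlocks₁₁ * S.toBlocks₁₂ + T.toBlocks₁₂ * S.toBlocks₂₂) +
          W * (T.toBlocks₂₁ * S.toBlocks₁₂ + T.toBlocks₂₂ * S.toBlocks₂₂) := by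
      rw [hX, hY]
      noncomm_ring
    rw [this, h12, h22, mul_one, zero_add]
  clear_value X Y
  have e3 : S.toBlocks₁₁ + X⁻¹ * Y * S.toBlocks₂₁ = X⁻¹ := by
    have : S.toBlocks₁₁ + X⁻¹ * Y * S.toBlocks₂₁ =
        X⁻¹ * (X * S.toBlocks₁₁ + Y * S.toBlocks₂₁) := by
      rw [mul_add, ← mul_assoc, ← mul_assoc, Matrix.nonsing_inv_mul _ hu, one_mul]
    rw [this, e1, mul_one]
  have e4 : S.toBlocks₁₂ + X⁻¹ * Y * S.toBlocks₂₂ = X⁻¹ * W := by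
    rw [← e2, mul_add, ← mul_assoc, ← mul_assoc, Matrix.nonsing_inv_mul _ hu, one_mul]
  rw [e3, e4, Matrix.nonsing_inv_nonsing_inv _ hu, ← mul_assoc, Matrix.mul_nonsing_inv _ hu,
    one_mul]

theorem PreservesForm.differentiableOn_mobius (hT : PreservesForm T) :
    DifferentiableOn ℂ (mobius T) (Omega n n) := by
  have h1 : ∀ A B : Matrix (Fin n) (Fin n) ℂ,
      DifferentiableOn ℂ (fun W => A + W * B) (Omega n n) := fun A B =>
    (differentiableOn_const A).add (differentiableOn_mul differentiableOn_id
      (differentiableOn_const B))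
  exact differentiableOn_mul (differentiableOn_inv (h1 _ _) fun W hW => hT.isUnit hW) (h1 _ _)

theorem PreservesForm.isAut_mobius (hT : PreservesForm T) (h : T * S = 1) :
    IsAut (Omega n n) (mobius T) := by
  have hS := hT.of_mul_eq_one (mul_eq_one_comm.1 h)
  exact ⟨hT.differentiableOn_mobius, fun W hW => hT.mobius_mem hW, mobius S,
    hS.differentiableOn_mobius, fun W hW => hS.mobius_mem hW,
    fun W hW => hT.mobius_mobius h hW, fun W hW => hS.mobius_mobius (mul_eq_one_comm.1 h) hW⟩

theorem isAut_id {E : Type*} [NormedAddCommGroup E] [NormedSpace ℂ E] (U : Set E) : IsAut U id :=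
  ⟨differentiableOn_id, Set.mapsTo_id U, id, differentiableOn_id, Set.mapsTo_id U,
    fun _ _ => rfl, fun _ _ => rfl⟩

end Mobius

/-! ### Automorphisms by permutations and phases. -/

section Phases

variable {n : ℕ}

/-- Permutation of rows and columns and multiplication by phases. -/
def permPhase (σ τ : Equiv.Perm (Fin n)) (θ φ : Fin n → ℂ) (W : Matrix (Fin n) (Fin n) ℂ) :
    Matrix (Fin n) (Fin n) ℂ :=
  Matrix.of fun i j => θ i * φ j * W (σ i) (τ j)

variable (σ τ : Equiv.Perm (Fin n)) {θ φ : Fin n → ℂ}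

theorem permPhase_mem (hθ : ∀ i, ‖θ i‖ = 1) (hφ : ∀ i, ‖φ i‖ = 1) {W : Matrix (Fin n) (Fin n) ℂ}
    (hW : W ∈ Omega n n) : permPhase σ τ θ φ W ∈ Omega n n := by
  rw [mem_Omega_iff] at hW ⊢
  intro x hx
  set x' : Fin n → ℂ := fun i => x (σ.symm i) * θ (σ.symm i) with hx'
  have hx'0 : x' ≠ 0 := by
    intro h
    refine hx (funext fun i => ?_)
    have := congrFun h (σ i)
    simp only [hx', Equiv.symm_apply_apply, Pi.zero_apply, mul_eq_zero] at this
    refine this.resolve_right fun h0 => ?_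
    have := hθ i
    rw [h0, norm_zero] at this
    exact zero_ne_one this
  have h1 : ∀ j, Matrix.vecMul x (permPhase σ τ θ φ W) j = φ j * Matrix.vecMul x' W (τ j) := by
    intro j
    simp only [Matrix.vecMul, dotProduct, permPhase, Matrix.of_apply, Finset.mul_sum]
    rw [← Equiv.sum_comp σ fun i => φ j * (x' i * W i (τ j))]
    refine Finset.sum_congr rfl fun i _ => ?_
    simp only [hx', Equiv.symm_apply_apply]
    ring
  have h2 := hW x' hx'0
  rw [form_sum_elim] at h2 ⊢
  simp only [h1, norm_mul, hφ, one_mul]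
  rw [Equiv.sum_comp τ fun j => ‖Matrix.vecMul x' W j‖ ^ 2]
  convert h2 using 2
  rw [← Equiv.sum_comp σ fun i => ‖x' i‖ ^ 2]
  refine Finset.sum_congr rfl fun i _ => ?_
  simp [hx', hθ]

theorem differentiable_permPhase : Differentiable ℂ (permPhase σ τ θ φ) := by
  refine differentiableOn_univ.1 (differentiableOn_matrix.2 fun i j => ?_)
  simp only [permPhase, Matrix.of_apply]
  exact (differentiableOn_const _).mul
    (differentiableOn_matrix.1 differentiableOn_id (σ i) (τ j))

theorem permPhase_permPhase (σ' τ' : Equiv.Perm (Fin n)) (θ' φ' : Fin n → ℂ)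
    (W : Matrix (Fin n) (Fin n) ℂ) :
    permPhase σ τ θ φ (permPhase σ' τ' θ' φ' W) = permPhase (σ' * σ) (τ' * τ)
      (fun i => θ i * θ' (σ i)) (fun j => φ j * φ' (τ j)) W := by
  ext i j
  simp only [permPhase, Matrix.of_apply, Equiv.Perm.mul_apply]
  ring

theorem permPhase_one (W : Matrix (Fin n) (Fin n) ℂ) :
    permPhase 1 1 (fun _ => 1) (fun _ => 1) W = W := by
  ext i j
  simp [permPhase]

theorem isAut_permPhase (hθ : ∀ i, ‖θ i‖ = 1) (hφ : ∀ i, ‖φ i‖ = 1) :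
    IsAut (Omega n n) (permPhase σ τ θ φ) := by
  have hθ0 : ∀ i, θ i ≠ 0 := fun i h => by simpa [h] using hθ i
  have hφ0 : ∀ i, φ i ≠ 0 := fun i h => by simpa [h] using hφ i
  refine ⟨(differentiable_permPhase σ τ).differentiableOn, fun W hW => permPhase_mem σ τ hθ hφ hW,
    permPhase σ⁻¹ τ⁻¹ (fun i => (θ (σ⁻¹ i))⁻¹) (fun j => (φ (τ⁻¹ j))⁻¹),
    (differentiable_permPhase _ _).differentiableOn,
    fun W hW => permPhase_mem _ _ (by simp [hθ]) (by simp [hφ]) hW, fun W _ => ?_, fun W _ => ?_⟩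
  · rw [permPhase_permPhase]
    convert permPhase_one W using 1
    congr 1 <;> simp [hθ0, hφ0]
  · rw [permPhase_permPhase]
    convert permPhase_one W using 1
    congr 1 <;> simp [hθ0, hφ0]

end Phases

/-! ### Indefinite Hermitian forms and Witt extension. -/

section Hermitian

variable {n : ℕ}

/-- The indefinite Hermitian form. -/
noncomputable def herm (v w : Fin n ⊕ Fin n → ℂ) : ℂ := ∑ k, (varSign k : ℂ) * v k * star (w k)

theorem herm_self (v : Fin n ⊕ Fin n → ℂ) : herm v v = (form v : ℂ) := by
  rw [form_eq_sum, herm]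
  push_cast
  refine Finset.sum_congr rfl fun k _ => ?_
  rw [mul_assoc]
  congr 1
  exact Complex.mul_conj' (v k)

theorem herm_add_left (v v' w : Fin n ⊕ Fin n → ℂ) : herm (v + v') w = herm v w + herm v' w := by
  simp only [herm, Pi.add_apply, ← Finset.sum_add_distrib]
  exact Finset.sum_congr rfl fun k _ => by ring

theorem herm_smul_left (a : ℂ) (v w : Fin n ⊕ Fin n → ℂ) : herm (a • v) w = a * herm v w := by
  simp only [herm, Pi.smul_apply, smul_eq_mul, Finset.mul_sum]
  exact Finset.sum_congr rfl fun k _ => by ring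

theorem star_herm (v w : Fin n ⊕ Fin n → ℂ) : star (herm v w) = herm w v := by
  simp only [herm, star_sum, star_mul', star_star]
  refine Finset.sum_congr rfl fun k _ => ?_
  rw [show star ((varSign k : ℝ) : ℂ) = ((varSign k : ℝ) : ℂ) from Complex.conj_ofReal _]
  ring

theorem herm_add_right (v w w' : Fin n ⊕ Fin n → ℂ) : herm v (w + w') = herm v w + herm v w' := by
  rw [← star_herm, herm_add_left, star_add, star_herm, star_herm]

theorem herm_smul_right (a : ℂ) (v w : Fin n ⊕ Fin n → ℂ) :
    herm v (a • w) = star a * herm v w := by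
  rw [← star_herm, herm_smul_left, star_mul', star_herm]

theorem herm_sum_left {ι : Type*} (s : Finset ι) (v : ι → Fin n ⊕ Fin n → ℂ)
    (w : Fin n ⊕ Fin n → ℂ) : herm (∑ i ∈ s, v i) w = ∑ i ∈ s, herm (v i) w := by
  classical
  induction s using Finset.induction_on with
  | empty => simp [herm]
  | insert i s hi ih => rw [Finset.sum_insert hi, Finset.sum_insert hi, herm_add_left, ih]

theorem herm_sum_right {ι : Type*} (s : Finset ι) (w : ι → Fin n ⊕ Fin n → ℂ)
    (v : Fin n ⊕ Fin n → ℂ) : herm v (∑ i ∈ s, w i) = ∑ i ∈ s, herm v (w i) := by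
  rw [← star_herm, herm_sum_left, star_sum]
  exact Finset.sum_congr rfl fun i _ => star_herm _ _

theorem herm_swap (v w : Fin n ⊕ Fin n → ℂ) : herm (v ∘ Sum.swap) (w ∘ Sum.swap) = -herm v w := by
  simp only [herm, Fintype.sum_sum_type, varSign, Function.comp_apply, Sum.swap_inl, Sum.swap_inr,
    Sum.elim_inl, Sum.elim_inr]
  push_cast
  simp only [one_mul, neg_mul, Finset.sum_neg_distrib]
  ring

/-- An orthonormal family with few positive vectors is orthogonal to a positive unit vector. -/
theorem exists_orthogonal_pos {ι κ : Type*} [Fintype ι] [Fintype κ] [DecidableEq κ]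
    (hι : Fintype.card ι < n) (u : ι → Fin n ⊕ Fin n → ℂ) (w : κ → Fin n ⊕ Fin n → ℂ)
    (huw : ∀ i j, herm (w j) (u i) = 0)
    (hww : ∀ j j', herm (w j) (w j') = if j = j' then -1 else 0) :
    ∃ p, (∀ i, herm p (u i) = 0) ∧ (∀ j, herm p (w j) = 0) ∧ herm p p = 1 := by
  -- Fewer than `n` linear conditions on `n` positive coordinates have a nonzero solution.
  obtain ⟨a, ha, ha0⟩ := Submodule.exists_mem_ne_zero_of_ne_bot
    (LinearMap.ker_ne_bot_of_finrank_lt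
      (f := Matrix.mulVecLin (Matrix.of fun i k => star (u i (Sum.inl k)) : Matrix ι (Fin n) ℂ))
      (by simpa using hι))
  rw [LinearMap.mem_ker, Matrix.mulVecLin_apply] at ha
  set y : Fin n ⊕ Fin n → ℂ := Sum.elim a 0 with hy
  have hyu : ∀ i, herm y (u i) = 0 := by
    intro i
    have := congrFun ha i
    simp only [Matrix.mulVec, dotProduct, Matrix.of_apply, Pi.zero_apply] at this
    simp only [herm, hy, Fintype.sum_sum_type, varSign, Sum.elim_inl, Sum.elim_inr, Pi.zero_apply]
    push_cast
    simp only [one_mul, mul_zero, zero_mul, Finset.sum_const_zero, add_zero]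
    rw [← this]
    exact Finset.sum_congr rfl fun k _ => mul_comm _ _
  -- Removal of the components along the `w j` takes a plus sign, as these have square `-1`, and it
  -- only increases the square of `y`.
  set p₀ := y + ∑ j, herm y (w j) • w j with hp₀
  have h1 : ∀ i, herm p₀ (u i) = 0 := by
    intro i
    simp [hp₀, herm_add_left, herm_sum_left, herm_smul_left, hyu, huw]
  have h2 : ∀ j, herm p₀ (w j) = 0 := by
    intro j
    simp [hp₀, herm_add_left, herm_sum_left, herm_smul_left, hww]
  have h3 : herm p₀ p₀ = ((∑ i, ‖a i‖ ^ 2 + ∑ j, ‖herm y (w j)‖ ^ 2 : ℝ) : ℂ) := by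
    conv_lhs => rw [hp₀, herm_add_right, herm_sum_right, ← hp₀]
    simp only [herm_smul_right, h2, mul_zero, Finset.sum_const_zero, add_zero]
    rw [hp₀, herm_add_left, herm_sum_left, herm_self]
    simp only [herm_smul_left]
    push_cast
    congr 1
    · rw [hy, form_sum_elim]
      simp
    · refine Finset.sum_congr rfl fun j _ => ?_
      rw [← star_herm y]
      exact Complex.mul_conj' _
  have hR : 0 < ∑ i, ‖a i‖ ^ 2 + ∑ j, ‖herm y (w j)‖ ^ 2 := by
    obtain ⟨i, hi⟩ := Function.ne_iff.1 ha0
    refine add_pos_of_pos_of_nonneg ?_ (Finset.sum_nonneg fun _ _ => by positivity)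
    exact Finset.sum_pos' (fun _ _ => by positivity)
      ⟨i, Finset.mem_univ _, pow_pos (norm_pos_iff.2 hi) 2⟩
  set R := ∑ i, ‖a i‖ ^ 2 + ∑ j, ‖herm y (w j)‖ ^ 2
  refine ⟨(((√R)⁻¹ : ℝ) : ℂ) • p₀, fun i => ?_, fun j => ?_, ?_⟩
  · rw [herm_smul_left, h1, mul_zero]
  · rw [herm_smul_left, h2, mul_zero]
  · rw [herm_smul_left, herm_smul_right, h3,
      show star (((√R)⁻¹ : ℝ) : ℂ) = (((√R)⁻¹ : ℝ) : ℂ) from Complex.conj_ofReal _]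
    norm_cast
    rw [← mul_assoc, ← mul_inv, Real.mul_self_sqrt hR.le, inv_mul_cancel₀ hR.ne']

/-- Exchange of the two coordinate blocks negates the form and reduces this to the positive case. -/
theorem exists_orthogonal_neg {ι κ : Type*} [Fintype ι] [Fintype κ] [DecidableEq ι]
    (hκ : Fintype.card κ < n) (u : ι → Fin n ⊕ Fin n → ℂ) (w : κ → Fin n ⊕ Fin n → ℂ)
    (huw : ∀ i j, herm (u i) (w j) = 0)
    (huu : ∀ i i', herm (u i) (u i') = if i = i' then 1 else 0) :
    ∃ p, (∀ i, herm p (u i) = 0) ∧ (∀ j, herm p (w j) = 0) ∧ herm p p = -1 := by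
  obtain ⟨p, h1, h2, h3⟩ := exists_orthogonal_pos hκ (fun j => w j ∘ Sum.swap)
    (fun i => u i ∘ Sum.swap) (fun i j => by rw [herm_swap, huw, neg_zero])
    (fun i i' => by
      rw [herm_swap, huu]
      split_ifs <;> simp)
  have hpp : (p ∘ Sum.swap) ∘ Sum.swap = p := by
    funext k
    simp
  refine ⟨p ∘ Sum.swap, fun i => ?_, fun j => ?_, ?_⟩
  · have := h2 i
    rwa [← hpp, herm_swap, neg_eq_zero] at this
  · have := h1 j
    rwa [← hpp, herm_swap, neg_eq_zero] at this
  · rw [herm_swap, h3]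

/-- A matrix with orthonormal rows preserves the form. -/
theorem preservesForm_of_orthonormal {T : Matrix (Fin n ⊕ Fin n) (Fin n ⊕ Fin n) ℂ}
    (hT : ∀ a b, herm (T a) (T b) = if a = b then (varSign a : ℂ) else 0) :
    PreservesForm T ∧ ∃ S, T * S = 1 := by
  constructor
  · intro v
    have h : herm (Matrix.vecMul v T) (Matrix.vecMul v T) = herm v v := by
      rw [Matrix.vecMul_eq_sum, herm_sum_left, herm]
      refine Finset.sum_congr rfl fun a _ => ?_
      rw [herm_sum_right, Finset.sum_eq_single a]
      · rw [herm_smul_left, herm_smul_right, hT, if_pos rfl]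
        ring
      · intro b _ hb
        rw [herm_smul_left, herm_smul_right, hT, if_neg hb.symm, mul_zero, mul_zero]
      · simp
    rw [herm_self, herm_self] at h
    exact_mod_cast h
  -- The inverse is `J T* J`, with `J` the diagonal matrix of signs.
  · refine ⟨Matrix.of fun k b => (varSign k : ℂ) * star (T b k) * (varSign b : ℂ), ?_⟩
    ext a b
    have h1 : (T * Matrix.of fun k b => (varSign k : ℂ) * star (T b k) * (varSign b : ℂ)) a b =
        herm (T a) (T b) * (varSign b : ℂ) := by
      simp only [Matrix.mul_apply, Matrix.of_apply, herm, Finset.sum_mul]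
      exact Finset.sum_congr rfl fun k _ => by ring
    rw [h1, hT, Matrix.one_apply]
    split_ifs with h
    · subst h
      rcases a with a | a <;> simp [varSign]
    · rw [zero_mul]

/-- Witt extension: an orthonormal family of signature `(r, r)` in signature `(r + 1, r + 1)`
extends to an orthonormal basis. -/
theorem exists_orthonormal_extension {r : ℕ}
    (R : Fin r ⊕ Fin r → Fin (r + 1) ⊕ Fin (r + 1) → ℂ)
    (hR : ∀ a b, herm (R a) (R b) = if a = b then (varSign a : ℂ) else 0) :
    ∃ T S : Matrix (Fin (r + 1) ⊕ Fin (r + 1)) (Fin (r + 1) ⊕ Fin (r + 1)) ℂ,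
      PreservesForm T ∧ T * S = 1 ∧ (∀ i, T (Sum.inl i.castSucc) = R (Sum.inl i)) ∧
        ∀ j, T (Sum.inr j.castSucc) = R (Sum.inr j) := by
  obtain ⟨p, hp1, hp2, hp3⟩ := exists_orthogonal_pos (by simp) (fun i => R (Sum.inl i))
    (fun j => R (Sum.inr j)) (fun i j => by simp [hR]) (fun j j' => by simp [hR, varSign])
  have hp1' : ∀ i, herm (R (Sum.inl i)) p = 0 := fun i => by rw [← star_herm, hp1, star_zero]
  have hp2' : ∀ i, herm (R (Sum.inr i)) p = 0 := fun i => by rw [← star_herm, hp2, star_zero]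
  set u : Fin (r + 1) → Fin (r + 1) ⊕ Fin (r + 1) → ℂ :=
    fun i => Fin.lastCases (motive := fun _ => Fin (r + 1) ⊕ Fin (r + 1) → ℂ) p
      (fun i => R (Sum.inl i)) i with hu
  have hulast : u (Fin.last r) = p := by simp [hu]
  have hucast : ∀ i : Fin r, u i.castSucc = R (Sum.inl i) := fun i => by simp [hu]
  have huu : ∀ i i', herm (u i) (u i') = if i = i' then 1 else 0 := by
    intro i i'
    induction i using Fin.lastCases with
    | last =>
      induction i' using Fin.lastCases with
      | last => rw [hulast, hp3, if_pos rfl]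
      | cast i' => rw [hulast, hucast, hp1, if_neg (Fin.castSucc_lt_last i').ne']
    | cast i =>
      induction i' using Fin.lastCases with
      | last => rw [hulast, hucast, hp1', if_neg (Fin.castSucc_lt_last i).ne]
      | cast i' => simp [hucast, hR, varSign]
  have huR : ∀ i j, herm (u i) (R (Sum.inr j)) = 0 := by
    intro i j
    induction i using Fin.lastCases with
    | last => rw [hulast, hp2]
    | cast i => simp [hucast, hR]
  obtain ⟨q, hq1, hq2, hq3⟩ := exists_orthogonal_neg (by simp) u (fun j => R (Sum.inr j)) huR huu
  have hq1' : ∀ i, herm (u i) q = 0 := fun i => by rw [← star_herm, hq1, star_zero]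
  have hq2' : ∀ i, herm (R (Sum.inr i)) q = 0 := fun i => by rw [← star_herm, hq2, star_zero]
  set w : Fin (r + 1) → Fin (r + 1) ⊕ Fin (r + 1) → ℂ :=
    fun i => Fin.lastCases (motive := fun _ => Fin (r + 1) ⊕ Fin (r + 1) → ℂ) q
      (fun i => R (Sum.inr i)) i with hw
  have hwlast : w (Fin.last r) = q := by simp [hw]
  have hwcast : ∀ i : Fin r, w i.castSucc = R (Sum.inr i) := fun i => by simp [hw]
  have hww : ∀ i i', herm (w i) (w i') = if i = i' then -1 else 0 := by
    intro i i'
    induction i using Fin.lastCases with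
    | last =>
      induction i' using Fin.lastCases with
      | last => rw [hwlast, hq3, if_pos rfl]
      | cast i' => rw [hwlast, hwcast, hq2, if_neg (Fin.castSucc_lt_last i').ne']
    | cast i =>
      induction i' using Fin.lastCases with
      | last => rw [hwlast, hwcast, hq2', if_neg (Fin.castSucc_lt_last i).ne]
      | cast i' => simp [hwcast, hR, varSign]
  have huw : ∀ i j, herm (u i) (w j) = 0 := by
    intro i j
    induction j using Fin.lastCases with
    | last => rw [hwlast, hq1']
    | cast j => rw [hwcast, huR]
  obtain ⟨hT, S, hS⟩ := preservesForm_of_orthonormal (T := Matrix.of (Sum.elim u w)) (by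
    rintro (a | a) (b | b)
    · show herm (u a) (u b) = _
      simp [huu, varSign]
    · show herm (u a) (w b) = _
      simp [huw]
    · show herm (w a) (u b) = _
      rw [← star_herm, huw]
      simp
    · show herm (w a) (w b) = _
      simp [hww, varSign])
  exact ⟨_, S, hT, hS, hucast, hwcast⟩

end Hermitian

/-! ### Cayley transforms and uniqueness on multiples of unitary matrices. -/

section Cayley

variable {n : ℕ}

/-- The squared Euclidean norm. -/
noncomputable def normSq (x : Fin n → ℂ) : ℝ := ∑ i, ‖x i‖ ^ 2

theorem normSq_eq (x : Fin n → ℂ) : (normSq x : ℂ) = x ⬝ᵥ star x := by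
  rw [dotProduct_comm, star_dotProduct_self]
  rfl

theorem normSq_pos {x : Fin n → ℂ} (hx : x ≠ 0) : 0 < normSq x := by
  obtain ⟨i, hi⟩ := Function.ne_iff.1 hx
  exact Finset.sum_pos' (fun _ _ => by positivity)
    ⟨i, Finset.mem_univ _, pow_pos (norm_pos_iff.2 hi) 2⟩

theorem normSq_smul (a : ℂ) (x : Fin n → ℂ) : normSq (a • x) = ‖a‖ ^ 2 * normSq x := by
  simp [normSq, mul_pow, Finset.mul_sum]

theorem mem_Omega_iff_normSq {Z : Matrix (Fin n) (Fin n) ℂ} :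
    Z ∈ Omega n n ↔ ∀ x : Fin n → ℂ, x ≠ 0 → normSq (Matrix.vecMul x Z) < normSq x := by
  rw [mem_Omega_iff]
  exact forall₂_congr fun x _ => sub_pos

theorem normSq_add (x y : Fin n → ℂ) :
    normSq (x + y) = normSq x + normSq y + 2 * (y ⬝ᵥ star x).re := by
  have h : ((normSq (x + y) : ℝ) : ℂ) = normSq x + normSq y + (y ⬝ᵥ star x + star (y ⬝ᵥ star x)) := by
    rw [normSq_eq, normSq_eq, normSq_eq, star_add, add_dotProduct, dotProduct_add, dotProduct_add,
      ← Matrix.star_dotProduct_star, star_star]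
    ring
  have := congrArg Complex.re h
  simp only [Complex.add_re, Complex.ofReal_re, show (star (y ⬝ᵥ star x)).re = (y ⬝ᵥ star x).re
    from Complex.conj_re _] at this
  linarith

theorem normSq_sub (x y : Fin n → ℂ) :
    normSq (x - y) = normSq x + normSq y - 2 * (y ⬝ᵥ star x).re := by
  have h := normSq_add x (-y)
  rw [← sub_eq_add_neg, neg_dotProduct, Complex.neg_re] at h
  have : normSq (-y) = normSq y := by simp [normSq]
  rw [h, this]
  ring

/-- The real part of the quadratic form of a matrix is nonnegative. -/
def Accretive (K : Matrix (Fin n) (Fin n) ℂ) : Prop :=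
  ∀ x : Fin n → ℂ, 0 ≤ (Matrix.vecMul x K ⬝ᵥ star x).re

/-- Accretivity gives `|x + xK|² ≥ |x|² + |xK|²`. -/
theorem Accretive.isUnit {K : Matrix (Fin n) (Fin n) ℂ} (hK : Accretive K) : IsUnit (1 + K) := by
  rw [← Matrix.vecMul_injective_iff_isUnit]
  refine (injective_iff_map_eq_zero (Matrix.vecMulLinear (1 + K))).2 fun x hx => ?_
  by_contra hne
  have hx' : Matrix.vecMul x (1 + K) = 0 := hx
  rw [Matrix.vecMul_add, Matrix.vecMul_one] at hx'
  have h1 := normSq_add x (Matrix.vecMul x K)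
  rw [hx'] at h1
  have h2 := hK x
  have h3 := normSq_pos hne
  have h4 : 0 ≤ normSq (Matrix.vecMul x K) := Finset.sum_nonneg fun _ _ => by positivity
  have h5 : normSq (0 : Fin n → ℂ) = 0 := by simp [normSq]
  linarith

/-- The Cayley transform. -/
noncomputable def cayley (K : Matrix (Fin n) (Fin n) ℂ) : Matrix (Fin n) (Fin n) ℂ :=
  (1 + K)⁻¹ * (1 - K)

/-- For `x = y(1 + K)` the claim is `|y - yK| ≤ |y + yK|`, and the squares differ by four times the
real part of the quadratic form at `y`. -/
theorem Accretive.normSq_cayley_le {K : Matrix (Fin n) (Fin n) ℂ} (hK : Accretive K)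
    (x : Fin n → ℂ) : normSq (Matrix.vecMul x (cayley K)) ≤ normSq x := by
  have hu := (Matrix.isUnit_iff_isUnit_det _).1 hK.isUnit
  have h1 : Matrix.vecMul (Matrix.vecMul x (1 + K)⁻¹) (1 + K) = x := by
    rw [Matrix.vecMul_vecMul, Matrix.nonsing_inv_mul _ hu, Matrix.vecMul_one]
  rw [cayley, ← Matrix.vecMul_vecMul]
  set y := Matrix.vecMul x (1 + K)⁻¹
  rw [← h1, Matrix.vecMul_sub, Matrix.vecMul_add, Matrix.vecMul_one, normSq_add, normSq_sub]
  linarith [hK y]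

theorem Accretive.smul_cayley_mem {K : Matrix (Fin n) (Fin n) ℂ} (hK : Accretive K) {a : ℂ}
    (ha : ‖a‖ < 1) : a • cayley K ∈ Omega n n := by
  rw [mem_Omega_iff_normSq]
  intro x hx
  rw [Matrix.vecMul_smul, normSq_smul]
  have h1 := hK.normSq_cayley_le x
  have h2 := normSq_pos hx
  have h3 : ‖a‖ ^ 2 < 1 := by
    rw [sq_lt_one_iff₀ (norm_nonneg a)]
    exact ha
  nlinarith [sq_nonneg ‖a‖]

/-- For skew-Hermitian `K` the adjoint of the transform is `(1 + K)(1 - K)⁻¹`, and the factors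
commute. -/
theorem cayley_unitary {K : Matrix (Fin n) (Fin n) ℂ} (hK : K.conjTranspose = -K) :
    cayley K * (cayley K).conjTranspose = 1 := by
  have hacc : ∀ L : Matrix (Fin n) (Fin n) ℂ, L.conjTranspose = -L → Accretive L := by
    intro L hL x
    have h : star (Matrix.vecMul x L ⬝ᵥ star x) = -(Matrix.vecMul x L ⬝ᵥ star x) := by
      rw [← Matrix.star_dotProduct_star, star_star, Matrix.star_vecMul, hL, Matrix.neg_mulVec,
        dotProduct_neg, Matrix.dotProduct_mulVec]
    have := congrArg Complex.re h
    rw [show (star (Matrix.vecMul x L ⬝ᵥ star x)).re = (Matrix.vecMul x L ⬝ᵥ star x).re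
      from Complex.conj_re _, Complex.neg_re] at this
    linarith
  have hu := (Matrix.isUnit_iff_isUnit_det _).1 (hacc K hK).isUnit
  have hu' := (Matrix.isUnit_iff_isUnit_det _).1
    (hacc (-K) (by rw [Matrix.conjTranspose_neg, hK])).isUnit
  rw [← sub_eq_add_neg] at hu'
  have h1 : (cayley K).conjTranspose = (1 + K) * (1 - K)⁻¹ := by
    rw [cayley, Matrix.conjTranspose_mul, Matrix.conjTranspose_nonsing_inv,
      Matrix.conjTranspose_sub, Matrix.conjTranspose_add, Matrix.conjTranspose_one, hK,
      sub_neg_eq_add, ← sub_eq_add_neg]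
  have h2 : (1 - K) * (1 + K) = (1 + K) * (1 - K) := by noncomm_ring
  rw [h1, cayley, mul_assoc, ← mul_assoc (1 - K), h2, mul_assoc, Matrix.mul_nonsing_inv _ hu',
    mul_one, Matrix.nonsing_inv_mul _ hu]

/-- Elements of the domain are Cayley transforms. -/
theorem exists_cayley_eq {W : Matrix (Fin n) (Fin n) ℂ} (hW : W ∈ Omega n n) :
    ∃ K, Accretive K ∧ cayley K = W := by
  rw [mem_Omega_iff_normSq] at hW
  have hunit : IsUnit (1 + W) := by
    rw [← Matrix.vecMul_injective_iff_isUnit]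
    refine (injective_iff_map_eq_zero (Matrix.vecMulLinear (1 + W))).2 fun x hx => ?_
    by_contra hne
    have hx' : Matrix.vecMul x (1 + W) = 0 := hx
    rw [Matrix.vecMul_add, Matrix.vecMul_one, add_eq_zero_iff_eq_neg'] at hx'
    have := hW x hne
    rw [hx'] at this
    simp [normSq] at this
  have hu := (Matrix.isUnit_iff_isUnit_det _).1 hunit
  -- The Cayley transform is its own inverse, so the witness is the transform of `W`.
  refine ⟨(1 + W)⁻¹ * (1 - W), fun x => ?_, ?_⟩
  · have h1 : Matrix.vecMul (Matrix.vecMul x (1 + W)⁻¹) (1 + W) = x := by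
      rw [Matrix.vecMul_vecMul, Matrix.nonsing_inv_mul _ hu, Matrix.vecMul_one]
    rw [← Matrix.vecMul_vecMul]
    set y := Matrix.vecMul x (1 + W)⁻¹
    have h2 : normSq (Matrix.vecMul y W) ≤ normSq y := by
      by_cases hy : y = 0
      · rw [hy, Matrix.zero_vecMul]
      · exact (hW y hy).le
    rw [← h1, Matrix.vecMul_sub, Matrix.vecMul_add, Matrix.vecMul_one]
    set z := Matrix.vecMul y W
    have e1 := normSq_add (y + z) (y - z)
    have e2 : y + z + (y - z) = (2 : ℂ) • y := by
      rw [two_smul]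
      abel
    rw [e2, normSq_smul, normSq_add y z, normSq_sub y z, Complex.norm_ofNat] at e1
    linarith
  · have e1 : (1 : Matrix (Fin n) (Fin n) ℂ) + (1 + W)⁻¹ * (1 - W) = (1 + W)⁻¹ * (2 : ℂ) • 1 := by
      have : 1 + (1 + W)⁻¹ * (1 - W) = (1 + W)⁻¹ * ((1 + W) + (1 - W)) := by
        rw [mul_add, Matrix.nonsing_inv_mul _ hu]
      rw [this, two_smul]
      congr 1
      abel
    have e2 : (1 : Matrix (Fin n) (Fin n) ℂ) - (1 + W)⁻¹ * (1 - W) = (1 + W)⁻¹ * (2 : ℂ) • W := by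
      have : 1 - (1 + W)⁻¹ * (1 - W) = (1 + W)⁻¹ * ((1 + W) - (1 - W)) := by
        rw [mul_sub (1 + W)⁻¹ (1 + W), Matrix.nonsing_inv_mul _ hu]
      rw [this, two_smul]
      congr 1
      abel
    have e3 : ((1 + W)⁻¹ * (2 : ℂ) • (1 : Matrix (Fin n) (Fin n) ℂ))⁻¹ =
        (2 : ℂ)⁻¹ • (1 + W) := by
      refine Matrix.inv_eq_left_inv ?_
      rw [Matrix.mul_smul, mul_one, Matrix.smul_mul, Matrix.mul_smul, Matrix.mul_nonsing_inv _ hu,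
        smul_smul, inv_mul_cancel₀ two_ne_zero, one_smul]
    rw [cayley, e1, e2, e3, Matrix.smul_mul, Matrix.mul_smul, Matrix.mul_smul, ← mul_assoc,
      Matrix.mul_nonsing_inv _ hu, one_mul, smul_smul, inv_mul_cancel₀ two_ne_zero, one_smul]

open Filter Topology in
/-- A holomorphic function on the domain which vanishes on the multiples of unitary matrices
vanishes. -/
theorem eq_zero_of_unitary {F : Matrix (Fin n) (Fin n) ℂ → ℂ}
    (hF : DifferentiableOn ℂ F (Omega n n))
    (h : ∀ (U : Matrix (Fin n) (Fin n) ℂ) (a : ℂ), U * U.conjTranspose = 1 → ‖a‖ < 1 →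
      F (a • U) = 0) {Z : Matrix (Fin n) (Fin n) ℂ} (hZ : Z ∈ Omega n n) : F Z = 0 := by
  -- Enlarging `Z` slightly inside the open domain writes it as `a` times a Cayley transform with
  -- `|a| < 1`; this factor keeps contractive, in particular unitary, transforms inside the domain.
  obtain ⟨t, ht, htZ⟩ : ∃ t : ℝ, 1 < t ∧ ((t : ℝ) : ℂ) • Z ∈ Omega n n := by
    have hc : Continuous fun t : ℝ => (t : ℂ) • Z := Complex.continuous_ofReal.smul continuous_const
    have h1 : ∀ᶠ t : ℝ in 𝓝 (1 : ℝ), ((t : ℝ) : ℂ) • Z ∈ Omega n n := by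
      refine hc.continuousAt.eventually (isOpen_Omega.mem_nhds ?_)
      simpa using hZ
    have h2 : ∀ᶠ t : ℝ in 𝓝[>] (1 : ℝ), 1 < t ∧ ((t : ℝ) : ℂ) • Z ∈ Omega n n :=
      Eventually.and self_mem_nhdsWithin (nhdsWithin_le_nhds h1)
    exact h2.exists
  have ht0 : 0 < t := by linarith
  obtain ⟨K, hK, hKW⟩ := exists_cayley_eq htZ
  set a : ℂ := ((t⁻¹ : ℝ) : ℂ)
  have ha : ‖a‖ < 1 := by
    rw [Complex.norm_real, Real.norm_of_nonneg (inv_pos.2 ht0).le]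
    exact inv_lt_one_of_one_lt₀ ht
  have haZ : a • cayley K = Z := by
    rw [hKW, smul_smul]
    simp only [a]
    rw [← Complex.ofReal_mul, inv_mul_cancel₀ ht0.ne', Complex.ofReal_one, one_smul]
  set R := (2 : ℂ)⁻¹ • (K + K.conjTranspose) with hR
  set N := (2 : ℂ)⁻¹ • (K - K.conjTranspose) with hN
  have hRN : R + N = K := by
    rw [hR, hN, ← smul_add, add_add_sub_cancel, ← two_smul ℂ K, smul_smul,
      inv_mul_cancel₀ two_ne_zero, one_smul]
  have hstar2 : star (2 : ℂ)⁻¹ = (2 : ℂ)⁻¹ := by simp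
  have hRs : R.conjTranspose = R := by
    rw [hR, Matrix.conjTranspose_smul, Matrix.conjTranspose_add, Matrix.conjTranspose_conjTranspose,
      add_comm, hstar2]
  have hNs : N.conjTranspose = -N := by
    rw [hN, Matrix.conjTranspose_smul, Matrix.conjTranspose_sub, Matrix.conjTranspose_conjTranspose,
      hstar2, ← smul_neg, neg_sub]
  have hquad : ∀ (L : Matrix (Fin n) (Fin n) ℂ) (x : Fin n → ℂ),
      star (Matrix.vecMul x L ⬝ᵥ star x) = Matrix.vecMul x L.conjTranspose ⬝ᵥ star x := by
    intro L x
    rw [← Matrix.star_dotProduct_star, star_star, Matrix.star_vecMul, Matrix.dotProduct_mulVec]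
  have hNre : ∀ x, (Matrix.vecMul x N ⬝ᵥ star x).re = 0 := by
    intro x
    have := congrArg Complex.re (hquad N x)
    rw [hNs, Matrix.vecMul_neg, neg_dotProduct, Complex.neg_re, show
      (star (Matrix.vecMul x N ⬝ᵥ star x)).re = (Matrix.vecMul x N ⬝ᵥ star x).re from
      Complex.conj_re _] at this
    linarith
  have hRim : ∀ x, (Matrix.vecMul x R ⬝ᵥ star x).im = 0 := by
    intro x
    have := congrArg Complex.im (hquad R x)
    rw [hRs, show
      (star (Matrix.vecMul x R ⬝ᵥ star x)).im = -(Matrix.vecMul x R ⬝ᵥ star x).im from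
      Complex.conj_im _] at this
    linarith
  have hRre : ∀ x, 0 ≤ (Matrix.vecMul x R ⬝ᵥ star x).re := by
    intro x
    have := hK x
    rw [← hRN, Matrix.vecMul_add, add_dotProduct, Complex.add_re, hNre, add_zero] at this
    exact this
  -- The family joins `K`, at `μ = 1`, to skew-Hermitian matrices, at imaginary `μ`, and is
  -- accretive on the closed right half plane. There the transform is defined and holomorphic in
  -- `μ`.
  set P : ℂ → Matrix (Fin n) (Fin n) ℂ := fun μ => μ • R + N with hP
  have hacc : ∀ μ : ℂ, 0 ≤ μ.re → Accretive (P μ) := by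
    intro μ hμ x
    rw [hP]
    simp only [Matrix.vecMul_add, Matrix.vecMul_smul, add_dotProduct, smul_dotProduct,
      smul_eq_mul, Complex.add_re, Complex.mul_re, hNre, hRim, mul_zero, sub_zero, add_zero]
    exact mul_nonneg hμ (hRre x)
  have hPd : Differentiable ℂ P := (differentiable_id.smul_const R).add_const N
  set D := {μ : ℂ | IsUnit (1 + P μ)}
  have hDopen : IsOpen D := by
    have : D = {μ : ℂ | (1 + P μ).det ≠ 0} := by
      ext μ
      exact (Matrix.isUnit_iff_isUnit_det _).trans isUnit_iff_ne_zero
    rw [this]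
    have hc : Continuous fun μ => (1 + P μ).det :=
      (continuous_const.add hPd.continuous).matrix_det
    exact isOpen_ne.preimage hc
  have hcd : DifferentiableOn ℂ (fun μ => a • cayley (P μ)) D := by
    refine DifferentiableOn.const_smul (differentiableOn_mul (differentiableOn_inv ?_ ?_) ?_) a
    · exact (hPd.const_add 1).differentiableOn
    · exact fun μ hμ => hμ
    · exact (hPd.const_sub 1).differentiableOn
  set O := D ∩ (fun μ => a • cayley (P μ)) ⁻¹' Omega n n
  have hOopen : IsOpen O := hcd.continuousOn.isOpen_inter_preimage hDopen isOpen_Omega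
  have han : AnalyticOnNhd ℂ (fun μ => F (a • cayley (P μ))) O :=
    DifferentiableOn.analyticOnNhd (hF.comp (hcd.mono Set.inter_subset_left) fun μ hμ => hμ.2) hOopen
  have hsub : {μ : ℂ | 0 ≤ μ.re} ⊆ O := fun μ hμ =>
    ⟨(hacc μ hμ).isUnit, (hacc μ hμ).smul_cayley_mem ha⟩
  have hpre : IsPreconnected {μ : ℂ | 0 ≤ μ.re} := (convex_halfSpace_re_ge 0).isPreconnected
  -- The function vanishes at the points `i/(k + 1)`, which accumulate at `0`; the identity theorem
  -- carries this to `μ = 1`.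
  have hfreq : ∃ᶠ μ in 𝓝[≠] (0 : ℂ), F (a • cayley (P μ)) = 0 := by
    have hlim : Tendsto (fun k : ℕ => ((1 / ((k : ℝ) + 1) : ℝ) : ℂ) * Complex.I) atTop (𝓝[≠] 0) := by
      refine tendsto_nhdsWithin_iff.2 ⟨?_, Eventually.of_forall fun k => ?_⟩
      · have h1 := ((Complex.continuous_ofReal.tendsto 0).comp
          (tendsto_one_div_add_atTop_nhds_zero_nat (𝕜 := ℝ))).mul_const Complex.I
        simpa using h1
      · have : ((1 / ((k : ℝ) + 1) : ℝ) : ℂ) ≠ 0 := by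
          rw [Complex.ofReal_ne_zero]
          positivity
        exact mul_ne_zero this Complex.I_ne_zero
    refine hlim.frequently (Frequently.of_forall fun k => ?_)
    refine h _ _ (cayley_unitary ?_) ha
    simp only [hP]
    rw [Matrix.conjTranspose_add, Matrix.conjTranspose_smul, hRs, hNs, neg_add, ← neg_smul]
    congr 2
    rw [star_mul']
    simp
  have hfin := (han.mono hsub).eqOn_zero_of_preconnected_of_frequently_eq_zero hpre
    (z₀ := 0) (by simp) hfreq (show (1 : ℂ) ∈ {μ : ℂ | 0 ≤ μ.re} by simp)
  simp only [hP, one_smul, hRN, haZ, Pi.zero_apply] at hfin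
  exact hfin

end Cayley

/-! ### Vanishing of the off-diagonal last row. -/

section BlockMaps

variable {r : ℕ}

/-- The last row of a block triangular element of the domain with `a • U` as its corner. -/
theorem normSq_last_row_lt {W : Matrix (Fin (r + 1)) (Fin (r + 1)) ℂ}
    (hW : W ∈ Omega (r + 1) (r + 1)) {U : Matrix (Fin r) (Fin r) ℂ} {a : ℂ}
    (hU : U * U.conjTranspose = 1) (ha : ‖a‖ < 1)
    (h1 : ∀ i j : Fin r, W i.castSucc j.castSucc = (a • U) i j)
    (j : Fin r) : ‖W (Fin.last r) j.castSucc‖ ^ 2 ≤ 1 - ‖a‖ ^ 2 := by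
  set c : Fin r → ℂ := fun j => W (Fin.last r) j.castSucc with hc
  have ha2 : 0 < 1 - ‖a‖ ^ 2 := by
    have : ‖a‖ ^ 2 < 1 := by
      rw [sq_lt_one_iff₀ (norm_nonneg a)]
      exact ha
    linarith
  set s : ℝ := (1 - ‖a‖ ^ 2)⁻¹ with hs
  -- The test vector `(x, 1)` is chosen so that the first `r` entries of its product with `W` are `s
  -- c`, by `s|a|² + 1 = s`. The contraction property then reads `s²|c|² < s²|a|²|c|² + 1`, which is
  -- `|c|² < 1 - |a|²`.
  set x : Fin r → ℂ := ((s : ℂ) * star a) • Matrix.vecMul c U.conjTranspose with hx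
  set X : Fin (r + 1) → ℂ := fun i => Fin.lastCases (motive := fun _ => ℂ) 1 x i with hX
  have hXlast : X (Fin.last r) = 1 := by simp [hX]
  have hXcast : ∀ i : Fin r, X i.castSucc = x i := fun i => by simp [hX]
  have hU' : U.conjTranspose * U = 1 := mul_eq_one_comm.1 hU
  have e1 : normSq X = s ^ 2 * ‖a‖ ^ 2 * normSq c + 1 := by
    have : normSq X = normSq x + 1 := by
      simp [normSq, Fin.sum_univ_castSucc, hXlast, hXcast]
    have h2 : normSq (Matrix.vecMul c U.conjTranspose) = normSq c := by
      have : (normSq (Matrix.vecMul c U.conjTranspose) : ℂ) = normSq c := by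
        rw [normSq_eq, normSq_eq, Matrix.star_vecMul, Matrix.conjTranspose_conjTranspose,
          Matrix.dotProduct_mulVec, Matrix.vecMul_vecMul, hU', Matrix.vecMul_one]
      exact_mod_cast this
    rw [this, hx, normSq_smul, h2, norm_mul, Complex.norm_real, norm_star, mul_pow,
      Real.norm_eq_abs, sq_abs]
  have e2 : ∀ j : Fin r, Matrix.vecMul X W j.castSucc = (s : ℂ) * c j := by
    intro j
    have h2 : Matrix.vecMul X W j.castSucc = Matrix.vecMul x (a • U) j + c j := by
      simp only [Matrix.vecMul, dotProduct, Fin.sum_univ_castSucc, hXlast, hXcast, h1, one_mul, hc]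
    rw [h2, hx, Matrix.smul_vecMul, Matrix.vecMul_smul, Matrix.vecMul_vecMul, hU',
      Matrix.vecMul_one]
    simp only [Pi.smul_apply, smul_eq_mul]
    have h3 : (s : ℂ) * (star a * a) + 1 = s := by
      rw [show star a * a = ((‖a‖ ^ 2 : ℝ) : ℂ) by
        push_cast
        exact Complex.conj_mul' a]
      norm_cast
      rw [hs]
      field_simp
      ring
    linear_combination c j * h3
  have hX0 : X ≠ 0 := fun h => by
    have := congrFun h (Fin.last r)
    rw [hXlast] at this
    exact one_ne_zero this
  have h4 := mem_Omega_iff_normSq.1 hW X hX0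
  have h5 : s ^ 2 * normSq c ≤ normSq (Matrix.vecMul X W) := by
    have h6 : normSq (Matrix.vecMul X W) =
        s ^ 2 * normSq c + ‖Matrix.vecMul X W (Fin.last r)‖ ^ 2 := by
      simp only [normSq, Fin.sum_univ_castSucc, e2, norm_mul, mul_pow, Complex.norm_real,
        Real.norm_eq_abs, sq_abs, Finset.mul_sum]
    rw [h6]
    exact le_add_of_nonneg_right (by positivity)
  have h7 : ‖c j‖ ^ 2 ≤ normSq c :=
    Finset.single_le_sum (f := fun i => ‖c i‖ ^ 2) (fun _ _ => by positivity) (Finset.mem_univ j)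
  have h8 : s * (1 - ‖a‖ ^ 2) = 1 := inv_mul_cancel₀ ha2.ne'
  have h9 : s ^ 2 * (1 - ‖a‖ ^ 2) * normSq c < 1 := by linarith
  have h10 : s * normSq c < 1 := by
    calc s * normSq c = s ^ 2 * (1 - ‖a‖ ^ 2) * normSq c := by
          rw [sq, mul_assoc s s, h8, mul_one]
      _ < 1 := h9
  have h11 : normSq c < 1 - ‖a‖ ^ 2 := by
    calc normSq c = (1 - ‖a‖ ^ 2) * (s * normSq c) := by
          rw [← mul_assoc, mul_comm _ s, h8, one_mul]
      _ < (1 - ‖a‖ ^ 2) * 1 := mul_lt_mul_of_pos_left h10 ha2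
      _ = _ := mul_one _
  exact h7.trans h11.le

-- On the circle of radius `ρ` the modulus is at most `√(1 - ρ²)`; the maximum principle carries the
-- bound inside, and `ρ` tends to `1`.
open Filter Topology in
theorem eq_zero_of_norm_sq_le {φ : ℂ → ℂ} (hφ : DifferentiableOn ℂ φ (Metric.ball 0 1))
    (h : ∀ a, ‖a‖ < 1 → ‖φ a‖ ^ 2 ≤ 1 - ‖a‖ ^ 2) {a : ℂ} (ha : ‖a‖ < 1) : φ a = 0 := by
  have key : ∀ ρ : ℝ, ‖a‖ < ρ → ρ < 1 → ‖φ a‖ ≤ √(1 - ρ ^ 2) := by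
    intro ρ h1 h2
    have hρ : 0 < ρ := (norm_nonneg a).trans_lt h1
    have hsub : Metric.closedBall (0 : ℂ) ρ ⊆ Metric.ball 0 1 := Metric.closedBall_subset_ball h2
    refine Complex.norm_le_of_forall_mem_frontier_norm_le (U := Metric.ball 0 ρ)
      Metric.isBounded_ball ?_ (fun z hz => ?_) (subset_closure (by simpa using h1))
    · refine DifferentiableOn.diffContOnCl ?_
      rw [closure_ball _ hρ.ne']
      exact hφ.mono hsub
    · rw [frontier_ball _ hρ.ne', mem_sphere_zero_iff_norm] at hz
      refine Real.le_sqrt_of_sq_le ?_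
      rw [← hz]
      exact h z (by rw [hz]; exact h2)
  have hlim : Tendsto (fun ρ : ℝ => √(1 - ρ ^ 2)) (𝓝[<] 1) (𝓝 0) := by
    have hc : Continuous fun ρ : ℝ => √(1 - ρ ^ 2) := by fun_prop
    have := hc.tendsto 1
    simp only [one_pow, sub_self, Real.sqrt_zero] at this
    exact this.mono_left nhdsWithin_le_nhds
  have hle : ‖φ a‖ ≤ 0 := by
    refine ge_of_tendsto hlim ?_
    filter_upwards [Ioo_mem_nhdsLT ha] with ρ hρ
    exact key ρ hρ.1 hρ.2
  exact norm_le_zero_iff.1 hle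

/-- The last row of a block triangular holomorphic map vanishes off the diagonal. -/
theorem last_row_eq_zero {F : Matrix (Fin r) (Fin r) ℂ → Matrix (Fin (r + 1)) (Fin (r + 1)) ℂ}
    (hF : DifferentiableOn ℂ F (Omega r r)) (hmaps : Set.MapsTo F (Omega r r) (Omega (r + 1) (r + 1)))
    (h1 : ∀ Z ∈ Omega r r, ∀ i j : Fin r, F Z i.castSucc j.castSucc = Z i j)
    {Z : Matrix (Fin r) (Fin r) ℂ} (hZ : Z ∈ Omega r r) (j : Fin r) :
    F Z (Fin.last r) j.castSucc = 0 := by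
  have hFj := differentiableOn_matrix.1 hF (Fin.last r) j.castSucc
  refine eq_zero_of_unitary hFj (fun U a hU ha => ?_) hZ
  have hmem : ∀ a : ℂ, ‖a‖ < 1 → a • U ∈ Omega r r := by
    intro a ha
    rw [mem_Omega_iff_normSq]
    intro x hx
    have h2 : normSq (Matrix.vecMul x U) = normSq x := by
      have : (normSq (Matrix.vecMul x U) : ℂ) = normSq x := by
        rw [normSq_eq, normSq_eq, Matrix.star_vecMul, Matrix.dotProduct_mulVec,
          Matrix.vecMul_vecMul, hU, Matrix.vecMul_one]
      exact_mod_cast this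
    rw [Matrix.vecMul_smul, normSq_smul, h2]
    have h3 : ‖a‖ ^ 2 < 1 := by
      rw [sq_lt_one_iff₀ (norm_nonneg a)]
      exact ha
    nlinarith [normSq_pos hx]
  refine eq_zero_of_norm_sq_le (φ := fun a => F (a • U) (Fin.last r) j.castSucc)
    (hFj.comp (t := Omega r r) ?_ fun a ha => hmem a (by simpa using ha))
    (fun a ha => normSq_last_row_lt (hmaps (hmem a ha)) hU ha (h1 _ (hmem a ha)) j) ha
  exact (differentiable_id.smul_const U).differentiableOn

end BlockMaps

/-! ### The linear case. -/

section LinearCase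

variable {r m n : ℕ}

/-- Polarization with `v + w` and `v + i w`. -/
theorem herm_eq_of_form_eq {L : (Fin n ⊕ Fin n → ℂ) →ₗ[ℂ] (Fin m ⊕ Fin m → ℂ)}
    (h : ∀ v, form (L v) = form v) (v w : Fin n ⊕ Fin n → ℂ) : herm (L v) (L w) = herm v w := by
  have key : ∀ x y, herm (L x) (L y) + herm (L y) (L x) = herm x y + herm y x := by
    intro x y
    have h1 : herm (L (x + y)) (L (x + y)) = herm (x + y) (x + y) := by
      rw [herm_self, herm_self, h]
    have h2 : ∀ x, herm (L x) (L x) = herm x x := fun x => by rw [herm_self, herm_self, h]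
    simp only [map_add, herm_add_left, herm_add_right, h2] at h1
    linear_combination h1
  have h1 := key v w
  have h2 := key v (Complex.I • w)
  simp only [map_smul, herm_smul_left, herm_smul_right] at h2
  rw [show star Complex.I = -Complex.I from Complex.conj_I] at h2
  linear_combination (1 / 2 : ℂ) * h1 + (Complex.I / 2) * h2 -
    ((herm v w - herm (L v) (L w)) - (herm w v - herm (L w) (L v))) / 2 * Complex.I_mul_I

theorem herm_single (a b : Fin n ⊕ Fin n) :
    herm (Pi.single a 1) (Pi.single b 1) = if a = b then (varSign a : ℂ) else 0 := by
  classical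
  rw [herm, Finset.sum_eq_single a]
  · by_cases h : a = b
    · subst h
      simp
    · simp [h]
  · intro c _ hc
    simp [hc]
  · simp

/-- Appending a zero to a vector. -/
def appendZero (x : Fin n → ℂ) : Fin (n + 1) → ℂ := Fin.snoc (α := fun _ => ℂ) x 0

@[simp] theorem appendZero_castSucc (x : Fin n → ℂ) (i : Fin n) : appendZero x i.castSucc = x i :=
  Fin.snoc_castSucc ..

@[simp] theorem appendZero_last (x : Fin n → ℂ) : appendZero x (Fin.last n) = 0 := Fin.snoc_last ..

/-- The images of the standard basis are orthonormal of signature `(r, r)`, so they form rows of a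
form-preserving matrix. -/
theorem exists_isometry_extension (L : (Fin r ⊕ Fin r → ℂ) →ₗ[ℂ] (Fin (r + 1) ⊕ Fin (r + 1) → ℂ))
    (h : ∀ v, form (L v) = form v) : ∃ T S, PreservesForm T ∧ T * S = 1 ∧
      ∀ x y, L (Sum.elim x y) = Matrix.vecMul (Sum.elim (appendZero x) (appendZero y)) T := by
  obtain ⟨T, S, hT, hTS, h1, h2⟩ := exists_orthonormal_extension (fun a => L (Pi.single a 1))
    fun a b => by rw [herm_eq_of_form_eq h, herm_single]
  refine ⟨T, S, hT, hTS, fun x y => ?_⟩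
  rw [Matrix.vecMul_eq_sum, Fintype.sum_sum_type, Fin.sum_univ_castSucc, Fin.sum_univ_castSucc]
  simp only [Sum.elim_inl, Sum.elim_inr, appendZero_castSucc, appendZero_last, h1, h2, zero_smul,
    add_zero]
  conv_lhs => rw [pi_eq_sum_univ' (Sum.elim x y), map_sum, Fintype.sum_sum_type]
  simp only [map_smul, Sum.elim_inl, Sum.elim_inr]

/-- A holomorphic map intertwined with a linear isometry is block diagonal. -/
theorem equivalent_diagMap {f : Matrix (Fin r) (Fin r) ℂ → Matrix (Fin (r + 1)) (Fin (r + 1)) ℂ}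
    (hf : DifferentiableOn ℂ f (Omega r r)) (hmaps : Set.MapsTo f (Omega r r) (Omega (r + 1) (r + 1)))
    (L : (Fin r ⊕ Fin r → ℂ) →ₗ[ℂ] (Fin (r + 1) ⊕ Fin (r + 1) → ℂ))
    (hL : ∀ v, form (L v) = form v) (hint : Intertwines f L) :
    ∃ h : Matrix (Fin r) (Fin r) ℂ → ℂ, DifferentiableOn ℂ h (Omega r r) ∧
      Set.MapsTo h (Omega r r) (Metric.ball 0 1) ∧
      MapEquivalent (Omega r r) (Omega (r + 1) (r + 1)) f (diagMap h) := by
  obtain ⟨T, S, hT, hTS, hLT⟩ := exists_isometry_extension L hL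
  have hST : S * T = 1 := mul_eq_one_comm.1 hTS
  have hS := hT.of_mul_eq_one hST
  set F := fun Z => mobius S (f Z) with hF
  have hFd : DifferentiableOn ℂ F (Omega r r) := hS.differentiableOn_mobius.comp hf hmaps
  have hFm : Set.MapsTo F (Omega r r) (Omega (r + 1) (r + 1)) := fun Z hZ =>
    hS.mobius_mem (hmaps hZ)
  -- After the automorphism the isometry is the inclusion by zeros, so the intertwining relation
  -- fixes the first `r` rows of `F Z` as `(Z, 0)`.
  have hFx : ∀ Z ∈ Omega r r, ∀ x, x ≠ 0 →
      Matrix.vecMul (appendZero x) (F Z) = appendZero (Matrix.vecMul x Z) := by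
    intro Z hZ x hx
    have h1 := hint Z hZ x hx
    set u : Fin (r + 1) → ℂ := fun i => L (Sum.elim x (Matrix.vecMul x Z)) (Sum.inl i) with hu
    have h2 : Sum.elim u (Matrix.vecMul u (f Z)) = L (Sum.elim x (Matrix.vecMul x Z)) := by
      rw [h1]
      funext k
      rcases k with k | k <;> rfl
    have h3 := congrArg (fun v => Matrix.vecMul v S) h2
    simp only [hLT] at h3
    rw [Matrix.vecMul_vecMul, hTS, Matrix.vecMul_one, vecMul_sum_elim_blocks] at h3
    have hX := (Matrix.isUnit_iff_isUnit_det _).1 (hS.isUnit (hmaps hZ))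
    have h4 : Matrix.vecMul u (S.toBlocks₁₁ + f Z * S.toBlocks₂₁) = appendZero x := by
      funext k
      exact congrFun h3 (Sum.inl k)
    have h5 : Matrix.vecMul u (S.toBlocks₁₂ + f Z * S.toBlocks₂₂) =
        appendZero (Matrix.vecMul x Z) := by
      funext k
      exact congrFun h3 (Sum.inr k)
    show Matrix.vecMul _ (mobius S (f Z)) = _
    rw [← h4, ← h5, mobius, Matrix.vecMul_vecMul, ← mul_assoc, Matrix.mul_nonsing_inv _ hX,
      one_mul]
  have hFrow : ∀ Z ∈ Omega r r, ∀ (i : Fin r) k, F Z i.castSucc k = appendZero (Z i) k := by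
    intro Z hZ i k
    have h1 := hFx Z hZ (Pi.single i 1) (by simp)
    have h2 : appendZero (Pi.single i 1 : Fin r → ℂ) = Pi.single i.castSucc 1 := by
      funext k
      refine Fin.lastCases ?_ (fun k => ?_) k
      · simp [(Fin.castSucc_lt_last i).ne']
      · simp [Pi.single_apply]
    rw [h2, Matrix.single_one_vecMul, Matrix.single_one_vecMul] at h1
    exact congrFun h1 k
  have hF1 : ∀ Z ∈ Omega r r, ∀ i j : Fin r, F Z i.castSucc j.castSucc = Z i j :=
    fun Z hZ i j => by rw [hFrow Z hZ, appendZero_castSucc]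
  have hF2 : ∀ Z ∈ Omega r r, ∀ i : Fin r, F Z i.castSucc (Fin.last r) = 0 :=
    fun Z hZ i => by rw [hFrow Z hZ, appendZero_last]
  have hF3 : ∀ Z ∈ Omega r r, ∀ j : Fin r, F Z (Fin.last r) j.castSucc = 0 :=
    fun Z hZ j => last_row_eq_zero hFd hFm hF1 hZ j
  refine ⟨fun Z => F Z (Fin.last r) (Fin.last r), differentiableOn_matrix.1 hFd _ _,
    fun Z hZ => ?_, id, mobius T, isAut_id _, hT.isAut_mobius hTS, fun Z hZ => ?_⟩
  · have h1 := mem_Omega_iff_normSq.1 (hFm hZ) (Pi.single (Fin.last r) 1) (by simp)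
    rw [Matrix.single_one_vecMul] at h1
    simp [normSq, Fin.sum_univ_castSucc, hF3 Z hZ, Matrix.row, (Fin.castSucc_lt_last _).ne] at h1
    simpa using h1
  · have h1 : diagMap (fun Z => F Z (Fin.last r) (Fin.last r)) Z = F Z := by
      ext i j
      refine Fin.lastCases ?_ (fun i => ?_) i <;> refine Fin.lastCases ?_ (fun j => ?_) j
      · simp [diagMap]
      · simp [diagMap, hF3 Z hZ]
      · simp [diagMap, hF2 Z hZ]
      · simp [diagMap, hF1 Z hZ]
    simp only [Function.comp_apply, id, h1]
    exact (hS.mobius_mobius hST (hmaps hZ)).symm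

end LinearCase

open MvPolynomial

theorem RatMap.exists_linearMap {r s r' s' : ℕ} (g : RatMap r s r' s') (hg : g.degree = 1) :
    ∃ L : (Fin r ⊕ Fin s → ℂ) →ₗ[ℂ] (Fin r' ⊕ Fin s' → ℂ), ∀ v, L v = g.evalVec v := by
  refine ⟨LinearMap.pi fun k => ∑ v, (g.comp k).coeff (Finsupp.single v 1) • LinearMap.proj v,
    fun z => funext fun k => ?_⟩
  have h := g.homogeneous k
  rw [hg] at h
  rw [RatMap.evalVec]
  conv_rhs => rw [linear_of_isHomogeneous_one h]
  simp

theorem RatMap.degree_eq {r s r' s' : ℕ} (g : RatMap r s r' s') {k : Fin r' ⊕ Fin s'}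
    {e : (Fin r ⊕ Fin s) →₀ ℕ} {c : ℂ} (h : g.comp k = monomial e c) (hc : c ≠ 0) :
    g.degree = e.degree := by
  have h1 := g.homogeneous k
  rw [h] at h1
  have h2 := h1 (d := e) (by simpa using hc)
  rw [← h2, Finsupp.degree_eq_weight_one]
  rfl

theorem Intertwines.smul {r s r' s' : ℕ} {f : Matrix (Fin r) (Fin s) ℂ → Matrix (Fin r') (Fin s') ℂ}
    {G : (Fin r ⊕ Fin s → ℂ) → Fin r' ⊕ Fin s' → ℂ} (h : Intertwines f G) (a : ℂ) :
    Intertwines f (a • G) := by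
  intro Z hZ A hA
  have := congrArg (a • ·) (h Z hZ A hA)
  simp only [← Matrix.smul_vecMul] at this
  exact this

section LinearCase

variable {r : ℕ}

/-- The nonzero coefficient of `x_1` in `P` forces degree one, so `g` is linear; division by `√a`
makes it an isometry without affecting the intertwining relation. -/
theorem equivalent_diagMap_of_normPoly (hr : 1 ≤ r)
    {f : Matrix (Fin r) (Fin r) ℂ → Matrix (Fin (r + 1)) (Fin (r + 1)) ℂ}
    (hf : DifferentiableOn ℂ f (Omega r r)) (hmaps : Set.MapsTo f (Omega r r) (Omega (r + 1) (r + 1)))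
    {g : RatMap r r (r + 1) (r + 1)}
    {E : Fin (r + 1) ⊕ Fin (r + 1) → (Fin r ⊕ Fin r) →₀ ℕ} {c : Fin (r + 1) ⊕ Fin (r + 1) → ℂ}
    (hg : ∀ k, g.comp k = monomial (E k) (c k)) (hint : Intertwines f g.evalVec) {a : ℝ} (ha : 0 < a)
    (hP : monomialNormPoly E c = indefPoly r * C a) :
    ∃ h : Matrix (Fin r) (Fin r) ℂ → ℂ, DifferentiableOn ℂ h (Omega r r) ∧
      Set.MapsTo h (Omega r r) (Metric.ball 0 1) ∧
      MapEquivalent (Omega r r) (Omega (r + 1) (r + 1)) f (diagMap h) := by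
  obtain ⟨k, hk, hck⟩ := exists_of_coeff_pos (E := E) (c := c)
    (e := Finsupp.single (Sum.inl ⟨0, hr⟩) 1) (by
      rw [hP, mul_comm, coeff_C_mul, indefPoly_eq, coeff_linear_single]
      simpa [varSign] using ha)
  have hdeg : g.degree = 1 := by rw [g.degree_eq (hg _) hck, hk, Finsupp.degree_single]
  obtain ⟨L, hL⟩ := g.exists_linearMap hdeg
  have hform : ∀ v, form (L v) = a * form v := by
    intro v
    have h1 := eval_monomialNormPoly (E := E) (c := c) v
    rw [hP, map_mul, eval_C, eval_indefPoly] at h1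
    have h2 : L v = fun k => eval v (monomial (E k) (c k)) := by
      rw [hL]
      funext k
      rw [RatMap.evalVec, hg]
    rw [h2, ← h1, mul_comm]
    rfl
  refine equivalent_diagMap hf hmaps ((((√a)⁻¹ : ℝ) : ℂ) • L) (fun v => ?_) ?_
  · rw [LinearMap.smul_apply, form_smul, hform, Complex.norm_real, norm_inv, inv_pow,
      Real.norm_eq_abs, sq_abs, Real.sq_sqrt ha.le, inv_mul_cancel_left₀ ha.ne']
  · have : (L : (Fin r ⊕ Fin r → ℂ) → _) = g.evalVec := funext hL
    rw [LinearMap.coe_smul, this]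
    exact hint.smul _

end LinearCase

/-! ### Normal form of the components of `g`. -/

section Slots

open Classical in
/-- The components of a monomial map are determined up to order and phases by the norm. -/
theorem exists_slot_perm {σ : Type*} {n : ℕ} {E : Fin n ⊕ Fin n → σ →₀ ℕ} {c : Fin n ⊕ Fin n → ℂ}
    {e d : Fin n → σ →₀ ℕ} (he : Function.Injective e) (hd : Function.Injective d) {p q : Fin n → ℝ}
    (hp : ∀ i, 0 < p i) (hq : ∀ i, 0 < q i) (hep : ∀ i, coeff (e i) (monomialNormPoly E c) = p i)
    (hdq : ∀ i, coeff (d i) (monomialNormPoly E c) = -q i) :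
    ∃ π ρ : Equiv.Perm (Fin n), (∀ i, E (Sum.inl (π i)) = e i ∧ ‖c (Sum.inl (π i))‖ ^ 2 = p i) ∧
      ∀ i, E (Sum.inr (ρ i)) = d i ∧ ‖c (Sum.inr (ρ i))‖ ^ 2 = q i := by
  have hne : ∀ i j, e i ≠ d j := by
    intro i j h
    have h1 := hep i
    rw [h, hdq] at h1
    linarith [hp i, hq j]
  choose s hs using fun i => exists_of_coeff_pos (E := E) (c := c) (e := e i)
    (by rw [hep]; exact hp i)
  choose t ht using fun i => exists_of_coeff_neg (E := E) (c := c) (e := d i)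
    (by rw [hdq]; linarith [hq i])
  have hsi : Function.Injective s := fun i j h => he (by rw [← (hs i).1, ← (hs j).1, h])
  have hti : Function.Injective t := fun i j h => hd (by rw [← (ht i).1, ← (ht j).1, h])
  -- There are as many prescribed monomials of each sign as components, so every component is used
  -- exactly once and nothing merges or cancels.
  set π := Equiv.ofBijective s (Finite.injective_iff_bijective.1 hsi)
  set ρ := Equiv.ofBijective t (Finite.injective_iff_bijective.1 hti)
  have hπ : ∀ i, E (Sum.inl (π i)) = e i := fun i => (hs i).1
  have hρ : ∀ i, E (Sum.inr (ρ i)) = d i := fun i => (ht i).1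
  have hcoeff : ∀ x, coeff x (monomialNormPoly E c) =
      (∑ i, if e i = x then ‖c (Sum.inl (π i))‖ ^ 2 else 0) +
        ∑ i, if d i = x then -‖c (Sum.inr (ρ i))‖ ^ 2 else 0 := by
    intro x
    rw [coeff_monomialNormPoly, Fintype.sum_sum_type]
    congr 1
    · rw [← Equiv.sum_comp π]
      simp [hπ, varSign]
    · rw [← Equiv.sum_comp ρ]
      simp [hρ, varSign]
  refine ⟨π, ρ, fun i => ⟨hπ i, ?_⟩, fun i => ⟨hρ i, ?_⟩⟩
  · have h1 := hep i
    rw [hcoeff] at h1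
    simpa [he.eq_iff, (hne _ _).symm] using h1
  · have h1 := hdq i
    rw [hcoeff] at h1
    simpa [hd.eq_iff, hne] using h1

/-- After composition with an automorphism, the components of the monomial map take a normal
form. -/
theorem exists_normalization {r n : ℕ} {f : Matrix (Fin r) (Fin r) ℂ → Matrix (Fin n) (Fin n) ℂ}
    {E : Fin n ⊕ Fin n → (Fin r ⊕ Fin r) →₀ ℕ} {c : Fin n ⊕ Fin n → ℂ}
    (hint : Intertwines f fun z k => eval z (monomial (E k) (c k)))
    {e d : Fin n → (Fin r ⊕ Fin r) →₀ ℕ} (he : Function.Injective e) (hd : Function.Injective d)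
    {p q : Fin n → ℝ} {a : ℝ} (ha : 0 < a) (hp : ∀ i, 0 < p i) (hq : ∀ i, 0 < q i)
    (hep : ∀ i, coeff (e i) (monomialNormPoly E c) = a * p i)
    (hdq : ∀ i, coeff (d i) (monomialNormPoly E c) = -(a * q i)) :
    ∃ (A : Matrix (Fin n) (Fin n) ℂ → Matrix (Fin n) (Fin n) ℂ)
      (f₀ : Matrix (Fin r) (Fin r) ℂ → Matrix (Fin n) (Fin n) ℂ), IsAut (Omega n n) A ∧
      (ContinuousOn f (Omega r r) → ContinuousOn f₀ (Omega r r)) ∧ f = A ∘ f₀ ∧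
      Intertwines f₀ fun z => Sum.elim (fun i => (√(p i) : ℝ) * eval z (monomial (e i) 1))
        fun i => (√(q i) : ℝ) * eval z (monomial (d i) 1) := by
  obtain ⟨π, ρ, hπ, hρ⟩ := exists_slot_perm he hd (fun i => mul_pos ha (hp i))
    (fun i => mul_pos ha (hq i)) hep hdq
  have hsa : √a ≠ 0 := (Real.sqrt_pos.2 ha).ne'
  have phase : ∀ (w : ℂ) (x : ℝ), 0 < x → ‖w‖ ^ 2 = a * x →
      ∃ θ : ℂ, ‖θ‖ = 1 ∧ w = θ * ((√a : ℝ) * (√x : ℝ)) := by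
    intro w x hx h
    have h1 : ‖w‖ = √a * √x := by
      rw [← Real.sqrt_mul ha.le, ← h, Real.sqrt_sq (norm_nonneg w)]
    have h2 : √a * √x ≠ 0 := mul_ne_zero hsa (Real.sqrt_pos.2 hx).ne'
    refine ⟨w / ((√a * √x : ℝ) : ℂ), ?_, ?_⟩
    · rw [norm_div, Complex.norm_real, ← h1, norm_norm, div_self]
      rwa [h1]
    · rw [← Complex.ofReal_mul, div_mul_cancel₀]
      exact_mod_cast h2
  choose θ hθ hcθ using fun i => phase _ _ (hp i) (hπ i).2
  choose φ hφ hcφ using fun i => phase _ _ (hq i) (hρ i).2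
  have hθ0 : ∀ i, θ i ≠ 0 := fun i h => by simpa [h] using hθ i
  have hφ0 : ∀ i, φ i ≠ 0 := fun i h => by simpa [h] using hφ i
  refine ⟨permPhase π⁻¹ ρ⁻¹ (fun i => (θ (π⁻¹ i))⁻¹) (fun j => φ (ρ⁻¹ j)),
    fun Z => permPhase π ρ θ (fun j => (φ j)⁻¹) (f Z),
    isAut_permPhase _ _ (by simp [hθ]) (by simp [hφ]),
    fun hf => (differentiable_permPhase π ρ).continuous.comp_continuousOn hf, ?_, ?_⟩
  · funext Z
    rw [Function.comp_apply, permPhase_permPhase]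
    symm
    convert permPhase_one (f Z) using 1
    congr 1 <;> simp [hθ0, hφ0]
  · intro Z hZ A hA
    have h1 := hint Z hZ A hA
    set z := Sum.elim A (Matrix.vecMul A Z)
    funext j
    have h2 := congrFun h1 (ρ j)
    simp only [Matrix.vecMul, dotProduct, Sum.elim_inl, Sum.elim_inr, permPhase,
      Matrix.of_apply] at h2 ⊢
    rw [← Equiv.sum_comp π] at h2
    have h3 : ∀ (e : (Fin r ⊕ Fin r) →₀ ℕ) (w y : ℂ),
        eval z (monomial e (w * y)) = w * y * eval z (monomial e 1) := fun e w y => by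
      simp [eval_monomial]
    simp only [(hπ _).1, (hρ _).1, hcθ, hcφ, h3] at h2
    -- The common scale `√a` and the column phase `φ j` are the only differences from the relation
    -- for `f`.
    have h4 : (√a : ℂ) * φ j ≠ 0 := mul_ne_zero (by exact_mod_cast hsa) (hφ0 j)
    refine mul_left_cancel₀ h4 ?_
    rw [Finset.mul_sum]
    refine Eq.trans (Finset.sum_congr rfl fun i _ => ?_) (h2.trans (by ring))
    have := hφ0 j
    field_simp

end Slots

open MvPolynomial

/-! ### The two quadratic maps. -/

section QuadraticCases

/-- The monomial `x_v x_w` as an exponent. -/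
noncomputable def pairExp {σ : Type*} (v w : σ) : σ →₀ ℕ := Finsupp.single v 1 + Finsupp.single w 1

theorem eval_pairExp {σ : Type*} (z : σ → ℂ) (v w : σ) :
    eval z (monomial (pairExp v w) 1) = z v * z w := by
  have : (monomial (pairExp v w) 1 : MvPolynomial σ ℂ) = X v * X w := by
    simp [pairExp, X, monomial_mul]
  rw [this, map_mul, eval_X, eval_X]

theorem injective_pairExp {σ : Type*} {e : Fin 3 → σ →₀ ℕ} {v : σ} (h0 : e 0 v = 2) (h1 : e 1 v = 1)
    (h2 : e 2 v = 0) : Function.Injective e := by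
  have h : Function.Injective fun k => e k v := by
    have : (fun k => e k v) = ![2, 1, 0] := by
      funext k
      fin_cases k <;> simp [h0, h1, h2]
    rw [this]
    decide
  exact fun k l hkl => h (congrArg (· v) hkl)

theorem coeff_indefPoly_mul_self {r : ℕ} (q : Fin r ⊕ Fin r → ℝ) (v : Fin r ⊕ Fin r) :
    coeff (pairExp v v) (indefPoly r * ∑ v, C (q v) * X v) = varSign v * q v := by
  rw [indefPoly_eq]
  exact coeff_linear_mul_linear_self _ _ _

theorem coeff_indefPoly_mul {r : ℕ} (q : Fin r ⊕ Fin r → ℝ) {v w : Fin r ⊕ Fin r} (h : v ≠ w) :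
    coeff (pairExp v w) (indefPoly r * ∑ v, C (q v) * X v) = varSign v * q w + varSign w * q v := by
  rw [indefPoly_eq]
  exact coeff_linear_mul_linear _ _ h

theorem castMap_rfl (F : Matrix (Fin 2) (Fin 2) ℂ → Matrix (Fin 3) (Fin 3) ℂ) :
    castMap rfl F = F := by
  funext Z
  rfl

variable {f : Matrix (Fin 2) (Fin 2) ℂ → Matrix (Fin 3) (Fin 3) ℂ}
  {E : Fin 3 ⊕ Fin 3 → (Fin 2 ⊕ Fin 2) →₀ ℕ} {c : Fin 3 ⊕ Fin 3 → ℂ}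

/-- Here `P` is `a` times `(x_0 + x_1)² - (y_0 + y_1)²`, so `g` is, up to order, phases and scale,
the normalized Veronese map in the `x` and in the `y`. The coefficient `2` of the mixed terms is the
source of `√2`. -/
theorem equivalent_quadMapB (hint : Intertwines f fun z k => eval z (monomial (E k) (c k))) {a : ℝ} (ha : 0 < a)
    (hP : monomialNormPoly E c = indefPoly 2 * (C a * ∑ v, X v)) :
    MapEquivalent (Omega 2 2) (Omega 3 3) f quadMapB := by
  have hP' : monomialNormPoly E c = indefPoly 2 * ∑ v, C ((fun _ => a) v) * X v := by
    rw [hP, Finset.mul_sum _ _ (C a)]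
  have hself := fun v => hP' ▸ coeff_indefPoly_mul_self (fun _ => a) v
  have hpair := fun {v w} (h : v ≠ w) => hP' ▸ coeff_indefPoly_mul (fun _ => a) h
  obtain ⟨A, f₀, hA, -, rfl, hint₀⟩ := exists_normalization hint
    (e := ![pairExp (Sum.inl 0) (Sum.inl 0), pairExp (Sum.inl 0) (Sum.inl 1),
      pairExp (Sum.inl 1) (Sum.inl 1)])
    (d := ![pairExp (Sum.inr 0) (Sum.inr 0), pairExp (Sum.inr 0) (Sum.inr 1),
      pairExp (Sum.inr 1) (Sum.inr 1)])
    (injective_pairExp (v := Sum.inl 0) (by simp [pairExp]) (by simp [pairExp])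
      (by simp [pairExp]))
    (injective_pairExp (v := Sum.inr 0) (by simp [pairExp]) (by simp [pairExp])
      (by simp [pairExp]))
    (p := ![1, 2, 1]) (q := ![1, 2, 1]) ha
    (by intro i; fin_cases i <;> simp) (by intro i; fin_cases i <;> simp)
    (by
      intro i
      fin_cases i <;> simp [hself, hpair, varSign]
      ring)
    (by
      intro i
      fin_cases i <;> simp [hself, hpair, varSign]
      ring)
  refine ⟨id, A, isAut_id _, hA, fun Z hZ => congrArg A ?_⟩
  have h2 : ((√2 : ℝ) : ℂ) * (√2 : ℝ) = 2 := by
    rw [← Complex.ofReal_mul, Real.mul_self_sqrt zero_le_two]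
    norm_num
  have hs : ((√2 : ℝ) : ℂ) ≠ 0 := fun h => by simp [h] at h2
  have key : ∀ x y : ℂ, ![x, y] ≠ 0 → ∀ j, x ^ 2 * (f₀ Z 0 j - quadMapB Z 0 j) +
      (√2 : ℝ) * x * y * (f₀ Z 1 j - quadMapB Z 1 j) + y ^ 2 * (f₀ Z 2 j - quadMapB Z 2 j) = 0 := by
    intro x y hxy j
    have h := congrFun (hint₀ Z hZ ![x, y] hxy) j
    simp only [Matrix.vecMul, dotProduct, Sum.elim_inl, Sum.elim_inr, Fin.sum_univ_three] at h
    fin_cases j <;>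
      simp [eval_pairExp, Matrix.vecMul, dotProduct, quadMapB] at h ⊢
    · linear_combination h - x * y * Z 0 0 * Z 1 0 * h2
    · linear_combination h
    · linear_combination h - x * y * Z 0 1 * Z 1 1 * h2
  -- The vectors `(1, 0)`, `(0, 1)` and `(1, 1)` separate the three rows.
  have h0 : ∀ j, f₀ Z 0 j = quadMapB Z 0 j := fun j => by
    simpa [sub_eq_zero] using key 1 0 (by simp) j
  have h3 : ∀ j, f₀ Z 2 j = quadMapB Z 2 j := fun j => by
    simpa [sub_eq_zero] using key 0 1 (by simp) j
  have h1 : ∀ j, f₀ Z 1 j = quadMapB Z 1 j := fun j => by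
    simpa [sub_eq_zero, h0, h3, hs] using key 1 1 (by simp) j
  ext i j
  fin_cases i
  · exact h0 j
  · exact h1 j
  · exact h3 j

-- With the distinguished indices moved to `0`, `P` is `a` times `x_0² + x_0 x_1 + x_1 y_0 - y_0² -
-- y_0 y_1 - x_0 y_1`, the term `x_0 y_0` cancelling. The third component `x_1 y_0` of `g`, at `(0,
-- 1)` and its image under `Z`, is the lower left entry of `Z`; the third row of `f` is thus first
-- found where this entry is nonzero, then everywhere by continuity.
open Filter Topology in
theorem equivalent_quadMapA (hf : ContinuousOn f (Omega 2 2))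
    (hint : Intertwines f fun z k => eval z (monomial (E k) (c k))) {a : ℝ} (ha : 0 < a)
    {i j : Fin 2}
    (hP : monomialNormPoly E c = indefPoly 2 * (C a * (X (Sum.inl i) + X (Sum.inr j)))) :
    MapEquivalent (Omega 2 2) (Omega 3 3) f quadMapA := by
  obtain ⟨α, rfl⟩ : ∃ α : Equiv.Perm (Fin 2), α 0 = i := ⟨Equiv.swap 0 i, by simp⟩
  obtain ⟨β, rfl⟩ : ∃ β : Equiv.Perm (Fin 2), β 0 = j := ⟨Equiv.swap 0 j, by simp⟩
  set q : Fin 2 ⊕ Fin 2 → ℝ := Sum.elim (Pi.single (α 0) a) (Pi.single (β 0) a) with hq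
  have hP' : monomialNormPoly E c = indefPoly 2 * ∑ v, C (q v) * X v := by
    rw [hP, mul_add, Fintype.sum_sum_type]
    congr 2
    · rw [Finset.sum_eq_single (α 0)] <;> simp +contextual [hq]
    · rw [Finset.sum_eq_single (β 0)] <;> simp +contextual [hq]
  have hself := fun v => hP' ▸ coeff_indefPoly_mul_self q v
  have hpair := fun {v w} (h : v ≠ w) => hP' ▸ coeff_indefPoly_mul q h
  obtain ⟨A, f₀, hA, hf₀, rfl, hint₀⟩ := exists_normalization hint
    (e := ![pairExp (Sum.inl (α 0)) (Sum.inl (α 0)), pairExp (Sum.inl (α 0)) (Sum.inl (α 1)),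
      pairExp (Sum.inl (α 1)) (Sum.inr (β 0))])
    (d := ![pairExp (Sum.inr (β 0)) (Sum.inr (β 0)), pairExp (Sum.inr (β 0)) (Sum.inr (β 1)),
      pairExp (Sum.inl (α 0)) (Sum.inr (β 1))])
    (injective_pairExp (v := Sum.inl (α 0)) (by simp [pairExp]) (by simp [pairExp])
      (by simp [pairExp]))
    (injective_pairExp (v := Sum.inr (β 0)) (by simp [pairExp]) (by simp [pairExp])
      (by simp [pairExp]))
    (p := fun _ => 1) (q := fun _ => 1) ha (by simp) (by simp)
    (by
      intro i
      fin_cases i <;> simp [hself, hpair, varSign, hq])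
    (by
      intro i
      fin_cases i <;> simp [hself, hpair, varSign, hq])
  replace hf₀ := hf₀ hf
  set τ := permPhase α β (fun _ => 1) fun _ => 1 with hτ
  have hτapp : ∀ Z i j, τ Z i j = Z (α i) (β j) := fun Z i j => by simp [hτ, permPhase]
  have key : ∀ Z ∈ Omega 2 2, ∀ x y : ℂ, ![x, y] ≠ 0 → ∀ j,
      x ^ 2 * (f₀ Z 0 j - quadMapA (τ Z) 0 j) + x * y * (f₀ Z 1 j - quadMapA (τ Z) 1 j) +
        y * (x * τ Z 0 0 + y * τ Z 1 0) * (f₀ Z 2 j - quadMapA (τ Z) 2 j) = 0 := by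
    intro Z hZ x y hxy j
    have h := congrFun (hint₀ Z hZ (![x, y] ∘ α.symm) fun h => hxy (by
      funext i
      simpa using congrFun h (α i))) j
    have hv : ∀ j, Matrix.vecMul (![x, y] ∘ α.symm) Z (β j) = x * τ Z 0 j + y * τ Z 1 j := by
      intro j
      rw [Matrix.vecMul, dotProduct, ← Equiv.sum_comp α]
      simp [hτapp]
    have hsum : ∀ (u : Fin 3 → ℂ) (M : Matrix (Fin 3) (Fin 3) ℂ) j,
        Matrix.vecMul u M j = u 0 * M 0 j + u 1 * M 1 j + u 2 * M 2 j := fun u M j => by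
      rw [Matrix.vecMul, dotProduct, Fin.sum_univ_three]
    rw [hsum] at h
    fin_cases j <;> simp [eval_pairExp, hv, quadMapA] at h ⊢ <;> linear_combination h
  have hne : ∀ Z ∈ Omega 2 2, τ Z 1 0 ≠ 0 → f₀ Z = quadMapA (τ Z) := by
    intro Z hZ hz
    have h0 : ∀ j, f₀ Z 0 j = quadMapA (τ Z) 0 j := fun j => by
      simpa [sub_eq_zero] using key Z hZ 1 0 (by simp) j
    have h2 : ∀ j, f₀ Z 2 j = quadMapA (τ Z) 2 j := fun j => by
      simpa [sub_eq_zero, hz] using key Z hZ 0 1 (by simp) j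
    have h1 : ∀ j, f₀ Z 1 j = quadMapA (τ Z) 1 j := fun j => by
      simpa [sub_eq_zero, h0, h2] using key Z hZ 1 1 (by simp) j
    ext i j
    fin_cases i
    · exact h0 j
    · exact h1 j
    · exact h2 j
  have hquad : Continuous quadMapA := by
    refine continuous_matrix fun i j => ?_
    have h : ∀ i j, Continuous fun Z : Matrix (Fin 2) (Fin 2) ℂ => Z i j := fun i j =>
      continuous_id.matrix_elem i j
    have := h 0 0
    have := h 0 1
    have := h 1 0
    have := h 1 1
    fin_cases i <;> fin_cases j <;> simp [quadMapA] <;> fun_prop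
  refine ⟨τ, A, isAut_permPhase _ _ (by simp) (by simp), hA, fun Z hZ => congrArg A ?_⟩
  by_cases hz : τ Z 1 0 = 0
  -- A perturbation of the one critical entry reaches the dense set where the identity is known.
  · set γ : ℂ → Matrix (Fin 2) (Fin 2) ℂ := fun t => Z + t • Matrix.single (α 1) (β 0) 1
    have hγ : Continuous γ := by fun_prop
    have hγ0 : γ 0 = Z := by simp [γ]
    have h1 : Tendsto (fun t => f₀ (γ t)) (𝓝[≠] 0) (𝓝 (f₀ Z)) := by
      have : ContinuousAt (fun t => f₀ (γ t)) 0 := by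
        refine ContinuousAt.comp (f := γ) ?_ hγ.continuousAt
        rw [hγ0]
        exact hf₀.continuousAt (isOpen_Omega.mem_nhds hZ)
      have h := this.tendsto
      rw [hγ0] at h
      exact h.mono_left nhdsWithin_le_nhds
    have h2 : Tendsto (fun t => quadMapA (τ (γ t))) (𝓝[≠] 0) (𝓝 (quadMapA (τ Z))) := by
      have hτc : Continuous τ := (differentiable_permPhase α β).continuous
      have h := ((hquad.comp hτc).comp hγ).tendsto 0
      simp only [Function.comp_apply, hγ0] at h
      exact h.mono_left nhdsWithin_le_nhds
    refine tendsto_nhds_unique (h1.congr' ?_) h2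
    have h3 : ∀ᶠ t in 𝓝 (0 : ℂ), γ t ∈ Omega 2 2 := by
      refine hγ.continuousAt.eventually ?_
      rw [hγ0]
      exact isOpen_Omega.mem_nhds hZ
    filter_upwards [nhdsWithin_le_nhds h3, self_mem_nhdsWithin] with t ht ht0
    refine hne _ ht ?_
    rw [hτapp] at hz
    simpa [hτapp, γ, hz] using ht0
  · exact hne Z hZ hz

end QuadraticCases

end TypeI

/-! ### The theorem. -/

open TypeI in
theorem theorem1p2 (r : ℕ) (hr : 2 ≤ r)
    (f : Matrix (Fin r) (Fin r) ℂ → Matrix (Fin (r + 1)) (Fin (r + 1)) ℂ)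
    (hf : IsProperHolo (Omega r r) (Omega (r + 1) (r + 1)) f)
    (hpres : PreservesSharp f)
    (g : RatMap r r (r + 1) (r + 1)) (hfg : Induces f g)
    (hproper : g.IsProper) (hmon : g.IsMonomial) (hQ : g.QuotientCondition) :
    (∃ h : Matrix (Fin r) (Fin r) ℂ → ℂ, DifferentiableOn ℂ h (Omega r r) ∧
        Set.MapsTo h (Omega r r) (Metric.ball 0 1) ∧
        MapEquivalent (Omega r r) (Omega (r + 1) (r + 1)) f (diagMap h)) ∨
      (∃ h2 : r = 2,
        MapEquivalent (Omega r r) (Omega (r + 1) (r + 1)) f (castMap h2 quadMapA)) ∨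
      (∃ h2 : r = 2,
        MapEquivalent (Omega r r) (Omega (r + 1) (r + 1)) f (castMap h2 quadMapB)) := by
  have hc := hf.1.continuousOn
  have hint := hfg.intertwines hc
  obtain ⟨E, c, hg⟩ := hmon.exists_data
  have hint' : Intertwines f fun z k => MvPolynomial.eval z (MvPolynomial.monomial (E k) (c k)) := by
    convert hint using 1
    funext z k
    rw [RatMap.evalVec, hg]
  obtain ⟨a, ha, hP | ⟨rfl, i, j, hP⟩ | ⟨rfl, hP⟩⟩ := hproper.monomial_classification hr hQ hg
  · exact Or.inl (equivalent_diagMap_of_normPoly (by omega) hf.1 hf.2.1 hg hint ha hP)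
  · refine Or.inr (Or.inl ⟨rfl, ?_⟩)
    rw [castMap_rfl]
    exact equivalent_quadMapA hc hint' ha hP
  · refine Or.inr (Or.inr ⟨rfl, ?_⟩)
    rw [castMap_rfl]
    exact equivalent_quadMapB hint' ha hP
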